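/- Let $I,J\subseteq\mathbb R$ be nonempty open intervals and let $f=f(t,x)$ be a smooth nonvanishing real function on $I\times J$. Consider the generalized Burgers equation $\mathcal L_f$: $u_t+uu_x+f(t,x)u_{xx}=0$. For a system $\mathcal E$ of differential equations in $(t,x)\in I\times J$, a conserved vector is a pair $(F^t,F^x)$ of differential functions (smooth functions of $t$, $x$ and finitely many derivatives of the dependent variables) with ${\rm D}_tF^t+{\rm D}_xF^x=0$ on the manifold defined by $\mathcal E$ and all its differential consequences in the infinite jet space. It is trivial if on this manifold it coincides with a pair of differential functions whose total divergence vanishes identically. A (local) conservation law is a class of conserved vectors modulo trivial ones. A characteristic of a conservation law of a single equation $E=0$ is a differential function $\mu$ such that ${\rm D}_tF^t+{\rm D}_xF^x=\mu E$ identically for some conserved vector $(F^t,F^x)$ of this conservation law; it is reduced if it does not involve derivatives with respect to $t$. 1. The equation $\mathcal L_f$ has a nontrivial (nonzero) local conservation law if and only if $f_{xxx}=0$ on $I\times J$. 2. Suppose that $f_{xxx}=0$. Then the space of conservation laws of $\mathcal L_f$ is one-dimensional. Moreover, the function $f_{xx}$, which depends only on $t$, has an antiderivative with respect to $t$ on $I$,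 and for each such antiderivative $\int f_{xx}\,dt$ there is a nonzero conservation law $C$ of $\mathcal L_f$ such that, for every $a\in\mathbb R$, the only reduced characteristic of $aC$ is $a\lambda$, where $\lambda=e^{\int f_{xx}\,dt}$. 3. Suppose that $f_{xxx}=0$, and let $\lambda=\lambda(t)$ be any nonvanishing function on $I$ with $\lambda_t=f_{xx}\lambda$. The potential conservation laws of $\mathcal L_f$ are the local conservation laws of the potential system $$v_x=\lambda u,\qquad v_t=-\lambda\left(\tfrac12u^2+fu_x-f_xu\right).$$ Regarding differential functions of $v$ as differential functions of $(u,v)$ induces a linear isomorphism from the space of conservation laws of the potential equation $$v_t+\tfrac1{2\lambda}v_x^2+fv_{xx}-f_xv_x=0$$ onto the space of conservation laws of the potential system. (a) If $f$ is nonconstant, in the local sense that it is not constant on any nonempty open subset of $I\times J$, then the potential system and the potential equation have no nonzero conservation laws. (b) If $f$ is constant (so that $\lambda$ is constant as well), then each conservation law of the potential equation has exactly one reduced characteristic, which is of the form $$\mu=\psi(t,x)\,e^{v/(2f\lambda)}$$ with a smooth solution $\psi$ of the linear heat equation $\psi_t=f\psi_{xx}$ on $I\times J$; conversely, for each such $\psi$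 there is exactly one conservation law of the potential equation with reduced characteristic $\psi e^{v/(2f\lambda)}$. In particular, for $\lambda=1$ the reduced characteristics are precisely the functions $\psi e^{v/(2f)}$. -/

import Mathlib

open Set
open scoped ContDiff

noncomputable section

namespace GenBurgers

/-! ### Jets, differential functions and total derivatives

There are two independent variables `(t, x)` and `n` dependent variables. -/

/-- Points of the infinite jet space: `j.1 = (t, x)`, and `j.2 (i, a, b)` is the coordinate that stands for
`∂ₜᵃ ∂ₓᵇ` of the `i`-th dependent variable. -/
abbrev Jet (n : ℕ) : Type := (ℝ × ℝ) × (Fin n × ℕ × ℕ → ℝ)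

/-- Differential functions over `Ω`: smooth functions of `(t, x) ∈ Ω` and of finitely many jet coordinates.
Values over points outside of `Ω` are irrelevant throughout. -/
def IsDiffFun {n : ℕ} (Ω : TopologicalSpace.Opens (ℝ × ℝ)) (F : Jet n → ℝ) : Prop :=
  ∃ (s : Finset (Fin n × ℕ × ℕ)) (G : (ℝ × ℝ) × (s → ℝ) → ℝ),
    ContDiffOn ℝ ∞ G ((Ω : Set (ℝ × ℝ)) ×ˢ univ) ∧
    ∀ j : Jet n, j.1 ∈ Ω → F j = G (j.1, fun c => j.2 c)

/-- `∂F/∂t` on the jet space. -/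
def partialT {n : ℕ} (F : Jet n → ℝ) (j : Jet n) : ℝ :=
  deriv (fun s : ℝ => F ((s, j.1.2), j.2)) j.1.1

/-- `∂F/∂x` on the jet space. -/
def partialX {n : ℕ} (F : Jet n → ℝ) (j : Jet n) : ℝ :=
  deriv (fun s : ℝ => F ((j.1.1, s), j.2)) j.1.2

/-- The partial derivative of `F` with respect to the jet coordinate `c`. -/
def partialU {n : ℕ} (c : Fin n × ℕ × ℕ) (F : Jet n → ℝ) (j : Jet n) : ℝ :=
  deriv (fun s : ℝ => F (j.1, Function.update j.2 c s)) (j.2 c)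

/-- The total derivative `D_t`. For a differential function the sum has finitely many nonzero terms. -/
def totalT {n : ℕ} (F : Jet n → ℝ) (j : Jet n) : ℝ :=
  partialT F j + ∑ᶠ c : Fin n × ℕ × ℕ, partialU c F j * j.2 (c.1, c.2.1 + 1, c.2.2)

/-- The total derivative `D_x`. -/
def totalX {n : ℕ} (F : Jet n → ℝ) (j : Jet n) : ℝ :=
  partialX F j + ∑ᶠ c : Fin n × ℕ × ℕ, partialU c F j * j.2 (c.1, c.2.1, c.2.2 + 1)

/-- The total divergence `D_t F.1 + D_x F.2`. -/
def totalDiv {n : ℕ} (F : (Jet n → ℝ) × (Jet n → ℝ)) (j : Jet n) : ℝ :=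
  totalT F.1 j + totalX F.2 j

section helpers

variable {n : ℕ} {Ω : TopologicalSpace.Opens (ℝ × ℝ)}

theorem IsDiffFun.zero : IsDiffFun Ω (0 : Jet n → ℝ) :=
  ⟨∅, fun _ => 0, contDiffOn_const, fun _ _ => rfl⟩

theorem IsDiffFun.add {F G : Jet n → ℝ} (hF : IsDiffFun Ω F) (hG : IsDiffFun Ω G) :
    IsDiffFun Ω (F + G) := by
  classical
  obtain ⟨s, A, hA, hFA⟩ := hF
  obtain ⟨r, B, hB, hGB⟩ := hG
  refine ⟨s ∪ r, fun p => A (p.1, fun c => p.2 ⟨c, Finset.mem_union_left _ c.2⟩) +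
    B (p.1, fun c => p.2 ⟨c, Finset.mem_union_right _ c.2⟩), ?_, ?_⟩
  · refine ContDiffOn.add (hA.comp (ContDiff.contDiffOn (by fun_prop)) ?_)
      (hB.comp (ContDiff.contDiffOn (by fun_prop)) ?_)
    · exact fun p hp => ⟨hp.1, mem_univ _⟩
    · exact fun p hp => ⟨hp.1, mem_univ _⟩
  · intro j hj
    simp [hFA j hj, hGB j hj]

theorem IsDiffFun.smul {F : Jet n → ℝ} (a : ℝ) (hF : IsDiffFun Ω F) : IsDiffFun Ω (a • F) := by
  obtain ⟨s, A, hA, hFA⟩ := hF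
  refine ⟨s, fun p => a * A p, contDiffOn_const.mul hA, ?_⟩
  intro j hj
  simp [hFA j hj]

theorem contDiffAt_of_mem {s : Finset (Fin n × ℕ × ℕ)} {G : (ℝ × ℝ) × (s → ℝ) → ℝ}
    (hG : ContDiffOn ℝ ∞ G ((Ω : Set (ℝ × ℝ)) ×ˢ univ)) {p : (ℝ × ℝ) × (s → ℝ)} (hp : p.1 ∈ Ω) :
    DifferentiableAt ℝ G p :=
  (hG.contDiffAt ((Ω.isOpen.prod isOpen_univ).mem_nhds ⟨hp, mem_univ _⟩)).differentiableAt (by simp)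

theorem IsDiffFun.differentiableAt_t {F : Jet n → ℝ} (hF : IsDiffFun Ω F) {j : Jet n} (hj : j.1 ∈ Ω) :
    DifferentiableAt ℝ (fun s : ℝ => F ((s, j.1.2), j.2)) j.1.1 := by
  obtain ⟨s, A, hA, hFA⟩ := hF
  have h1 : DifferentiableAt ℝ (fun r : ℝ => A ((r, j.1.2), fun c => j.2 c)) j.1.1 := by
    refine DifferentiableAt.comp (𝕜 := ℝ) j.1.1
      (g := A) (f := fun r : ℝ => (((r, j.1.2), fun c : s => j.2 c) : (ℝ × ℝ) × (s → ℝ))) ?_ (by fun_prop)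
    exact contDiffAt_of_mem hA hj
  refine h1.congr_of_eventuallyEq ?_
  have h2 : ∀ᶠ r : ℝ in nhds j.1.1, (r, j.1.2) ∈ Ω :=
    (Continuous.continuousAt (by fun_prop : Continuous fun r : ℝ => (r, j.1.2))).eventually
      (Ω.isOpen.mem_nhds hj)
  filter_upwards [h2] with r hr
  exact hFA ((r, j.1.2), j.2) hr

theorem IsDiffFun.differentiableAt_x {F : Jet n → ℝ} (hF : IsDiffFun Ω F) {j : Jet n} (hj : j.1 ∈ Ω) :
    DifferentiableAt ℝ (fun s : ℝ => F ((j.1.1, s), j.2)) j.1.2 := by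
  obtain ⟨s, A, hA, hFA⟩ := hF
  have h1 : DifferentiableAt ℝ (fun r : ℝ => A ((j.1.1, r), fun c => j.2 c)) j.1.2 := by
    refine DifferentiableAt.comp (𝕜 := ℝ) j.1.2
      (g := A) (f := fun r : ℝ => (((j.1.1, r), fun c : s => j.2 c) : (ℝ × ℝ) × (s → ℝ))) ?_ (by fun_prop)
    exact contDiffAt_of_mem hA hj
  refine h1.congr_of_eventuallyEq ?_
  have h2 : ∀ᶠ r : ℝ in nhds j.1.2, (j.1.1, r) ∈ Ω :=
    (Continuous.continuousAt (by fun_prop : Continuous fun r : ℝ => (j.1.1, r))).eventually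
      (Ω.isOpen.mem_nhds hj)
  filter_upwards [h2] with r hr
  exact hFA ((j.1.1, r), j.2) hr

theorem IsDiffFun.differentiableAt_u {F : Jet n → ℝ} (hF : IsDiffFun Ω F) {j : Jet n} (hj : j.1 ∈ Ω)
    (c : Fin n × ℕ × ℕ) :
    DifferentiableAt ℝ (fun s : ℝ => F (j.1, Function.update j.2 c s)) (j.2 c) := by
  obtain ⟨s, A, hA, hFA⟩ := hF
  have h0 : (fun r : ℝ => F (j.1, Function.update j.2 c r)) =
      fun r : ℝ => A (j.1, fun d => Function.update j.2 c r d) := by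
    funext r
    exact hFA (j.1, Function.update j.2 c r) hj
  rw [h0]
  refine DifferentiableAt.comp (𝕜 := ℝ) (j.2 c)
    (g := A) (f := fun r : ℝ => ((j.1, fun d : s => Function.update j.2 c r d) : (ℝ × ℝ) × (s → ℝ))) ?_ ?_
  · exact contDiffAt_of_mem hA hj
  · refine (differentiableAt_const _).prodMk (differentiableAt_pi.2 fun d => ?_)
    by_cases h : (d : Fin n × ℕ × ℕ) = c
    · subst h; simp
    · simp [Function.update_of_ne h]

theorem IsDiffFun.finite_support {F : Jet n → ℝ} (hF : IsDiffFun Ω F) {j : Jet n} (hj : j.1 ∈ Ω)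
    (g : Fin n × ℕ × ℕ → ℝ) :
    (Function.support fun c => partialU c F j * g c).Finite := by
  obtain ⟨s, A, hA, hFA⟩ := hF
  refine s.finite_toSet.subset fun c hc => ?_
  by_contra hcs
  refine hc ?_
  have h0 : (fun r : ℝ => F (j.1, Function.update j.2 c r)) = fun _ : ℝ => A (j.1, fun d => j.2 d) := by
    funext r
    rw [hFA (j.1, Function.update j.2 c r) hj]
    congr 2
    funext d
    refine Function.update_of_ne (fun h => hcs ?_) _ _
    rw [← h]
    exact d.2
  simp [partialU, h0]

theorem totalT_add {F G : Jet n → ℝ} (hF : IsDiffFun Ω F) (hG : IsDiffFun Ω G) {j : Jet n}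
    (hj : j.1 ∈ Ω) : totalT (F + G) j = totalT F j + totalT G j := by
  have h1 : partialT (F + G) j = partialT F j + partialT G j :=
    deriv_fun_add (hF.differentiableAt_t hj) (hG.differentiableAt_t hj)
  have h2 : ∀ c, partialU c (F + G) j = partialU c F j + partialU c G j := fun c =>
    deriv_fun_add (hF.differentiableAt_u hj c) (hG.differentiableAt_u hj c)
  simp only [totalT, h1, h2, add_mul]
  rw [finsum_add_distrib (hF.finite_support hj _) (hG.finite_support hj _)]
  ring

theorem totalX_add {F G : Jet n → ℝ} (hF : IsDiffFun Ω F) (hG : IsDiffFun Ω G) {j : Jet n}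
    (hj : j.1 ∈ Ω) : totalX (F + G) j = totalX F j + totalX G j := by
  have h1 : partialX (F + G) j = partialX F j + partialX G j :=
    deriv_fun_add (hF.differentiableAt_x hj) (hG.differentiableAt_x hj)
  have h2 : ∀ c, partialU c (F + G) j = partialU c F j + partialU c G j := fun c =>
    deriv_fun_add (hF.differentiableAt_u hj c) (hG.differentiableAt_u hj c)
  simp only [totalX, h1, h2, add_mul]
  rw [finsum_add_distrib (hF.finite_support hj _) (hG.finite_support hj _)]
  ring

theorem totalT_smul (a : ℝ) (F : Jet n → ℝ) (j : Jet n) : totalT (a • F) j = a * totalT F j := by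
  have h1 : partialT (a • F) j = a * partialT F j := deriv_const_mul_field a
  have h2 : ∀ c, partialU c (a • F) j = a * partialU c F j := fun c => deriv_const_mul_field a
  simp only [totalT, h1, h2, mul_add, mul_assoc]
  rw [← smul_eq_mul a (finsum _), smul_finsum]
  simp only [smul_eq_mul]

theorem totalX_smul (a : ℝ) (F : Jet n → ℝ) (j : Jet n) : totalX (a • F) j = a * totalX F j := by
  have h1 : partialX (a • F) j = a * partialX F j := deriv_const_mul_field a
  have h2 : ∀ c, partialU c (a • F) j = a * partialU c F j := fun c => deriv_const_mul_field a
  simp only [totalX, h1, h2, mul_add, mul_assoc]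
  rw [← smul_eq_mul a (finsum _), smul_finsum]
  simp only [smul_eq_mul]

theorem totalDiv_add {F G : (Jet n → ℝ) × (Jet n → ℝ)} (hF1 : IsDiffFun Ω F.1) (hF2 : IsDiffFun Ω F.2)
    (hG1 : IsDiffFun Ω G.1) (hG2 : IsDiffFun Ω G.2) {j : Jet n} (hj : j.1 ∈ Ω) :
    totalDiv (F + G) j = totalDiv F j + totalDiv G j := by
  simp only [totalDiv, Prod.fst_add, Prod.snd_add, totalT_add hF1 hG1 hj, totalX_add hF2 hG2 hj]
  ring

theorem totalDiv_smul (a : ℝ) (F : (Jet n → ℝ) × (Jet n → ℝ)) (j : Jet n) :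
    totalDiv (a • F) j = a * totalDiv F j := by
  simp only [totalDiv, Prod.smul_fst, Prod.smul_snd, totalT_smul, totalX_smul]
  ring

theorem totalDiv_zero (j : Jet n) : totalDiv (0 : (Jet n → ℝ) × (Jet n → ℝ)) j = 0 := by
  have h := totalDiv_smul 0 (0 : (Jet n → ℝ) × (Jet n → ℝ)) j
  simpa using h

end helpers

/-! ### Conservation laws of a system of differential equations

A system of `m` equations `E k = 0` for `n` dependent variables is given by functions `E k` on the jet space. -/

/-- The manifold defined by the system `E` in the infinite jet space over `Ω`: the equations and all their
differential consequences `D_tᵃ D_xᵇ E k = 0`. -/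
def solutionManifold {n m : ℕ} (Ω : TopologicalSpace.Opens (ℝ × ℝ)) (E : Fin m → Jet n → ℝ) : Set (Jet n) :=
  {j | j.1 ∈ Ω ∧ ∀ (k : Fin m) (a b : ℕ), totalT^[a] (totalX^[b] (E k)) j = 0}

/-- Conserved vectors of `E`: pairs of differential functions whose total divergence vanishes on the
solutions of `E`. -/
def conservedVectors {n m : ℕ} (Ω : TopologicalSpace.Opens (ℝ × ℝ)) (E : Fin m → Jet n → ℝ) :
    Submodule ℝ ((Jet n → ℝ) × (Jet n → ℝ)) where
  carrier := {F | IsDiffFun Ω F.1 ∧ IsDiffFun Ω F.2 ∧ ∀ j ∈ solutionManifold Ω E, totalDiv F j = 0}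
  add_mem' := by
    rintro F G ⟨hF1, hF2, hF⟩ ⟨hG1, hG2, hG⟩
    refine ⟨hF1.add hG1, hF2.add hG2, fun j hj => ?_⟩
    rw [totalDiv_add hF1 hF2 hG1 hG2 hj.1, hF j hj, hG j hj, add_zero]
  zero_mem' := ⟨IsDiffFun.zero, IsDiffFun.zero, fun j _ => totalDiv_zero j⟩
  smul_mem' := by
    rintro a F ⟨hF1, hF2, hF⟩
    refine ⟨hF1.smul a, hF2.smul a, fun j hj => ?_⟩
    rw [totalDiv_smul, hF j hj, mul_zero]

/-- Pairs of differential functions that coincide on the solutions of `E` with a null divergence, that is,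
with a pair of differential functions whose total divergence vanishes identically. -/
def trivialVectors {n m : ℕ} (Ω : TopologicalSpace.Opens (ℝ × ℝ)) (E : Fin m → Jet n → ℝ) :
    Submodule ℝ ((Jet n → ℝ) × (Jet n → ℝ)) where
  carrier := {F | IsDiffFun Ω F.1 ∧ IsDiffFun Ω F.2 ∧ ∃ G : (Jet n → ℝ) × (Jet n → ℝ),
    IsDiffFun Ω G.1 ∧ IsDiffFun Ω G.2 ∧ (∀ j : Jet n, j.1 ∈ Ω → totalDiv G j = 0) ∧
    ∀ j ∈ solutionManifold Ω E, F.1 j = G.1 j ∧ F.2 j = G.2 j}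
  add_mem' := by
    rintro F F' ⟨hF1, hF2, G, hG1, hG2, hG, hFG⟩ ⟨hF1', hF2', G', hG1', hG2', hG', hFG'⟩
    refine ⟨hF1.add hF1', hF2.add hF2', G + G', hG1.add hG1', hG2.add hG2', fun j hj => ?_,
      fun j hj => ?_⟩
    · rw [totalDiv_add hG1 hG2 hG1' hG2' hj, hG j hj, hG' j hj, add_zero]
    · simp [hFG j hj, hFG' j hj]
  zero_mem' := ⟨IsDiffFun.zero, IsDiffFun.zero, 0, IsDiffFun.zero, IsDiffFun.zero,
    fun j _ => totalDiv_zero j, fun _ _ => ⟨rfl, rfl⟩⟩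
  smul_mem' := by
    rintro a F ⟨hF1, hF2, G, hG1, hG2, hG, hFG⟩
    refine ⟨hF1.smul a, hF2.smul a, a • G, hG1.smul a, hG2.smul a, fun j hj => ?_, fun j hj => ?_⟩
    · rw [totalDiv_smul, hG j hj, mul_zero]
    · simp [hFG j hj]

/-- The space of (local) conservation laws of `E`: conserved vectors modulo trivial conserved vectors. -/
abbrev ConservationLaws {n m : ℕ} (Ω : TopologicalSpace.Opens (ℝ × ℝ)) (E : Fin m → Jet n → ℝ) : Type :=
  conservedVectors Ω E ⧸ (trivialVectors Ω E).submoduleOf (conservedVectors Ω E)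

/-- The conservation law that contains a given conserved vector. -/
abbrev conservationLaw {n m : ℕ} {Ω : TopologicalSpace.Opens (ℝ × ℝ)} {E : Fin m → Jet n → ℝ}
    (F : conservedVectors Ω E) : ConservationLaws Ω E :=
  Submodule.Quotient.mk F

/-- `μ` is a characteristic of the conservation law `C` of the single equation `E 0 = 0`: some conserved
vector in `C` satisfies `D_t F.1 + D_x F.2 = μ * E 0` identically on the jet space. -/
def IsCharacteristic {n : ℕ} {Ω : TopologicalSpace.Opens (ℝ × ℝ)} {E : Fin 1 → Jet n → ℝ}
    (C : ConservationLaws Ω E) (μ : Jet n → ℝ) : Prop :=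
  IsDiffFun Ω μ ∧ ∃ F : conservedVectors Ω E, conservationLaw F = C ∧
    ∀ j : Jet n, j.1 ∈ Ω → totalDiv F.1 j = μ j * E 0 j

/-- A characteristic is reduced if it does not depend on jet coordinates that involve a derivative with
respect to `t`. -/
def IsReducedCharacteristic {n : ℕ} {Ω : TopologicalSpace.Opens (ℝ × ℝ)} {E : Fin 1 → Jet n → ℝ}
    (C : ConservationLaws Ω E) (μ : Jet n → ℝ) : Prop :=
  IsCharacteristic C μ ∧
    ∀ j j' : Jet n, j.1 ∈ Ω → j.1 = j'.1 → (∀ i b, j.2 (i, 0, b) = j'.2 (i, 0, b)) → μ j = μ j'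

/-! ### Generalized Burgers equations and their potential counterparts -/

/-- `f_x`. -/
def fx (f : ℝ → ℝ → ℝ) (t x : ℝ) : ℝ := deriv (fun y => f t y) x

/-- `f_xx`. -/
def fxx (f : ℝ → ℝ → ℝ) (t x : ℝ) : ℝ := iteratedDeriv 2 (fun y => f t y) x

/-- `f_xxx`. -/
def fxxx (f : ℝ → ℝ → ℝ) (t x : ℝ) : ℝ := iteratedDeriv 3 (fun y => f t y) x

/-- The generalized Burgers equation `u_t + u u_x + f u_xx = 0`; the dependent variable `u` has index `0`. -/
def burgers (f : ℝ → ℝ → ℝ) : Fin 1 → Jet 1 → ℝ := fun _ j =>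
  j.2 (0, 1, 0) + j.2 (0, 0, 0) * j.2 (0, 0, 1) + f j.1.1 j.1.2 * j.2 (0, 0, 2)

/-- The potential system `v_x = lam u`, `v_t = -lam (u² / 2 + f u_x - f_x u)`;
the dependent variables are `u` (index `0`) and `v` (index `1`). -/
def potentialSystem (f : ℝ → ℝ → ℝ) (lam : ℝ → ℝ) : Fin 2 → Jet 2 → ℝ :=
  ![fun j => j.2 (1, 0, 1) - lam j.1.1 * j.2 (0, 0, 0),
    fun j => j.2 (1, 1, 0) + lam j.1.1 * (j.2 (0, 0, 0) ^ 2 / 2 + f j.1.1 j.1.2 * j.2 (0, 0, 1)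
      - fx f j.1.1 j.1.2 * j.2 (0, 0, 0))]

/-- The potential equation `v_t + v_x² / (2 lam) + f v_xx - f_x v_x = 0`; the dependent variable `v` has
index `0`. -/
def potentialEquation (f : ℝ → ℝ → ℝ) (lam : ℝ → ℝ) : Fin 1 → Jet 1 → ℝ := fun _ j =>
  j.2 (0, 1, 0) + j.2 (0, 0, 1) ^ 2 / (2 * lam j.1.1) + f j.1.1 j.1.2 * j.2 (0, 0, 2)
    - fx f j.1.1 j.1.2 * j.2 (0, 0, 1)

/-- A function of the jets of `v`, regarded as a function of the jets of `(u, v)`. -/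
def liftV (F : Jet 1 → ℝ) : Jet 2 → ℝ := fun j => F (j.1, fun c => j.2 (1, c.2))

/-- The open rectangle of points `(t, x)` with `t ∈ I` and `x ∈ J`. -/
def box (I J : TopologicalSpace.Opens ℝ) : TopologicalSpace.Opens (ℝ × ℝ) :=
  ⟨(I : Set ℝ) ×ˢ (J : Set ℝ), I.isOpen.prod J.isOpen⟩

/-- Smooth solutions of the linear heat equation `ψ_t = f ψ_xx` on `I × J`. -/
def IsHeatSolution (I J : TopologicalSpace.Opens ℝ) (f ψ : ℝ → ℝ → ℝ) : Prop :=
  ContDiffOn ℝ ∞ (Function.uncurry ψ) ((I : Set ℝ) ×ˢ (J : Set ℝ)) ∧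
    ∀ t ∈ I, ∀ x ∈ J, deriv (fun s => ψ s x) t = f t x * iteratedDeriv 2 (fun y => ψ t y) x

end GenBurgers

end

open GenBurgers

/-!
Differential functions over an open set `Ω` of points `(t, x)` form an algebra `DF Ω ι`, where `ι` indexes the
jet coordinates. A vector field on the jet space acts on this algebra as a derivation (`DF.vf`), and so the total
derivatives are the derivations `DF.Dt` and `DF.Dx`; a change of coordinates is an algebra homomorphism
(`DF.subst`), which intertwines derivations by the chain rule (`DF.vf_subst`). After this translation the
arguments are algebraic.

*Evolution equations.* The manifold of `u_t = K` is parametrized by `t`, `x` and the `x`-derivatives of `u`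
(`DF.eq_substPoint_of_mem_manifold`), and there the total derivatives become `DF.evo K` and `DF.D`. If the total
divergence of a pair equals `μ (u_t - K)` and the density of the pair vanishes on the manifold, then so does `μ`
(`DF.onShell_eq_zero_of_div`): introduce `h = u_t - K` as a new variable, linearize at `h = 0`, and integrate the
resulting formal divergence by parts. Therefore a conservation law has at most one reduced characteristic.

*Reduction of order.* For `K = -φ(t, x) u_xx + κ(t, x, u, u_x)` with `φ ≠ 0`, the coefficient of `u_{r+1}²` in
`D_t ρ + D_x σ = 0` shows that a conserved density `ρ` of order `r ≥ 1` is linear in `u_r`, so that it can be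
replaced by a density of smaller order (`DF.Quasilinear.exists_lower`). Hence every conservation law has a density
`ρ(t, x, u)`; its reduced characteristic is `∂ρ/∂u`, which determines the law (`DF.Conserved.law_eq_iff`).

*The generalized Burgers equation.* The remaining equations for `γ = ∂ρ/∂u` say that `γ` depends only on `t` and
satisfies `γ_t = f_xx γ` (`DF.burgersChar_of_conserved`). Differentiation with respect to `x` gives
`f_xxx γ = 0`, and a nonzero `γ` has no zeros. Conversely, if `f_xxx = 0`, then the solutions of this ordinary
differential equation are the multiples of `e^{∫ f_xx dt}`, and each of them is a characteristic.

*The potential equation.* With `θ = 1 / (2 f λ)`, the characteristic `μ = ∂ρ/∂v` satisfies `μ_v = θ μ` and a linear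
equation in `t` and `x`. Applying `∂/∂v - θ` to this linear equation twice gives `θ_x² μ = 0`, which leads to
`f_x μ = f_t μ = 0` and `μ_t = f μ_xx` (`DF.PotentialCoeffs.potentialChar`). So `μ` vanishes unless `f` is constant
on some open set, and for constant `f` it is `ψ e^{θ v}` with a solution `ψ` of the heat equation.

*The potential system.* The first equation gives `u = v_x / λ`, and elimination of `u` turns the system into the
potential equation. The substitutions in both directions commute with the total derivatives and are inverse to
each other on the manifolds (`DF.PotentialData.isExtensionBy`), which identifies the conservation laws
(`DF.IsExtensionBy.exists_linearEquiv`).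
-/

noncomputable section

namespace GenBurgers

/-! ### Differential functions over an arbitrary set of jet coordinates -/

/-- Jets over `Ω` with fibre coordinates indexed by `ι`. -/
abbrev JetOver (Ω : TopologicalSpace.Opens (ℝ × ℝ)) (ι : Type) : Type := Ω × (ι → ℝ)

/-- The function `G` of `(t, x)` and of the coordinates in the finite set `s` represents `F`. -/
def Represents {Ω : TopologicalSpace.Opens (ℝ × ℝ)} {ι : Type} (s : Finset ι)
    (G : (ℝ × ℝ) × (s → ℝ) → ℝ) (F : JetOver Ω ι → ℝ) : Prop :=
  ContDiffOn ℝ ∞ G ((Ω : Set (ℝ × ℝ)) ×ˢ univ) ∧ ∀ j, F j = G (j.1, s.restrict j.2)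

section

variable {Ω : TopologicalSpace.Opens (ℝ × ℝ)} {ι κ : Type}

theorem Represents.mono {s r : Finset ι} (h : s ⊆ r) {G : (ℝ × ℝ) × (s → ℝ) → ℝ}
    {F : JetOver Ω ι → ℝ} (hF : Represents s G F) :
    Represents r (fun p => G (p.1, fun c => p.2 ⟨c, h c.2⟩)) F :=
  ⟨hF.1.comp (ContDiff.contDiffOn (by fun_prop)) fun _ hp => ⟨hp.1, mem_univ _⟩, fun j => hF.2 j⟩

theorem Represents.common {s r : Finset ι} {G : (ℝ × ℝ) × (s → ℝ) → ℝ}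
    {G' : (ℝ × ℝ) × (r → ℝ) → ℝ} {F F' : JetOver Ω ι → ℝ}
    (hF : Represents s G F) (hF' : Represents r G' F') :
    ∃ (q : Finset ι) (A B : (ℝ × ℝ) × (q → ℝ) → ℝ), Represents q A F ∧ Represents q B F' := by
  classical
  exact ⟨s ∪ r, _, _, hF.mono Finset.subset_union_left, hF'.mono Finset.subset_union_right⟩

/-- The algebra of differential functions over `Ω`: smooth functions of `(t, x) ∈ Ω` and of finitely many
of the coordinates indexed by `ι`. -/
def DF (Ω : TopologicalSpace.Opens (ℝ × ℝ)) (ι : Type) : Subalgebra ℝ (JetOver Ω ι → ℝ) where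
  carrier := {F | ∃ s G, Represents s G F}
  mul_mem' := by
    rintro F F' ⟨s, G, h⟩ ⟨r, G', h'⟩
    obtain ⟨q, A, B, hA, hB⟩ := h.common h'
    exact ⟨q, A * B, hA.1.mul hB.1, fun j => by simp [hA.2 j, hB.2 j]⟩
  add_mem' := by
    rintro F F' ⟨s, G, h⟩ ⟨r, G', h'⟩
    obtain ⟨q, A, B, hA, hB⟩ := h.common h'
    exact ⟨q, A + B, hA.1.add hB.1, fun j => by simp [hA.2 j, hB.2 j]⟩
  algebraMap_mem' a := ⟨∅, fun _ => a, contDiffOn_const, fun _ => rfl⟩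

instance : CoeFun (DF Ω ι) fun _ => JetOver Ω ι → ℝ := ⟨fun F => F.1⟩

namespace DF

@[ext] theorem ext {F G : DF Ω ι} (h : ∀ j, F j = G j) : F = G := Subtype.ext (funext h)

@[simp] theorem add_apply (F G : DF Ω ι) (j) : (F + G) j = F j + G j := rfl
@[simp] theorem mul_apply (F G : DF Ω ι) (j) : (F * G) j = F j * G j := rfl
@[simp] theorem sub_apply (F G : DF Ω ι) (j) : (F - G) j = F j - G j := rfl
@[simp] theorem neg_apply (F : DF Ω ι) (j) : (-F) j = -F j := rfl
@[simp] theorem zero_apply (j) : (0 : DF Ω ι) j = 0 := rfl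
@[simp] theorem pow_apply (F : DF Ω ι) (k : ℕ) (j) : (F ^ k) j = F j ^ k := rfl

/-- Extension by zero to all `(t, x)`. Derivatives are taken at points over the open set `Ω` only, so that the
values elsewhere play no role. -/
def extend (F : JetOver Ω ι → ℝ) (p : (ℝ × ℝ) × (ι → ℝ)) : ℝ :=
  open Classical in if h : p.1 ∈ Ω then F (⟨p.1, h⟩, p.2) else 0

theorem extend_of_mem (F : JetOver Ω ι → ℝ) {p : (ℝ × ℝ) × (ι → ℝ)} (h : p.1 ∈ Ω) :
    extend F p = F (⟨p.1, h⟩, p.2) := dif_pos h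

/-- The point `j + ε w`. -/
def line (j : JetOver Ω ι) (w : (ℝ × ℝ) × (ι → ℝ)) (ε : ℝ) : (ℝ × ℝ) × (ι → ℝ) :=
  ((j.1 : ℝ × ℝ) + ε • w.1, j.2 + ε • w.2)

theorem line_mem (j : JetOver Ω ι) (w : (ℝ × ℝ) × (ι → ℝ)) :
    ∀ᶠ ε in nhds (0 : ℝ), (line j w ε).1 ∈ Ω := by
  have hc : Continuous fun ε : ℝ => (line j w ε).1 := by unfold line; fun_prop
  refine hc.continuousAt.eventually (Ω.isOpen.mem_nhds ?_)
  simp [line]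

/-- The directional derivative of `F` at `j` in the direction `w`. -/
def dir (F : DF Ω ι) (j : JetOver Ω ι) (w : (ℝ × ℝ) × (ι → ℝ)) : ℝ :=
  deriv (fun ε => extend F (line j w ε)) 0

theorem _root_.GenBurgers.Represents.hasDerivAt {s : Finset ι} {G : (ℝ × ℝ) × (s → ℝ) → ℝ}
    {F : JetOver Ω ι → ℝ} (h : Represents s G F) (j : JetOver Ω ι) (w : (ℝ × ℝ) × (ι → ℝ)) :
    HasDerivAt (fun ε => extend F (line j w ε))
      (fderiv ℝ G ((j.1 : ℝ × ℝ), s.restrict j.2) (w.1, s.restrict w.2)) 0 := by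
  have h1 : HasDerivAt (fun ε : ℝ => (((j.1 : ℝ × ℝ) + ε • w.1, s.restrict j.2 + ε • s.restrict w.2) :
      (ℝ × ℝ) × (s → ℝ))) (w.1, s.restrict w.2) 0 := by
    refine HasDerivAt.prodMk ?_ ?_
    · simpa using ((hasDerivAt_id (0 : ℝ)).smul_const w.1).const_add (j.1 : ℝ × ℝ)
    · simpa using ((hasDerivAt_id (0 : ℝ)).smul_const (s.restrict w.2)).const_add (s.restrict j.2)
  have hd : DifferentiableAt ℝ G ((j.1 : ℝ × ℝ), s.restrict j.2) :=
    (h.1.contDiffAt ((Ω.isOpen.prod isOpen_univ).mem_nhds ⟨j.1.2, mem_univ _⟩)).differentiableAt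
      (by simp)
  have h2 := HasFDerivAt.comp_hasDerivAt (l := G)
    (l' := fderiv ℝ G ((j.1 : ℝ × ℝ), s.restrict j.2)) 0 (by simpa using hd.hasFDerivAt) h1
  refine h2.congr_of_eventuallyEq ?_
  filter_upwards [line_mem j w] with ε hε
  rw [extend_of_mem F hε, h.2]
  rfl

theorem dir_eq_fderiv {F : DF Ω ι} {s : Finset ι} {G : (ℝ × ℝ) × (s → ℝ) → ℝ}
    (h : Represents s G F.1) (j : JetOver Ω ι) (w : (ℝ × ℝ) × (ι → ℝ)) :
    dir F j w = fderiv ℝ G ((j.1 : ℝ × ℝ), s.restrict j.2) (w.1, s.restrict w.2) :=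
  (h.hasDerivAt j w).deriv

theorem hasDerivAt_dir (F : DF Ω ι) (j : JetOver Ω ι) (w : (ℝ × ℝ) × (ι → ℝ)) :
    HasDerivAt (fun ε => extend F (line j w ε)) (dir F j w) 0 := by
  obtain ⟨s, G, h⟩ := F.2
  rw [dir_eq_fderiv h]
  exact h.hasDerivAt j w

theorem extend_line_zero (F : DF Ω ι) (j : JetOver Ω ι) (w : (ℝ × ℝ) × (ι → ℝ)) :
    extend F (line j w 0) = F j := by
  have : (line j w 0).1 ∈ Ω := by simp [line]
  rw [extend_of_mem _ this]
  exact congrArg F.1 (Prod.ext (Subtype.ext (by simp [line])) (by simp [line]))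

/-- The derivative in the direction `w` may be computed from a formula for `F` along the line that is valid over `Ω`. -/
theorem dir_congr {F : DF Ω ι} {j : JetOver Ω ι} {w : (ℝ × ℝ) × (ι → ℝ)} {f : ℝ → ℝ} {d : ℝ}
    (hf : HasDerivAt f d 0) (h : ∀ᶠ ε in nhds (0 : ℝ), ∀ hε : (line j w ε).1 ∈ Ω,
      F (⟨(line j w ε).1, hε⟩, (line j w ε).2) = f ε) : dir F j w = d := by
  refine (hf.congr_of_eventuallyEq ?_).deriv
  filter_upwards [h, line_mem j w] with ε h1 h2
  rw [extend_of_mem _ h2, h1 h2]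

theorem dir_add_right (F : DF Ω ι) (j : JetOver Ω ι) (w w' : (ℝ × ℝ) × (ι → ℝ)) :
    dir F j (w + w') = dir F j w + dir F j w' := by
  obtain ⟨s, G, h⟩ := F.2
  simp only [dir_eq_fderiv h]
  rw [← map_add]
  rfl

theorem dir_smul_right (F : DF Ω ι) (j : JetOver Ω ι) (a : ℝ) (w : (ℝ × ℝ) × (ι → ℝ)) :
    dir F j (a • w) = a * dir F j w := by
  obtain ⟨s, G, h⟩ := F.2
  simp only [dir_eq_fderiv h]
  rw [← smul_eq_mul, ← map_smul]
  rfl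

theorem dir_add (F G : DF Ω ι) (j : JetOver Ω ι) (w : (ℝ × ℝ) × (ι → ℝ)) :
    dir (F + G) j w = dir F j w + dir G j w := by
  refine dir_congr ((hasDerivAt_dir F j w).add (hasDerivAt_dir G j w)) (.of_forall fun ε hε => ?_)
  simp [extend_of_mem _ hε]

theorem dir_mul (F G : DF Ω ι) (j : JetOver Ω ι) (w : (ℝ × ℝ) × (ι → ℝ)) :
    dir (F * G) j w = F j * dir G j w + G j * dir F j w := by
  have := (hasDerivAt_dir F j w).mul (hasDerivAt_dir G j w)
  rw [extend_line_zero, extend_line_zero] at this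
  rw [dir_congr this (.of_forall fun ε hε => ?_)]
  · ring
  · simp [extend_of_mem _ hε]

theorem dir_smul (a : ℝ) (F : DF Ω ι) (j : JetOver Ω ι) (w : (ℝ × ℝ) × (ι → ℝ)) :
    dir (a • F) j w = a * dir F j w := by
  refine dir_congr ((hasDerivAt_dir F j w).const_mul a) (.of_forall fun ε hε => ?_)
  simp [extend_of_mem _ hε]

/-! ### Vector fields -/

/-- The vector field `e.1 ∂/∂t + e.2 ∂/∂x + ∑ A c ∂/∂u_c` at the jet `j`. -/
def tangent (e : ℝ × ℝ) (A : ι → DF Ω ι) (j : JetOver Ω ι) : (ℝ × ℝ) × (ι → ℝ) := (e, fun c => A c j)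

theorem const_fderiv_mem {s : Finset ι} {G : (ℝ × ℝ) × (s → ℝ) → ℝ} {F : JetOver Ω ι → ℝ}
    (h : Represents s G F) (v : (ℝ × ℝ) × (s → ℝ)) :
    (fun j : JetOver Ω ι => fderiv ℝ G ((j.1 : ℝ × ℝ), s.restrict j.2) v) ∈ DF Ω ι :=
  ⟨s, fun p => fderiv ℝ G p v,
    (h.1.fderiv_of_isOpen (Ω.isOpen.prod isOpen_univ) (by simp)).clm_apply contDiffOn_const,
    fun _ => rfl⟩

theorem dir_tangent_mem (e : ℝ × ℝ) (A : ι → DF Ω ι) (F : DF Ω ι) :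
    (fun j => dir F j (tangent e A j)) ∈ DF Ω ι := by
  classical
  obtain ⟨s, G, h⟩ := F.2
  have : (fun j => dir F j (tangent e A j)) =
      (fun j : JetOver Ω ι => fderiv ℝ G ((j.1 : ℝ × ℝ), s.restrict j.2) (e, 0)) +
      ∑ c : s, (A c).1 *
        fun j : JetOver Ω ι => fderiv ℝ G ((j.1 : ℝ × ℝ), s.restrict j.2) (0, Pi.single c 1) := by
    funext j
    have hw : ((e, s.restrict fun c => A c j) : (ℝ × ℝ) × (s → ℝ)) =
        (e, 0) + ∑ c : s, A c j • ((0, Pi.single c 1) : (ℝ × ℝ) × (s → ℝ)) := by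
      refine Prod.ext ?_ ?_
      · simp [Prod.fst_sum]
      · ext d
        simp [Prod.snd_sum, Pi.single_apply]
    rw [dir_eq_fderiv h]
    simp only [tangent, hw, map_add, map_sum, map_smul]
    simp
  rw [this]
  exact add_mem (const_fderiv_mem h _) (sum_mem fun c _ => mul_mem (A c).2 (const_fderiv_mem h _))

/-- The derivation `e.1 ∂/∂t + e.2 ∂/∂x + ∑ A c ∂/∂u_c` of the algebra of differential functions. -/
def vf (e : ℝ × ℝ) (A : ι → DF Ω ι) : Derivation ℝ (DF Ω ι) (DF Ω ι) :=
  Derivation.mk'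
    { toFun := fun F => ⟨fun j => dir F j (tangent e A j), dir_tangent_mem e A F⟩
      map_add' := fun F G => ext fun j => dir_add F G j _
      map_smul' := fun a F => ext fun j => dir_smul a F j _ }
    fun F G => ext fun j => dir_mul F G j _

theorem vf_apply (e : ℝ × ℝ) (A : ι → DF Ω ι) (F : DF Ω ι) (j : JetOver Ω ι) :
    vf e A F j = dir F j (e, fun c => A c j) := rfl

/-- The coordinate `u_c`. -/
def coord (c : ι) : DF Ω ι :=
  ⟨fun j => j.2 c, {c}, fun p => p.2 ⟨c, by simp⟩, ContDiff.contDiffOn (by fun_prop), fun _ => rfl⟩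

@[simp] theorem coord_apply (c : ι) (j : JetOver Ω ι) : (coord c : DF Ω ι) j = j.2 c := rfl

@[simp] theorem dir_coord (c : ι) (j : JetOver Ω ι) (w) : dir (coord c) j w = w.2 c := by
  refine dir_congr (f := fun ε => j.2 c + ε * w.2 c) ?_ (.of_forall fun ε hε => ?_)
  · simpa using ((hasDerivAt_id (0 : ℝ)).mul_const (w.2 c)).const_add (j.2 c)
  · simp [line]

@[simp] theorem vf_coord (e : ℝ × ℝ) (A : ι → DF Ω ι) (c : ι) : vf e A (coord c) = A c :=
  ext fun j => by rw [vf_apply, dir_coord]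

/-- A smooth function of `(t, x)` as a differential function. -/
def base (g : ℝ × ℝ → ℝ) (hg : ContDiffOn ℝ ∞ g Ω) : DF Ω ι :=
  ⟨fun j => g j.1, ∅, fun p => g p.1, hg.comp contDiff_fst.contDiffOn fun _ hp => hp.1, fun _ => rfl⟩

@[simp] theorem base_apply (g : ℝ × ℝ → ℝ) (hg : ContDiffOn ℝ ∞ g Ω) (j : JetOver Ω ι) :
    (base g hg : DF Ω ι) j = g j.1 := rfl

theorem dir_base (g : ℝ × ℝ → ℝ) (hg : ContDiffOn ℝ ∞ g Ω) (j : JetOver Ω ι) (w) :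
    dir (base g hg) j w = fderiv ℝ g j.1 w.1 := by
  have h1 : HasDerivAt (fun ε : ℝ => (j.1 : ℝ × ℝ) + ε • w.1) w.1 0 := by
    simpa using ((hasDerivAt_id (0 : ℝ)).smul_const w.1).const_add (j.1 : ℝ × ℝ)
  have hd : DifferentiableAt ℝ g j.1 :=
    (hg.contDiffAt (Ω.isOpen.mem_nhds j.1.2)).differentiableAt (by simp)
  exact dir_congr (HasFDerivAt.comp_hasDerivAt (l := g) 0 (by simpa using hd.hasFDerivAt) h1)
    (.of_forall fun ε hε => rfl)

/-- The composition of a smooth function of one real variable with a differential function. -/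
def compReal (g : ℝ → ℝ) (hg : ContDiff ℝ ∞ g) (F : DF Ω ι) : DF Ω ι :=
  ⟨fun j => g (F j), by
    obtain ⟨s, G, h⟩ := F.2
    exact ⟨s, g ∘ G, hg.comp_contDiffOn h.1, fun j => congrArg g (h.2 j)⟩⟩

theorem dir_compReal (g : ℝ → ℝ) (hg : ContDiff ℝ ∞ g) (F : DF Ω ι) (j : JetOver Ω ι) (w) :
    dir (compReal g hg F) j w = deriv g (F j) * dir F j w := by
  have h1 : HasDerivAt g (deriv g (F j)) (extend F (line j w 0)) := by
    rw [extend_line_zero]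
    exact (hg.differentiable (by simp) _).hasDerivAt
  refine dir_congr (h1.comp 0 (hasDerivAt_dir F j w)) (.of_forall fun ε hε => ?_)
  simp [compReal, extend_of_mem _ hε]

/-! ### Substitutions -/

/-- The jet with the same `(t, x)` and the coordinates `P c`. -/
def substPoint (P : κ → DF Ω ι) (j : JetOver Ω ι) : JetOver Ω κ := (j.1, fun c => P c j)

theorem comp_substPoint_mem (P : κ → DF Ω ι) (F : DF Ω κ) :
    (fun j => F (substPoint P j)) ∈ DF Ω ι := by
  classical
  obtain ⟨s, G, h⟩ := F.2
  choose r A hA using fun c => (P c).2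
  have hr : ∀ c : s, r c ⊆ s.biUnion r := fun c => Finset.subset_biUnion_of_mem r c.2
  refine ⟨s.biUnion r, fun p => G (p.1, fun c => A c (p.1, fun d => p.2 ⟨d, hr c d.2⟩)), ?_, ?_⟩
  · refine h.1.comp (ContDiffOn.prodMk contDiff_fst.contDiffOn (contDiffOn_pi.2 fun c => ?_))
      fun p hp => ⟨hp.1, mem_univ _⟩
    exact ((hA c).mono (hr c)).1
  · intro j
    refine (h.2 _).trans ?_
    congr 2
    funext c
    exact (hA c).2 j

/-- The substitution `u_c = P c` as a homomorphism of algebras of differential functions. -/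
def subst (P : κ → DF Ω ι) : DF Ω κ →ₐ[ℝ] DF Ω ι where
  toFun F := ⟨fun j => F (substPoint P j), comp_substPoint_mem P F⟩
  map_one' := rfl
  map_mul' _ _ := rfl
  map_zero' := rfl
  map_add' _ _ := rfl
  commutes' _ := rfl

theorem subst_apply (P : κ → DF Ω ι) (F : DF Ω κ) (j : JetOver Ω ι) :
    subst P F j = F (j.1, fun c => P c j) := rfl

@[simp] theorem subst_coord (P : κ → DF Ω ι) (c : κ) : subst P (coord c) = P c := rfl

theorem subst_subst {ν : Type} (P : κ → DF Ω ι) (Q : ν → DF Ω κ) (F : DF Ω ν) :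
    subst P (subst Q F) = subst (fun c => subst P (Q c)) F := rfl

theorem dir_subst (P : κ → DF Ω ι) (F : DF Ω κ) (j : JetOver Ω ι) (w) :
    dir (subst P F) j w = dir F (substPoint P j) (w.1, fun c => dir (P c) j w) := by
  obtain ⟨s, G, h⟩ := F.2
  rw [dir_eq_fderiv h]
  have h1 : HasDerivAt (fun ε : ℝ => (((j.1 : ℝ × ℝ) + ε • w.1,
      fun c : s => extend (P c) (line j w ε)) : (ℝ × ℝ) × (s → ℝ)))
      (w.1, fun c : s => dir (P c) j w) 0 := by
    refine HasDerivAt.prodMk ?_ (hasDerivAt_pi.2 fun c => hasDerivAt_dir (P c) j w)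
    simpa using ((hasDerivAt_id (0 : ℝ)).smul_const w.1).const_add (j.1 : ℝ × ℝ)
  have hd : DifferentiableAt ℝ G ((j.1 : ℝ × ℝ), s.restrict (substPoint P j).2) :=
    (h.1.contDiffAt ((Ω.isOpen.prod isOpen_univ).mem_nhds ⟨j.1.2, mem_univ _⟩)).differentiableAt
      (by simp)
  refine dir_congr (HasFDerivAt.comp_hasDerivAt (l := G) 0 ?_ h1) (.of_forall fun ε hε => ?_)
  · simp only [extend_line_zero, zero_smul, add_zero]
    exact hd.hasFDerivAt
  · rw [subst_apply, h.2]
    simp only [Function.comp, extend_of_mem _ hε]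
    rfl

/-- The chain rule: if the substitution maps the vector field `(e, A)` to `(e, B)`, then it intertwines the
two derivations. -/
theorem vf_subst {P : κ → DF Ω ι} {e : ℝ × ℝ} {A : ι → DF Ω ι} {B : κ → DF Ω κ}
    (h : ∀ c, vf e A (P c) = subst P (B c)) (F : DF Ω κ) :
    vf e A (subst P F) = subst P (vf e B F) := by
  ext j
  rw [vf_apply, dir_subst, subst_apply, vf_apply]
  congr 1
  refine Prod.ext rfl (funext fun c => ?_)
  exact congrArg (fun H : DF Ω ι => H j) (h c)

/-- The commutator of two vector fields with constant components in the directions of `t` and `x`. -/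
theorem vf_vf_sub (e e' : ℝ × ℝ) (A B : ι → DF Ω ι) (F : DF Ω ι) :
    vf e A (vf e' B F) - vf e' B (vf e A F) = vf 0 (fun c => vf e A (B c) - vf e' B (A c)) F := by
  obtain ⟨s, G, h⟩ := F.2
  have hs : IsOpen ((Ω : Set (ℝ × ℝ)) ×ˢ (univ : Set (s → ℝ))) := Ω.isOpen.prod isOpen_univ
  -- the second derivative of `G` in `key` is symmetric, so that it cancels in the commutator
  have key : ∀ (e e' : ℝ × ℝ) (A B : ι → DF Ω ι) (j : JetOver Ω ι), vf e A (vf e' B F) j =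
      fderiv ℝ (fderiv ℝ G) ((j.1 : ℝ × ℝ), s.restrict j.2) (e, s.restrict fun c => A c j)
        (e', s.restrict fun c => B c j) +
      fderiv ℝ G ((j.1 : ℝ × ℝ), s.restrict j.2) (0, s.restrict fun c => vf e A (B c) j) := by
    intro e e' A B j
    set w : (ℝ × ℝ) × (ι → ℝ) := (e, fun c => A c j) with hw
    have hm : ((j.1 : ℝ × ℝ), s.restrict j.2) ∈ ((Ω : Set (ℝ × ℝ)) ×ˢ (univ : Set (s → ℝ))) :=
      ⟨j.1.2, mem_univ _⟩
    have h1 : HasDerivAt (fun ε : ℝ => (((j.1 : ℝ × ℝ) + ε • w.1, s.restrict j.2 + ε • s.restrict w.2) :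
        (ℝ × ℝ) × (s → ℝ))) (w.1, s.restrict w.2) 0 := by
      refine HasDerivAt.prodMk ?_ ?_
      · simpa using ((hasDerivAt_id (0 : ℝ)).smul_const w.1).const_add (j.1 : ℝ × ℝ)
      · simpa using ((hasDerivAt_id (0 : ℝ)).smul_const (s.restrict w.2)).const_add (s.restrict j.2)
    have hd : DifferentiableAt ℝ (fderiv ℝ G) ((j.1 : ℝ × ℝ), s.restrict j.2) :=
      ((h.1.fderiv_of_isOpen hs (m := ∞) (by simp)).contDiffAt (hs.mem_nhds hm)).differentiableAt
        (by simp)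
    have h2 := HasFDerivAt.comp_hasDerivAt (l := fderiv ℝ G)
      (l' := fderiv ℝ (fderiv ℝ G) ((j.1 : ℝ × ℝ), s.restrict j.2)) 0
      (by simpa using hd.hasFDerivAt) h1
    have h3 : HasDerivAt (fun ε : ℝ => ((e', fun c : s => extend (B c) (line j w ε)) :
        (ℝ × ℝ) × (s → ℝ))) (0, fun c : s => dir (B c) j w) 0 :=
      (hasDerivAt_const _ _).prodMk (hasDerivAt_pi.2 fun c => hasDerivAt_dir (B c) j w)
    rw [vf_apply]
    rw [dir_congr (h2.clm_apply h3) (.of_forall fun ε hε => ?_)]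
    · simp only [extend_line_zero, Function.comp]
      simp only [zero_smul, add_zero]
      rfl
    · rw [vf_apply, dir_eq_fderiv h]
      have h4 : (fun c : s => extend (B c) (line j w ε)) = s.restrict fun c =>
          B c (⟨(line j w ε).1, hε⟩, (line j w ε).2) := funext fun c => extend_of_mem _ hε
      simp only [Function.comp]
      rw [h4]
      rfl
  ext j
  have hm : ((j.1 : ℝ × ℝ), s.restrict j.2) ∈ ((Ω : Set (ℝ × ℝ)) ×ˢ (univ : Set (s → ℝ))) :=
    ⟨j.1.2, mem_univ _⟩
  have hsymm : IsSymmSndFDerivAt ℝ G ((j.1 : ℝ × ℝ), s.restrict j.2) :=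
    (h.1.contDiffAt (hs.mem_nhds hm)).isSymmSndFDerivAt (by
      simpa using (by exact_mod_cast le_top : ((2 : ℕ∞) : WithTop ℕ∞) ≤ ∞))
  rw [sub_apply, key, key, hsymm.eq, vf_apply, dir_eq_fderiv h, add_sub_add_left_eq_sub, ← map_sub]
  congr 1
  refine Prod.ext (by simp) ?_
  ext c
  simp

theorem vf_comm {e e' : ℝ × ℝ} {A B : ι → DF Ω ι} (h : ∀ c, vf e A (B c) = vf e' B (A c)) (F : DF Ω ι) :
    vf e A (vf e' B F) = vf e' B (vf e A F) := by
  rw [← sub_eq_zero, vf_vf_sub]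
  ext j
  have : (fun c => vf e A (B c) - vf e' B (A c)) = 0 := funext fun c => sub_eq_zero.2 (h c)
  rw [this, vf_apply]
  have h0 := dir_smul_right F j 0 0
  rw [smul_zero, zero_mul] at h0
  exact h0

end DF

end

/-! ### Partial derivatives and antiderivatives of differential functions -/

/-- Integrals over `[0, 1]` of smooth functions depend smoothly on parameters. This is an instance of the
smoothness of convolutions with a compactly supported kernel that depends on a parameter. -/
theorem contDiffOn_integral_unitInterval {E : Type*} [NormedAddCommGroup E] [NormedSpace ℝ E]
    {U : Set E} (hU : IsOpen U) {g : E × ℝ → ℝ} (hg : ContDiffOn ℝ ∞ g (U ×ˢ univ)) :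
    ContDiffOn ℝ ∞ (fun p => ∫ s in (0 : ℝ)..1, g (p, s)) U := by
  -- `χ` equals `1` on `[-1, 1]`, which contains all arguments `-s` with `s ∈ [0, 1]`
  let χ : ContDiffBump (0 : ℝ) := ⟨1, 2, one_pos, one_lt_two⟩
  have hk : IsCompact (tsupport χ) := χ.hasCompactSupport
  have h1 : ContDiffOn ℝ ∞ (fun p : E => MeasureTheory.convolution (indicator (Ioc (0 : ℝ) 1) fun _ => (1 : ℝ))
      (fun y => χ y * g (p, -y)) (ContinuousLinearMap.lsmul ℝ ℝ) MeasureTheory.volume 0) U := by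
    refine MeasureTheory.contDiffOn_convolution_right_with_param_comp (n := ⊤)
      (g := fun p y => χ y * g (p, -y)) (v := fun _ => (0 : ℝ)) (ContinuousLinearMap.lsmul ℝ ℝ)
      contDiffOn_const hU hk (fun p y _ hy => ?_) ?_ ?_
    · simp [image_eq_zero_of_notMem_tsupport hy]
    · exact ((MeasureTheory.integrable_indicator_iff measurableSet_Ioc).2
        (MeasureTheory.integrableOn_const (by simp))).locallyIntegrable
    · refine ContDiffOn.mul (χ.contDiff.comp contDiff_snd).contDiffOn
        (hg.comp (ContDiff.contDiffOn (by fun_prop)) fun p hp => ⟨hp.1, mem_univ _⟩)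
  refine h1.congr fun p _ => ?_
  rw [intervalIntegral.integral_of_le zero_le_one, MeasureTheory.convolution_def,
    ← MeasureTheory.integral_indicator measurableSet_Ioc]
  congr 1
  funext s
  by_cases hs : s ∈ Ioc (0 : ℝ) 1
  · have : χ (-s) = 1 := χ.one_of_mem_closedBall (by
      simp only [χ, Metric.mem_closedBall, dist_zero_right, norm_neg, Real.norm_eq_abs]
      rw [abs_of_pos hs.1]; exact hs.2)
    simp [indicator_of_mem hs, this]
  · simp [indicator_of_notMem hs]

namespace DF

variable {Ω : TopologicalSpace.Opens (ℝ × ℝ)} {ι κ : Type}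

theorem dir_zero_right (F : DF Ω ι) (j : JetOver Ω ι) : dir F j 0 = 0 := by
  have := dir_smul_right F j 0 0
  rwa [smul_zero, zero_mul] at this

theorem vf_zero_zero (F : DF Ω ι) : vf 0 0 F = 0 := ext fun j => dir_zero_right F j

theorem vf_zero_add (A B : ι → DF Ω ι) (F : DF Ω ι) : vf 0 (A + B) F = vf 0 A F + vf 0 B F := by
  ext j
  rw [add_apply, vf_apply, vf_apply, vf_apply, ← dir_add_right]
  congr 1
  exact Prod.ext (by simp) rfl

theorem dir_sum_right (F : DF Ω ι) (j : JetOver Ω ι) {α : Type*} (s : Finset α)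
    (w : α → (ℝ × ℝ) × (ι → ℝ)) : dir F j (∑ a ∈ s, w a) = ∑ a ∈ s, dir F j (w a) := by
  classical
  induction s using Finset.induction_on with
  | empty => simp [dir_zero_right]
  | insert a s h ih => rw [Finset.sum_insert h, Finset.sum_insert h, dir_add_right, ih]

variable [DecidableEq ι]

/-- The partial derivative with respect to the coordinate `u_c`. -/
def pd (c : ι) : Derivation ℝ (DF Ω ι) (DF Ω ι) := vf 0 (Pi.single c 1)

theorem pd_apply (c : ι) (F : DF Ω ι) (j : JetOver Ω ι) :
    pd c F j = dir F j (0, Pi.single c 1) := by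
  rw [pd, vf_apply]
  congr 2
  funext d
  by_cases h : d = c
  · subst h; simp
  · simp [h]

theorem pd_coord (c d : ι) : pd c (coord d : DF Ω ι) = if d = c then 1 else 0 := by
  rw [pd, vf_coord, Pi.single_apply]

@[simp] theorem pd_coord_self (c : ι) : pd c (coord c : DF Ω ι) = 1 := by simp [pd_coord]

theorem pd_coord_of_ne {c d : ι} (h : d ≠ c) : pd c (coord d : DF Ω ι) = 0 := by simp [pd_coord, h]

@[simp] theorem pd_base (c : ι) (g : ℝ × ℝ → ℝ) (hg : ContDiffOn ℝ ∞ g Ω) :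
    pd c (base g hg : DF Ω ι) = 0 :=
  ext fun j => by rw [pd_apply, dir_base]; simp

/-- The commutator of a vector field with the coordinate field `∂/∂u_c`. -/
theorem pd_vf (c : ι) (e : ℝ × ℝ) (A : ι → DF Ω ι) (F : DF Ω ι) :
    pd c (vf e A F) = vf e A (pd c F) + vf 0 (fun d => pd c (A d)) F := by
  rw [add_comm, ← sub_eq_iff_eq_add, pd, vf_vf_sub]
  congr 2
  funext d
  have : vf e A ((Pi.single c 1 : ι → DF Ω ι) d) = 0 := by
    by_cases h : d = c
    · subst h; simp
    · simp [h]
  rw [this, sub_zero]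

theorem pd_comm (c d : ι) (F : DF Ω ι) : pd c (pd d F) = pd d (pd c F) := by
  rw [pd.eq_def d, pd_vf, add_eq_left]
  have : (fun e => pd c ((Pi.single d 1 : ι → DF Ω ι) e)) = 0 := by
    funext e
    by_cases h : e = d
    · subst h; simp [pd]
    · simp [h]
  rw [this]
  ext j
  exact dir_zero_right F j

/-- A finite set of coordinates on which `F` depends, with the expansion of directional derivatives of `F` in terms
of partial derivatives. -/
theorem exists_finset (F : DF Ω ι) : ∃ s : Finset ι,
    (∀ j j' : JetOver Ω ι, j.1 = j'.1 → (∀ c ∈ s, j.2 c = j'.2 c) → F j = F j') ∧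
    (∀ j (w : (ℝ × ℝ) × (ι → ℝ)), dir F j w = dir F j (w.1, 0) + ∑ c ∈ s, w.2 c * pd c F j) ∧
    ∀ c, c ∉ s → pd c F = 0 := by
  obtain ⟨s, G, h⟩ := F.2
  have h0 : ∀ j (w : (ℝ × ℝ) × (ι → ℝ)), (∀ c ∈ s, w.2 c = 0) → dir F j (0, w.2) = 0 := by
    intro j w hw
    rw [dir_eq_fderiv h]
    have : ((0, s.restrict w.2) : (ℝ × ℝ) × (s → ℝ)) = 0 := by
      refine Prod.ext rfl ?_
      ext c
      exact hw c c.2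
    rw [this, map_zero]
  refine ⟨s, fun j j' h1 h2 => ?_, fun j w => ?_, fun c hc => ?_⟩
  · rw [h.2, h.2, h1]
    congr 2
    ext c
    exact h2 c c.2
  · have hw : w = (w.1, 0) + (∑ c ∈ s, w.2 c • ((0, Pi.single c 1) : (ℝ × ℝ) × (ι → ℝ)) +
        (0, fun c => if c ∈ s then 0 else w.2 c)) := by
      refine Prod.ext ?_ ?_
      · simp [Prod.fst_sum]
      · ext d
        by_cases hd : d ∈ s <;> simp [Prod.snd_sum, Pi.single_apply, hd]
    conv_lhs => rw [hw]
    rw [dir_add_right, dir_add_right, dir_sum_right,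
      h0 j (0, fun c => if c ∈ s then 0 else w.2 c) fun c hc => by simp [hc], add_zero]
    congr 1
    exact Finset.sum_congr rfl fun c _ => by rw [dir_smul_right, pd_apply]
  · ext j
    rw [pd_apply]
    refine h0 j (0, Pi.single c 1) fun d hd => ?_
    have : d ≠ c := fun h => hc (h ▸ hd)
    simp [this]

/-- A vector field in terms of partial derivatives. -/
theorem vf_eq_sum {F : DF Ω ι} {s : Finset ι} (hs : ∀ c, c ∉ s → pd c F = 0) (e : ℝ × ℝ)
    (A : ι → DF Ω ι) : vf e A F = vf e 0 F + ∑ c ∈ s, A c * pd c F := by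
  obtain ⟨r, -, hr, hr'⟩ := exists_finset F
  have h1 : vf e A F = vf e 0 F + ∑ c ∈ r, A c * pd c F := by
    ext j
    rw [vf_apply, hr]
    simp only [add_apply, AddSubmonoidClass.coe_finsetSum, Finset.sum_apply, vf_apply]
    rfl
  rw [h1]
  congr 1
  have h2 : ∀ q : Finset ι, (∀ c, c ∉ q → pd c F = 0) →
      ∑ c ∈ q, A c * pd c F = ∑ c ∈ r ∪ s, if c ∈ q then A c * pd c F else 0 := by
    intro q hq
    rw [← Finset.sum_filter]
    refine (Finset.sum_subset (fun c hc => (Finset.mem_filter.1 hc).2) fun c hc hc' => ?_).symm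
    by_cases h : pd c F = 0
    · simp [h]
    · exact absurd (Finset.mem_filter.2 ⟨Finset.mem_union.2 (by
        by_contra h'; push Not at h'; exact h (hr' c h'.1)), hc⟩) hc'
  rw [h2 r hr', h2 s hs]
  refine Finset.sum_congr rfl fun c _ => ?_
  by_cases h : pd c F = 0
  · simp [h]
  · have h3 : c ∈ r := by by_contra h'; exact h (hr' c h')
    have h4 : c ∈ s := by by_contra h'; exact h (hs c h')
    simp [h3, h4]

/-- A field with a single component. -/
theorem vf_single (c : ι) (B : DF Ω ι) (F : DF Ω ι) : vf 0 (Pi.single c B) F = B * pd c F := by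
  ext j
  rw [mul_apply, pd_apply, vf_apply, ← dir_smul_right]
  congr 1
  refine Prod.ext (by simp) ?_
  ext d
  by_cases h : d = c
  · subst h; simp
  · simp [h]

/-- If `∂F/∂u_c` vanishes, then `F` does not depend on `u_c`. -/
theorem eq_update {F : DF Ω ι} {c : ι} (h : pd c F = 0) (p : Ω) (u : ι → ℝ) (y : ℝ) :
    F (p, Function.update u c y) = F (p, u) := by
  have h1 : ∀ z : ℝ, HasDerivAt (fun y => F (p, Function.update u c y)) 0 z := by
    intro z
    have h2 := hasDerivAt_dir F (p, Function.update u c z) (0, Pi.single c 1)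
    rw [← pd_apply, h, zero_apply] at h2
    have h3 : (fun ε => extend F.1 (line (p, Function.update u c z) (0, Pi.single c 1) ε)) =
        fun ε => F (p, Function.update u c (z + ε)) := by
      funext ε
      have : (line (p, Function.update u c z) ((0, Pi.single c 1) : (ℝ × ℝ) × (ι → ℝ)) ε).1 ∈ Ω := by
        simp [line]
      rw [extend_of_mem _ this]
      refine congrArg F.1 (Prod.ext (Subtype.ext (by simp [line])) ?_)
      ext d
      by_cases hd : d = c
      · subst hd; simp [line]
      · simp [line, hd]
    rw [h3] at h2
    simpa using HasDerivAt.comp_sub_const (f := fun ε => F (p, Function.update u c (z + ε))) z z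
      (by simpa using h2)
  have h4 := is_const_of_deriv_eq_zero (fun z => (h1 z).differentiableAt) (fun z => (h1 z).deriv) y (u c)
  simpa using h4

/-- A differential function all of whose partial derivatives with respect to jet coordinates vanish is a
function of `(t, x)`. -/
theorem exists_eq_base {F : DF Ω ι} (h : ∀ c, pd c F = 0) :
    ∃ (g : ℝ × ℝ → ℝ) (hg : ContDiffOn ℝ ∞ g Ω), F = base g hg := by
  have h1 : ∀ (p : Ω) (u : ι → ℝ), F (p, u) = F (p, 0) := by
    intro p u
    obtain ⟨s, hs, -, -⟩ := exists_finset F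
    have h2 : ∀ r : Finset ι, F (p, fun c => if c ∈ r then 0 else u c) = F (p, u) := by
      intro r
      induction r using Finset.induction_on with
      | empty => simp
      | insert c r _ ih =>
        rw [← ih, ← eq_update (h c) p (fun d => if d ∈ r then 0 else u d) 0]
        refine congrArg F.1 (Prod.ext rfl ?_)
        ext d
        by_cases hd : d = c
        · subst hd; simp
        · simp [hd]
    rw [← h2 s]
    exact hs _ _ rfl fun c hc => by simp [hc]
  obtain ⟨s, G, hG⟩ := F.2
  refine ⟨fun p => G (p, 0), hG.1.comp (ContDiff.contDiffOn (by fun_prop))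
    fun p hp => ⟨hp, mem_univ _⟩, ?_⟩
  ext j
  rw [base_apply, show F j = F (j.1, j.2) from rfl, h1, hG.2]
  rfl

/-- Every differential function has an antiderivative with respect to `u_c` that depends on no other
coordinates than the given function. -/
theorem exists_antideriv (c : ι) (F : DF Ω ι) :
    ∃ H : DF Ω ι, pd c H = F ∧ ∀ d, d ≠ c → pd d F = 0 → pd d H = 0 := by
  obtain ⟨s, G, hG⟩ : ∃ s G, c ∈ s ∧ Represents s G F.1 := by
    obtain ⟨s, G, h⟩ := F.2
    exact ⟨insert c s, _, Finset.mem_insert_self _ _, h.mono (Finset.subset_insert _ _)⟩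
  obtain ⟨hc, hG⟩ := hG
  -- the antiderivative is `u_c * I`; the interval of integration in `I` does not depend on the jet
  let I : JetOver Ω ι → ℝ := fun j => ∫ y in (0 : ℝ)..1, F (j.1, Function.update j.2 c (y * j.2 c))
  have hI : I ∈ DF Ω ι := by
    refine ⟨s, fun p => ∫ y in (0 : ℝ)..1,
      G (p.1, fun d => if d = ⟨c, hc⟩ then y * p.2 ⟨c, hc⟩ else p.2 d), ?_, fun j => ?_⟩
    · refine contDiffOn_integral_unitInterval (Ω.isOpen.prod isOpen_univ)
        (g := fun q : ((ℝ × ℝ) × (s → ℝ)) × ℝ =>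
          G (q.1.1, fun d => if d = ⟨c, hc⟩ then q.2 * q.1.2 ⟨c, hc⟩ else q.1.2 d)) ?_
      refine hG.1.comp (ContDiff.contDiffOn ?_) fun p hp => ⟨hp.1.1, mem_univ _⟩
      refine ContDiff.prodMk (by fun_prop) (contDiff_pi.2 fun d => ?_)
      split_ifs <;> fun_prop
    · refine intervalIntegral.integral_congr fun y _ => ?_
      refine (hG.2 _).trans ?_
      congr 2
      funext d
      by_cases hd : d = ⟨c, hc⟩
      · simp [hd, Finset.restrict]
      · have : (d : ι) ≠ c := fun h => hd (Subtype.ext h)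
        simp [hd, this, Finset.restrict]
  refine ⟨coord c * ⟨I, hI⟩, ?_, fun d hd hF => ?_⟩
  · ext j
    have hcont : Continuous fun y => F (j.1, Function.update j.2 c y) := by
      have : (fun y => F (j.1, Function.update j.2 c y)) = fun y =>
          G ((j.1 : ℝ × ℝ), s.restrict (Function.update j.2 c y)) := funext fun y => hG.2 _
      rw [this]
      refine hG.1.continuousOn.comp_continuous ?_ fun y => ⟨j.1.2, mem_univ _⟩
      refine Continuous.prodMk continuous_const (continuous_pi fun d => ?_)
      exact (continuous_apply (d : ι)).comp (continuous_const.update c continuous_id)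
    have h1 : HasDerivAt (fun z => ∫ y in (0 : ℝ)..z, F (j.1, Function.update j.2 c y))
        (F (j.1, Function.update j.2 c (j.2 c))) (j.2 c) :=
      intervalIntegral.integral_hasDerivAt_right (hcont.intervalIntegrable _ _)
        (hcont.stronglyMeasurableAtFilter _ _) hcont.continuousAt
    rw [Function.update_eq_self] at h1
    have h2 := HasDerivAt.comp_const_add (f := fun z => ∫ y in (0 : ℝ)..z,
      F (j.1, Function.update j.2 c y)) (j.2 c) 0 (by simpa using h1)
    rw [pd_apply]
    refine dir_congr h2 (.of_forall fun ε hε => ?_)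
    have h3 : (line j ((0, Pi.single c 1) : (ℝ × ℝ) × (ι → ℝ)) ε).2 =
        Function.update j.2 c (j.2 c + ε) := by
      ext d
      by_cases hd : d = c
      · subst hd; simp [line]
      · simp [line, hd]
    have h4 : (⟨(line j ((0, Pi.single c 1) : (ℝ × ℝ) × (ι → ℝ)) ε).1, hε⟩ : Ω) = j.1 :=
      Subtype.ext (by simp [line])
    rw [h3, h4]
    simp only [mul_apply, coord_apply, I, Function.update_self, Function.update_idem]
    rw [intervalIntegral.mul_integral_comp_mul_right
      (f := fun y => F (j.1, Function.update j.2 c y))]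
    simp
  · rw [Derivation.leibniz, pd_coord_of_ne hd.symm, smul_zero, add_zero]
    have : pd d (⟨I, hI⟩ : DF Ω ι) = 0 := by
      ext j
      rw [pd_apply]
      refine dir_congr (hasDerivAt_const 0 (I j)) (.of_forall fun ε hε => ?_)
      have h3 : (line j ((0, Pi.single d 1) : (ℝ × ℝ) × (ι → ℝ)) ε).2 =
          Function.update j.2 d (j.2 d + ε) := by
        ext d'
        by_cases hd : d' = d
        · subst hd; simp [line]
        · simp [line, hd]
      have h4 : (⟨(line j ((0, Pi.single d 1) : (ℝ × ℝ) × (ι → ℝ)) ε).1, hε⟩ : Ω) = j.1 :=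
        Subtype.ext (by simp [line])
      rw [h3, h4]
      refine intervalIntegral.integral_congr fun y _ => ?_
      simp only
      rw [Function.update_of_ne hd.symm, Function.update_comm hd, eq_update hF]
    rw [this, smul_zero]

end DF

/-! ### Differential functions on the jet space and total derivatives -/

namespace DF

section

variable {Ω : TopologicalSpace.Opens (ℝ × ℝ)} {n m : ℕ}

/-- The function `F` on the jet space, whose values outside of `Ω` are irrelevant, restricts to the
differential function `A` over `Ω`. -/
def Restricts (F : Jet n → ℝ) (A : DF Ω (Fin n × ℕ × ℕ)) : Prop :=
  ∀ (j : Jet n) (h : j.1 ∈ Ω), F j = A (⟨j.1, h⟩, j.2)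

theorem isDiffFun_iff {F : Jet n → ℝ} :
    IsDiffFun Ω F ↔ ∃ A : DF Ω (Fin n × ℕ × ℕ), Restricts F A := by
  constructor
  · rintro ⟨s, G, hG, h⟩
    exact ⟨⟨fun j => G (j.1, s.restrict j.2), s, G, hG, fun _ => rfl⟩, fun j hj => h j hj⟩
  · rintro ⟨A, h⟩
    obtain ⟨s, G, hG⟩ := A.2
    exact ⟨s, G, hG.1, fun j hj => (h j hj).trans (hG.2 _)⟩

theorem restricts_extend (A : DF Ω (Fin n × ℕ × ℕ)) : Restricts (extend A.1) A :=
  fun _ h => extend_of_mem A.1 h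

theorem Restricts.isDiffFun {F : Jet n → ℝ} {A : DF Ω (Fin n × ℕ × ℕ)} (h : Restricts F A) :
    IsDiffFun Ω F := isDiffFun_iff.2 ⟨A, h⟩

theorem Restricts.deriv_eq {F : Jet n → ℝ} {A : DF Ω (Fin n × ℕ × ℕ)} (h : Restricts F A)
    {j : Jet n} (hj : j.1 ∈ Ω) (w : (ℝ × ℝ) × (Fin n × ℕ × ℕ → ℝ)) :
    deriv (fun ε : ℝ => F (j.1 + ε • w.1, j.2 + ε • w.2)) 0 = dir A (⟨j.1, hj⟩, j.2) w := by
  refine Filter.EventuallyEq.deriv_eq ?_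
  filter_upwards [line_mem (⟨j.1, hj⟩, j.2) w] with ε hε
  rw [extend_of_mem _ hε]
  exact h _ hε

theorem Restricts.partialT_eq {F : Jet n → ℝ} {A : DF Ω (Fin n × ℕ × ℕ)} (h : Restricts F A)
    {j : Jet n} (hj : j.1 ∈ Ω) : partialT F j = dir A (⟨j.1, hj⟩, j.2) ((1, 0), 0) := by
  rw [← h.deriv_eq hj]
  have := deriv_comp_const_add (fun s : ℝ => F ((s, j.1.2), j.2)) j.1.1 0
  rw [add_zero] at this
  rw [partialT, ← this]
  congr 1
  funext ε
  exact congrArg F (Prod.ext (Prod.ext (by simp) (by simp)) (by simp))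

theorem Restricts.partialX_eq {F : Jet n → ℝ} {A : DF Ω (Fin n × ℕ × ℕ)} (h : Restricts F A)
    {j : Jet n} (hj : j.1 ∈ Ω) : partialX F j = dir A (⟨j.1, hj⟩, j.2) ((0, 1), 0) := by
  rw [← h.deriv_eq hj]
  have := deriv_comp_const_add (fun s : ℝ => F ((j.1.1, s), j.2)) j.1.2 0
  rw [add_zero] at this
  rw [partialX, ← this]
  congr 1
  funext ε
  exact congrArg F (Prod.ext (Prod.ext (by simp) (by simp)) (by simp))

theorem Restricts.partialU_eq {F : Jet n → ℝ} {A : DF Ω (Fin n × ℕ × ℕ)} (h : Restricts F A)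
    {j : Jet n} (hj : j.1 ∈ Ω) (c : Fin n × ℕ × ℕ) :
    partialU c F j = pd c A (⟨j.1, hj⟩, j.2) := by
  rw [pd_apply, ← h.deriv_eq hj]
  have := deriv_comp_const_add (fun s : ℝ => F (j.1, Function.update j.2 c s)) (j.2 c) 0
  rw [add_zero] at this
  rw [partialU, ← this]
  congr 1
  funext ε
  refine congrArg F (Prod.ext (by simp) ?_)
  ext d
  by_cases hd : d = c
  · subst hd; simp
  · simp [hd]

/-- The total derivative `D_t` as a derivation. -/
def Dt : Derivation ℝ (DF Ω (Fin n × ℕ × ℕ)) (DF Ω (Fin n × ℕ × ℕ)) :=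
  vf (1, 0) fun c => coord (c.1, c.2.1 + 1, c.2.2)

/-- The total derivative `D_x` as a derivation. -/
def Dx : Derivation ℝ (DF Ω (Fin n × ℕ × ℕ)) (DF Ω (Fin n × ℕ × ℕ)) :=
  vf (0, 1) fun c => coord (c.1, c.2.1, c.2.2 + 1)

@[simp] theorem Dt_coord (c : Fin n × ℕ × ℕ) :
    Dt (coord c : DF Ω _) = coord (c.1, c.2.1 + 1, c.2.2) := vf_coord _ _ _

@[simp] theorem Dx_coord (c : Fin n × ℕ × ℕ) :
    Dx (coord c : DF Ω _) = coord (c.1, c.2.1, c.2.2 + 1) := vf_coord _ _ _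

theorem Dt_Dx (F : DF Ω (Fin n × ℕ × ℕ)) : Dt (Dx F) = Dx (Dt F) :=
  vf_comm (fun c => by rw [vf_coord, vf_coord]) F

/-- The sum over all jet coordinates in the definition of the total derivatives is a directional derivative. -/
theorem finsum_partialU {F : Jet n → ℝ} {A : DF Ω (Fin n × ℕ × ℕ)} (h : Restricts F A)
    {j : Jet n} (hj : j.1 ∈ Ω) (e : ℝ × ℝ) (g : Fin n × ℕ × ℕ → ℝ) :
    dir A (⟨j.1, hj⟩, j.2) (e, 0) + ∑ᶠ c, partialU c F j * g c =
      dir A (⟨j.1, hj⟩, j.2) (e, g) := by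
  obtain ⟨s, -, h1, h2⟩ := exists_finset A
  rw [h1 _ (e, g)]
  congr 1
  rw [finsum_eq_sum_of_support_subset (s := s)]
  · exact Finset.sum_congr rfl fun c _ => by rw [h.partialU_eq hj, mul_comm]
  · intro c hc
    by_contra hcs
    refine hc ?_
    simp only
    rw [h.partialU_eq hj, h2 c hcs]
    simp

theorem Restricts.totalT {F : Jet n → ℝ} {A : DF Ω (Fin n × ℕ × ℕ)} (h : Restricts F A) :
    Restricts (totalT F) (Dt A) := fun j hj => by
  rw [GenBurgers.totalT, h.partialT_eq hj, finsum_partialU h hj]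
  rfl

theorem Restricts.totalX {F : Jet n → ℝ} {A : DF Ω (Fin n × ℕ × ℕ)} (h : Restricts F A) :
    Restricts (totalX F) (Dx A) := fun j hj => by
  rw [GenBurgers.totalX, h.partialX_eq hj, finsum_partialU h hj]
  rfl

theorem Restricts.iterate {F : Jet n → ℝ} {A : DF Ω (Fin n × ℕ × ℕ)} (h : Restricts F A) (a b : ℕ) :
    Restricts (GenBurgers.totalT^[a] (GenBurgers.totalX^[b] F)) (Dt^[a] (Dx^[b] A)) := by
  induction a with
  | zero =>
    induction b with
    | zero => exact h
    | succ b ih =>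
      simp only [Function.iterate_zero, id, Function.iterate_succ_apply'] at ih ⊢
      exact ih.totalX
  | succ a ih =>
    simp only [Function.iterate_succ_apply']
    exact ih.totalT

theorem Restricts.totalDiv {F : (Jet n → ℝ) × (Jet n → ℝ)} {A B : DF Ω (Fin n × ℕ × ℕ)}
    (hA : Restricts F.1 A) (hB : Restricts F.2 B) : Restricts (totalDiv F) (Dt A + Dx B) :=
  fun j hj => by rw [GenBurgers.totalDiv, hA.totalT j hj, hB.totalX j hj]; rfl

/-- The manifold in the jet space over `Ω` that is defined by the system `A` and all its differential
consequences. -/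
def manifold (A : Fin m → DF Ω (Fin n × ℕ × ℕ)) : Set (JetOver Ω (Fin n × ℕ × ℕ)) :=
  {j | ∀ (k : Fin m) (a b : ℕ), (Dt^[a] (Dx^[b] (A k)) : DF Ω _) j = 0}

theorem mem_solutionManifold {E : Fin m → Jet n → ℝ} {A : Fin m → DF Ω (Fin n × ℕ × ℕ)}
    (h : ∀ k, Restricts (E k) (A k)) {j : Jet n} :
    j ∈ solutionManifold Ω E ↔ ∃ hj : j.1 ∈ Ω, (⟨j.1, hj⟩, j.2) ∈ manifold A := by
  constructor
  · rintro ⟨hj, h1⟩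
    exact ⟨hj, fun k a b => by rw [← (h k).iterate a b j hj]; exact h1 k a b⟩
  · rintro ⟨hj, h1⟩
    exact ⟨hj, fun k a b => by rw [(h k).iterate a b j hj]; exact h1 k a b⟩

theorem mem_conservedVectors {E : Fin m → Jet n → ℝ} {A : Fin m → DF Ω (Fin n × ℕ × ℕ)}
    (h : ∀ k, Restricts (E k) (A k)) {F : (Jet n → ℝ) × (Jet n → ℝ)} {R S : DF Ω (Fin n × ℕ × ℕ)}
    (hR : Restricts F.1 R) (hS : Restricts F.2 S) :
    F ∈ conservedVectors Ω E ↔ ∀ j ∈ manifold A, (Dt R + Dx S) j = 0 := by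
  constructor
  · rintro ⟨-, -, h1⟩ j hj
    rw [← h1 ((j.1 : ℝ × ℝ), j.2) ((mem_solutionManifold h).2 ⟨j.1.2, hj⟩)]
    exact (hR.totalDiv hS ((j.1 : ℝ × ℝ), j.2) j.1.2).symm
  · intro h1
    refine ⟨hR.isDiffFun, hS.isDiffFun, fun j hj => ?_⟩
    obtain ⟨hj, hm⟩ := (mem_solutionManifold h).1 hj
    rw [hR.totalDiv hS j hj, h1 _ hm]

theorem mem_trivialVectors {E : Fin m → Jet n → ℝ} {A : Fin m → DF Ω (Fin n × ℕ × ℕ)}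
    (h : ∀ k, Restricts (E k) (A k)) {F : (Jet n → ℝ) × (Jet n → ℝ)} {R S : DF Ω (Fin n × ℕ × ℕ)}
    (hR : Restricts F.1 R) (hS : Restricts F.2 S) :
    F ∈ trivialVectors Ω E ↔ ∃ G H : DF Ω (Fin n × ℕ × ℕ), Dt G + Dx H = 0 ∧
      ∀ j ∈ manifold A, R j = G j ∧ S j = H j := by
  constructor
  · rintro ⟨-, -, G, h1, h2, h3, h4⟩
    obtain ⟨G1, h1⟩ := isDiffFun_iff.1 h1
    obtain ⟨G2, h2⟩ := isDiffFun_iff.1 h2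
    refine ⟨G1, G2, ext fun j => ?_, fun j hj => ?_⟩
    · rw [← h1.totalDiv h2 ((j.1 : ℝ × ℝ), j.2) j.1.2]
      exact h3 _ j.1.2
    · have := h4 ((j.1 : ℝ × ℝ), j.2) ((mem_solutionManifold h).2 ⟨j.1.2, hj⟩)
      rwa [hR _ j.1.2, hS _ j.1.2, h1 _ j.1.2, h2 _ j.1.2] at this
  · rintro ⟨G, H, h1, h2⟩
    refine ⟨hR.isDiffFun, hS.isDiffFun, (extend G.1, extend H.1), (restricts_extend G).isDiffFun,
      (restricts_extend H).isDiffFun, fun j hj => ?_, fun j hj => ?_⟩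
    · rw [Restricts.totalDiv (F := (extend G.1, extend H.1)) (restricts_extend G) (restricts_extend H) j hj,
        h1]
      rfl
    · obtain ⟨hj, hm⟩ := (mem_solutionManifold h).1 hj
      change F.1 j = extend G.1 j ∧ F.2 j = extend H.1 j
      rw [hR j hj, hS j hj, restricts_extend G j hj, restricts_extend H j hj]
      exact h2 _ hm

/-- If all total derivatives of `F` vanish at `j`, then so do those of every multiple of `F`. -/
theorem iterate_mul_eq_zero {F : DF Ω (Fin n × ℕ × ℕ)} {j : JetOver Ω (Fin n × ℕ × ℕ)}
    (h : ∀ a b, (Dt^[a] (Dx^[b] F) : DF Ω _) j = 0) (g : DF Ω (Fin n × ℕ × ℕ)) (a b : ℕ) :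
    (Dt^[a] (Dx^[b] (g * F)) : DF Ω _) j = 0 := by
  have hadd : ∀ a b (F G : DF Ω (Fin n × ℕ × ℕ)),
      Dt^[a] (Dx^[b] (F + G)) = Dt^[a] (Dx^[b] F) + Dt^[a] (Dx^[b] G) := by
    intro a b F G
    rw [iterate_map_add, iterate_map_add]
  induction b generalizing F g with
  | zero =>
    simp only [Function.iterate_zero, id]
    induction a generalizing F g with
    | zero =>
      have := h 0 0
      simp only [Function.iterate_zero, id] at this
      simp [this]
    | succ a ih =>
      rw [Function.iterate_succ_apply, Derivation.leibniz, smul_eq_mul, smul_eq_mul, iterate_map_add,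
        add_apply, mul_comm F, ih h, ih fun a b => ?_, add_zero]
      have h2 : Dx^[b] (Dt F) = Dt (Dx^[b] F) := ((Function.Commute.iterate_right
        (f := (Dt : DF Ω (Fin n × ℕ × ℕ) → _)) (g := Dx) Dt_Dx b) F).symm
      rw [h2, ← Function.iterate_succ_apply]
      exact h _ _
  | succ b ih =>
    rw [Function.iterate_succ_apply, Derivation.leibniz, smul_eq_mul, smul_eq_mul, hadd,
      add_apply, mul_comm F, ih h, ih fun a b => ?_, add_zero]
    rw [← Function.iterate_succ_apply]
    exact h _ _

end

end DF

/-! ### Evolution equations: jets of solutions at fixed time -/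

namespace DF

section

variable {Ω : TopologicalSpace.Opens (ℝ × ℝ)}

/-- The total derivative with respect to `x` on differential functions of `t`, `x` and the `x`-derivatives
`u_b` of `u`. -/
def D : Derivation ℝ (DF Ω ℕ) (DF Ω ℕ) := vf (0, 1) fun b => coord (b + 1)

/-- The total derivative with respect to `t` by virtue of the evolution equation `u_t = K`. -/
def evo (K : DF Ω ℕ) : Derivation ℝ (DF Ω ℕ) (DF Ω ℕ) := vf (1, 0) fun b => D^[b] K

@[simp] theorem D_coord (b : ℕ) : D (coord b : DF Ω ℕ) = coord (b + 1) := vf_coord _ _ _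

@[simp] theorem evo_coord (K : DF Ω ℕ) (b : ℕ) : evo K (coord b) = D^[b] K := vf_coord _ _ _

theorem evo_D (K F : DF Ω ℕ) : evo K (D F) = D (evo K F) :=
  vf_comm (fun b => by
    refine (evo_coord K (b + 1)).trans ?_
    rw [Function.iterate_succ_apply']; rfl) F

/-- The coordinates on the manifold of `u_t = K` in terms of the `x`-derivatives of `u`. -/
def evoCoord (K : DF Ω ℕ) (c : Fin 1 × ℕ × ℕ) : DF Ω ℕ := (evo K)^[c.2.1] (coord c.2.2)

/-- The restriction of differential functions to the manifold of `u_t = K`. -/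
abbrev onShell (K : DF Ω ℕ) : DF Ω (Fin 1 × ℕ × ℕ) →ₐ[ℝ] DF Ω ℕ := subst (evoCoord K)

/-- A differential function of `x`-derivatives as a function on the jet space. -/
abbrev lift : DF Ω ℕ →ₐ[ℝ] DF Ω (Fin 1 × ℕ × ℕ) := subst fun b => coord (0, 0, b)

/-- The left-hand side of the evolution equation `u_t - K = 0`. -/
def evoEq (K : DF Ω ℕ) : DF Ω (Fin 1 × ℕ × ℕ) := coord (0, 1, 0) - lift K

theorem D_evo_iterate (K : DF Ω ℕ) (a : ℕ) (F : DF Ω ℕ) : D ((evo K)^[a] F) = (evo K)^[a] (D F) :=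
  Function.Commute.iterate_right (f := (D : DF Ω ℕ → _)) (g := evo K) (fun F => (evo_D K F).symm) a F

theorem onShell_Dt (K : DF Ω ℕ) (F : DF Ω (Fin 1 × ℕ × ℕ)) :
    onShell K (Dt F) = evo K (onShell K F) :=
  (vf_subst (fun c => by
    rw [subst_coord, evoCoord, evoCoord, Function.iterate_succ_apply']; rfl) F).symm

theorem onShell_Dx (K : DF Ω ℕ) (F : DF Ω (Fin 1 × ℕ × ℕ)) :
    onShell K (Dx F) = D (onShell K F) :=
  (vf_subst (fun c => by
    rw [subst_coord, evoCoord, evoCoord]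
    exact (D_evo_iterate K _ _).trans (by rw [D_coord])) F).symm

@[simp] theorem onShell_lift (K F : DF Ω ℕ) : onShell K (lift F) = F := rfl

@[simp] theorem onShell_evoEq (K : DF Ω ℕ) : onShell K (evoEq K) = 0 := by
  rw [evoEq, map_sub, onShell_lift, subst_coord, evoCoord]
  simp

theorem onShell_iterate (K : DF Ω ℕ) (a b : ℕ) (F : DF Ω (Fin 1 × ℕ × ℕ)) :
    onShell K (Dt^[a] (Dx^[b] F)) = (evo K)^[a] (D^[b] (onShell K F)) := by
  have h1 : ∀ F, onShell K (Dx^[b] F) = D^[b] (onShell K F) := by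
    induction b with
    | zero => intro F; rfl
    | succ b ih => intro F; rw [Function.iterate_succ_apply, ih, onShell_Dx, Function.iterate_succ_apply]
  induction a with
  | zero => exact h1 F
  | succ a ih => rw [Function.iterate_succ_apply', onShell_Dt, ih, Function.iterate_succ_apply']

theorem substPoint_mem_manifold (K : DF Ω ℕ) (j : JetOver Ω ℕ) :
    substPoint (evoCoord K) j ∈ manifold fun _ : Fin 1 => evoEq K := by
  intro k a b
  have h : onShell K (Dt^[a] (Dx^[b] (evoEq K))) j = 0 := by
    rw [onShell_iterate, onShell_evoEq, iterate_map_zero, iterate_map_zero]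
    rfl
  exact h

/-- `F` does not involve derivatives that contain more than `a` differentiations with respect to `t`. -/
def TimeOrderLE {n : ℕ} (a : ℕ) (F : DF Ω (Fin n × ℕ × ℕ)) : Prop :=
  ∀ j j' : JetOver Ω (Fin n × ℕ × ℕ), j.1 = j'.1 →
    (∀ i a' b, a' ≤ a → j.2 (i, a', b) = j'.2 (i, a', b)) → F j = F j'

theorem TimeOrderLE.dir_eq {n a : ℕ} {F : DF Ω (Fin n × ℕ × ℕ)} (h : TimeOrderLE a F)
    {j j' : JetOver Ω (Fin n × ℕ × ℕ)} (hj : j.1 = j'.1)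
    (hj' : ∀ i a' b, a' ≤ a → j.2 (i, a', b) = j'.2 (i, a', b)) {w w' : (ℝ × ℝ) × (Fin n × ℕ × ℕ → ℝ)}
    (hw : w.1 = w'.1) (hw' : ∀ i a' b, a' ≤ a → w.2 (i, a', b) = w'.2 (i, a', b)) :
    dir F j w = dir F j' w' := by
  unfold dir
  congr 1
  funext ε
  have h1 : (line j w ε).1 = (line j' w' ε).1 := by simp [line, hj, hw]
  by_cases hε : (line j w ε).1 ∈ Ω
  · rw [extend_of_mem _ hε, extend_of_mem _ (h1 ▸ hε)]
    exact h _ _ (Subtype.ext h1) fun i a' b ha => by simp [line, hj' i a' b ha, hw' i a' b ha]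
  · rw [extend, extend, dif_neg hε, dif_neg (h1 ▸ hε)]

theorem TimeOrderLE.Dx {n a : ℕ} {F : DF Ω (Fin n × ℕ × ℕ)} (h : TimeOrderLE a F) :
    TimeOrderLE a (Dx F) := fun _ _ hj hj' =>
  h.dir_eq hj hj' rfl fun i a' b ha => hj' i a' (b + 1) ha

theorem TimeOrderLE.Dt {n a : ℕ} {F : DF Ω (Fin n × ℕ × ℕ)} (h : TimeOrderLE a F) :
    TimeOrderLE (a + 1) (Dt F) := fun _ _ hj hj' =>
  h.dir_eq hj (fun i a' b ha => hj' i a' b (by omega)) rfl fun i a' b ha => hj' i (a' + 1) b (by omega)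

/-- The equation `D_tᵃ D_xᵇ (u_t - K) = 0` expresses `∂ₜᵃ⁺¹ ∂ₓᵇ u` in terms of derivatives with at most `a`
differentiations with respect to `t`. -/
theorem timeOrderLE_iterate_lift (K : DF Ω ℕ) (a b : ℕ) :
    TimeOrderLE a (Dt^[a] (Dx^[b] (lift K))) := by
  induction a with
  | zero =>
    induction b with
    | zero =>
      intro j j' h1 h2
      exact congrArg K.1 (Prod.ext h1 (funext fun b => h2 0 0 b le_rfl))
    | succ b ih =>
      simp only [Function.iterate_zero, id, Function.iterate_succ_apply'] at ih ⊢
      exact ih.Dx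
  | succ a ih =>
    rw [Function.iterate_succ_apply']
    exact ih.Dt

theorem iterate_evoEq (K : DF Ω ℕ) (a b : ℕ) :
    Dt^[a] (Dx^[b] (evoEq K)) = coord (0, a + 1, b) - Dt^[a] (Dx^[b] (lift K)) := by
  have h1 : Dx^[b] (coord (0, 1, 0) : DF Ω (Fin 1 × ℕ × ℕ)) = coord (0, 1, b) := by
    induction b with
    | zero => rfl
    | succ b ih => rw [Function.iterate_succ_apply', ih, Dx_coord]
  have h2 : Dt^[a] (coord (0, 1, b) : DF Ω (Fin 1 × ℕ × ℕ)) = coord (0, a + 1, b) := by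
    induction a with
    | zero => rfl
    | succ a ih => rw [Function.iterate_succ_apply', ih, Dt_coord]
  rw [evoEq, iterate_map_sub, iterate_map_sub, h1, h2]

/-- The manifold of `u_t = K` is parametrized by the `x`-derivatives of `u`. -/
theorem eq_substPoint_of_mem_manifold {K : DF Ω ℕ} {j : JetOver Ω (Fin 1 × ℕ × ℕ)}
    (hj : j ∈ manifold fun _ : Fin 1 => evoEq K) :
    j = substPoint (evoCoord K) (j.1, fun b => j.2 (0, 0, b)) := by
  set r : JetOver Ω ℕ := (j.1, fun b => j.2 (0, 0, b)) with hr
  have hrm := substPoint_mem_manifold K r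
  -- both jets satisfy all differential consequences, which determine the `t`-derivatives successively
  have key : ∀ a b, j.2 (0, a, b) = (substPoint (evoCoord K) r).2 (0, a, b) := by
    intro a
    induction a using Nat.strong_induction_on with
    | _ a ih =>
      intro b
      rcases a with - | a
      · rfl
      · have h1 := hj 0 a b
        have h2 := hrm 0 a b
        rw [iterate_evoEq, sub_apply, coord_apply, sub_eq_zero] at h1 h2
        rw [h1, h2]
        refine timeOrderLE_iterate_lift K a b _ _ rfl fun i a' b' ha => ?_
        rw [Subsingleton.elim i 0]
        exact ih a' (by omega) b'
  refine Prod.ext rfl (funext fun ⟨i, a, b⟩ => ?_)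
  rw [Subsingleton.elim i 0]
  exact key a b

/-- Equality on the manifold is equality after the restriction. -/
theorem forall_manifold {K : DF Ω ℕ} {F G : DF Ω (Fin 1 × ℕ × ℕ)} :
    (∀ j ∈ manifold fun _ : Fin 1 => evoEq K, F j = G j) ↔ onShell K F = onShell K G := by
  constructor
  · intro h
    ext j
    exact h _ (substPoint_mem_manifold K j)
  · intro h j hj
    rw [eq_substPoint_of_mem_manifold hj]
    exact congrArg (fun H : DF Ω ℕ => H _) h

end

/-! ### Characteristics of trivial conservation laws of evolution equations -/

/-- The formal adjoint argument: if `∑ c a b ∂ₜᵃ ∂ₓᵇ h` and `∑ d a b ∂ₜᵃ ∂ₓᵇ h` are the components of a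
vector with total divergence `μ h` for an arbitrary function `h`, then `μ = 0`. -/
theorem eq_zero_of_formal_divergence {V : Type*} [AddCommGroup V] [Module ℝ V] (T X : V →ₗ[ℝ] V)
    (hTX : ∀ v, T (X v) = X (T v)) (c d : ℕ → ℕ → V) (N : ℕ)
    (hc : ∀ a b, N ≤ a → c a b = 0) (hd : ∀ a b, N ≤ b → d a b = 0) (μ : V)
    (h : ∀ a b, T (c a b) + (if a = 0 then 0 else c (a - 1) b) + X (d a b) +
      (if b = 0 then 0 else d a (b - 1)) = if a = 0 ∧ b = 0 then μ else 0) : μ = 0 := by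
  -- summation of the equations with the weights `(-T)ᵃ` eliminates `c`, and leaves a recursion for `e` in `b`
  let S : ℕ → Module.End ℝ V := fun a => (-T : Module.End ℝ V) ^ a
  have hS : ∀ a v, S (a + 1) v = -S a (T v) := by
    intro a v
    simp only [S, pow_succ, Module.End.mul_apply]
    exact map_neg _ _
  have hSX : ∀ a v, S a (X v) = X (S a v) := by
    intro a
    induction a with
    | zero => intro v; rfl
    | succ a ih => intro v; rw [hS, hS, hTX, ih, map_neg]
  let e : ℕ → V := fun b => ∑ a ∈ Finset.range (N + 1), S a (d a b)
  have tele : ∀ b n, ∑ a ∈ Finset.range (n + 1), S a (T (c a b) + (if a = 0 then 0 else c (a - 1) b)) =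
      S n (T (c n b)) := by
    intro b n
    induction n with
    | zero => simp
    | succ n ih =>
      rw [Finset.sum_range_succ, ih]
      simp [hS]
  have he : ∀ b, X (e b) + (if b = 0 then 0 else e (b - 1)) = if b = 0 then μ else 0 := by
    intro b
    have h1 : ∑ a ∈ Finset.range (N + 1), S a (T (c a b) + (if a = 0 then 0 else c (a - 1) b) +
        X (d a b) + (if b = 0 then 0 else d a (b - 1))) =
        ∑ a ∈ Finset.range (N + 1), S a (if a = 0 ∧ b = 0 then μ else 0) :=
      Finset.sum_congr rfl fun a _ => by rw [h]
    have h2 : ∑ a ∈ Finset.range (N + 1), S a (if a = 0 ∧ b = 0 then μ else 0) =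
        if b = 0 then μ else 0 := by
      rw [Finset.sum_eq_single 0]
      · simp [S]
      · intro a _ ha; simp [ha]
      · simp
    rw [h2] at h1
    rw [← h1]
    simp only [map_add, Finset.sum_add_distrib]
    have h3 := tele b N
    simp only [map_add, Finset.sum_add_distrib] at h3
    rw [h3, hc N b le_rfl, map_zero, map_zero, zero_add]
    congr 1
    · simp only [e, map_sum, hSX]
    · by_cases hb : b = 0 <;> simp [hb, e]
  -- `e` vanishes at `b = N`, hence at all smaller `b`, and the equation for `b = 0` becomes `0 = μ`
  have hz : ∀ k b, b + k = N → e b = 0 := by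
    intro k
    induction k with
    | zero =>
      intro b hb
      exact Finset.sum_eq_zero fun a _ => by rw [hd a b (by omega), map_zero]
    | succ k ih =>
      intro b hb
      have := he (b + 1)
      rw [ih (b + 1) (by omega)] at this
      simpa using this
  have h0 := he 0
  rw [hz N 0 (by omega)] at h0
  simpa using h0.symm

section

variable {Ω : TopologicalSpace.Opens (ℝ × ℝ)}

/-- Jet coordinates adapted to the equation `u_t = K`, whose left-hand side `h = u_t - K` is introduced as a second
dependent variable: the `x`-derivatives of `u` and all derivatives of `h`. -/
abbrev Idx₂ : Type := ℕ ⊕ (ℕ × ℕ)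

/-- The total derivative with respect to `x` on differential functions of `u` and `h`. -/
def X₂ : Derivation ℝ (DF Ω Idx₂) (DF Ω Idx₂) :=
  vf (0, 1) (Sum.elim (fun b => coord (Sum.inl (b + 1))) fun c => coord (Sum.inr (c.1, c.2 + 1)))

/-- The right-hand side of `u_t = K + h`. -/
def K₂ (K : DF Ω ℕ) : DF Ω Idx₂ := subst (fun b => coord (Sum.inl b)) K + coord (Sum.inr (0, 0))

/-- The total derivative with respect to `t` by virtue of `u_t = K + h`. -/
def T₂ (K : DF Ω ℕ) : Derivation ℝ (DF Ω Idx₂) (DF Ω Idx₂) :=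
  vf (1, 0) (Sum.elim (fun b => X₂^[b] (K₂ K)) fun c => coord (Sum.inr (c.1 + 1, c.2)))

theorem X₂_inl (b : ℕ) : X₂ (coord (Sum.inl b) : DF Ω Idx₂) = coord (Sum.inl (b + 1)) := vf_coord _ _ _
theorem X₂_inr (c : ℕ × ℕ) : X₂ (coord (Sum.inr c) : DF Ω Idx₂) = coord (Sum.inr (c.1, c.2 + 1)) :=
  vf_coord _ _ _
theorem T₂_inl (K : DF Ω ℕ) (b : ℕ) : T₂ K (coord (Sum.inl b)) = X₂^[b] (K₂ K) := vf_coord _ _ _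
theorem T₂_inr (K : DF Ω ℕ) (c : ℕ × ℕ) :
    T₂ K (coord (Sum.inr c)) = coord (Sum.inr (c.1 + 1, c.2)) := vf_coord _ _ _

theorem T₂_X₂ (K : DF Ω ℕ) (F : DF Ω Idx₂) : T₂ K (X₂ F) = X₂ (T₂ K F) := by
  refine vf_comm (fun c => ?_) F
  rcases c with b | c
  · exact (T₂_inl K (b + 1)).trans (Function.iterate_succ_apply' _ _ _)
  · exact (T₂_inr K _).trans (X₂_inr (c.1 + 1, c.2)).symm

/-- The derivatives of `u` in terms of its `x`-derivatives and the derivatives of `h`. -/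
def coord₂ (K : DF Ω ℕ) (c : Fin 1 × ℕ × ℕ) : DF Ω Idx₂ := (T₂ K)^[c.2.1] (coord (Sum.inl c.2.2))

theorem subst₂_Dt (K : DF Ω ℕ) (F : DF Ω (Fin 1 × ℕ × ℕ)) :
    subst (coord₂ K) (Dt F) = T₂ K (subst (coord₂ K) F) :=
  (vf_subst (fun c => by
    rw [subst_coord, coord₂, coord₂, Function.iterate_succ_apply']; rfl) F).symm

theorem subst₂_Dx (K : DF Ω ℕ) (F : DF Ω (Fin 1 × ℕ × ℕ)) :
    subst (coord₂ K) (Dx F) = X₂ (subst (coord₂ K) F) :=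
  (vf_subst (fun c => by
    rw [subst_coord, coord₂, coord₂]
    exact (Function.Commute.iterate_right (f := (X₂ : DF Ω Idx₂ → _)) (g := T₂ K)
      (fun F => (T₂_X₂ K F).symm) _ _).trans (by rw [X₂_inl])) F).symm

theorem subst₂_evoEq (K : DF Ω ℕ) : subst (coord₂ K) (evoEq K) = coord (Sum.inr (0, 0)) := by
  rw [evoEq, map_sub, subst_coord]
  have h1 : coord₂ K (0, 1, 0) = K₂ K := T₂_inl K 0
  have h2 : subst (coord₂ K) (lift K) = subst (fun b => coord (Sum.inl b)) K := rfl
  rw [h1, h2, K₂, add_sub_cancel_left]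

/-- Restriction to `h = 0`. -/
abbrev atZero : DF Ω Idx₂ →ₐ[ℝ] DF Ω ℕ := subst (Sum.elim coord fun _ => 0)

theorem atZero_X₂ (F : DF Ω Idx₂) : atZero (X₂ F) = D (atZero F) := by
  refine (vf_subst (fun c => ?_) F).symm
  rcases c with b | c
  · exact D_coord b
  · exact map_zero _

theorem atZero_X₂_iterate (b : ℕ) (F : DF Ω Idx₂) : atZero (X₂^[b] F) = D^[b] (atZero F) := by
  induction b with
  | zero => rfl
  | succ b ih => rw [Function.iterate_succ_apply', atZero_X₂, ih, Function.iterate_succ_apply']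

theorem atZero_K₂ (K : DF Ω ℕ) : atZero (K₂ K) = K := by
  rw [K₂, map_add, subst_coord]
  exact add_zero K

theorem atZero_T₂ (K : DF Ω ℕ) (F : DF Ω Idx₂) : atZero (T₂ K F) = evo K (atZero F) := by
  refine (vf_subst (fun c => ?_) F).symm
  rcases c with b | c
  · refine (evo_coord K b).trans ?_
    rw [Sum.elim_inl, atZero_X₂_iterate, atZero_K₂]
  · exact map_zero _

theorem atZero_coord₂ (K : DF Ω ℕ) (F : DF Ω (Fin 1 × ℕ × ℕ)) :
    atZero (subst (coord₂ K) F) = onShell K F := by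
  rw [subst_subst]
  congr 2
  funext c
  unfold coord₂ evoCoord
  induction c.2.1 with
  | zero => rfl
  | succ a ih => rw [Function.iterate_succ_apply', atZero_T₂, ih, Function.iterate_succ_apply']

/-- At `h = 0`, directional derivatives along the `u`-coordinates vanish if `F` vanishes for `h = 0`. -/
theorem atZero_vf_inl {F : DF Ω Idx₂} (hF : atZero F = 0) (A : ℕ → DF Ω Idx₂) :
    atZero (vf 0 (Sum.elim A fun _ => 0) F) = 0 := by
  ext j
  have h1 := dir_subst (Sum.elim coord fun _ => 0) F j
    (0, fun b => A b (substPoint (Sum.elim coord fun _ => 0) j))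
  rw [show subst (Sum.elim coord fun _ => 0) F = 0 from hF] at h1
  have h2 : dir (0 : DF Ω ℕ) j (0, fun b => A b (substPoint (Sum.elim coord fun _ => 0) j)) = 0 :=
    dir_congr (hasDerivAt_const 0 0) (.of_forall fun ε hε => rfl)
  rw [h2] at h1
  rw [subst_apply, vf_apply, zero_apply, h1]
  congr 2
  funext c
  rcases c with b | c
  · simp [substPoint]
  · exact (h2.symm ▸ dir_congr (hasDerivAt_const 0 0) (.of_forall fun ε hε => rfl) : dir 0 j _ = _).symm

/-- The coefficient of `∂ₜᵃ ∂ₓᵇ h` in the linearization of `F` at `h = 0`. -/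
def linCoeff (F : DF Ω Idx₂) (a b : ℕ) : DF Ω ℕ := atZero (pd (Sum.inr (a, b)) F)

theorem linCoeff_X₂ {F : DF Ω Idx₂} (a b : ℕ) :
    linCoeff (X₂ F) a b = D (linCoeff F a b) + if b = 0 then 0 else linCoeff F a (b - 1) := by
  rw [linCoeff, X₂, pd_vf, map_add]
  congr 1
  · exact atZero_X₂ _
  · rcases b with - | b
    · have : (fun d => pd (Sum.inr (a, 0)) ((Sum.elim (fun b => coord (Sum.inl (b + 1)))
          fun c => coord (Sum.inr (c.1, c.2 + 1)) : Idx₂ → DF Ω Idx₂) d)) = 0 := by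
        funext d
        rcases d with d | d
        · exact pd_coord_of_ne (by simp)
        · exact pd_coord_of_ne (by simp)
      rw [this, vf_zero_zero, map_zero, if_pos rfl]
    · have : (fun d => pd (Sum.inr (a, b + 1)) ((Sum.elim (fun b => coord (Sum.inl (b + 1)))
          fun c => coord (Sum.inr (c.1, c.2 + 1)) : Idx₂ → DF Ω Idx₂) d)) =
          Pi.single (Sum.inr (a, b)) 1 := by
        funext d
        rcases d with d | ⟨d1, d2⟩
        · simp [pd_coord]
        · simp [pd_coord, Pi.single_apply]
      rw [this, vf_single, one_mul, if_neg (by omega)]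
      rfl

/-- The right-hand side `K + h` contributes to the linearization only through the `u`-derivatives of `F`, which
vanish at `h = 0` if `F` does. -/
theorem linCoeff_T₂ {K : DF Ω ℕ} {F : DF Ω Idx₂} (hF : atZero F = 0) (a b : ℕ) :
    linCoeff (T₂ K F) a b = evo K (linCoeff F a b) + if a = 0 then 0 else linCoeff F (a - 1) b := by
  rw [linCoeff, T₂, pd_vf, map_add]
  congr 1
  · exact atZero_T₂ _ _
  · have h1 : (fun d => pd (Sum.inr (a, b)) ((Sum.elim (fun b => X₂^[b] (K₂ K))
        fun c => coord (Sum.inr (c.1 + 1, c.2)) : Idx₂ → DF Ω Idx₂) d)) =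
        Sum.elim (fun d => pd (Sum.inr (a, b)) (X₂^[d] (K₂ K))) (fun _ => 0) +
        (if a = 0 then 0 else Pi.single (Sum.inr (a - 1, b)) 1) := by
      funext d
      rcases a with - | a
      · rcases d with d | ⟨d1, d2⟩
        · simp
        · simp [pd_coord]
      · rcases d with d | ⟨d1, d2⟩
        · simp
        · simp [pd_coord, Pi.single_apply]
    rw [h1, vf_zero_add, map_add, atZero_vf_inl hF, zero_add]
    rcases a with - | a
    · simp only [if_true]
      rw [vf_zero_zero, map_zero]
    · simp only [Nat.add_eq_zero_iff, one_ne_zero, and_false, if_false]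
      rw [vf_single, one_mul]
      rfl

theorem linCoeff_eventually_zero (F : DF Ω Idx₂) :
    ∃ N, ∀ a b, N ≤ a ∨ N ≤ b → linCoeff F a b = 0 := by
  obtain ⟨s, -, -, hs⟩ := exists_finset F
  refine ⟨s.sup (Sum.elim id fun c => max c.1 c.2) + 1, fun a b h => ?_⟩
  rw [linCoeff, hs _ fun h' => ?_, map_zero]
  have := Finset.le_sup (f := Sum.elim id fun c : ℕ × ℕ => max c.1 c.2) h'
  simp only [Sum.elim_inr] at this
  omega

/-- If a pair of differential functions has total divergence `μ E`, and its density vanishes on the manifold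
of `u_t = K`, then `μ` vanishes on this manifold as well: the linearization at `h = 0` of the pair, as a
function of the derivatives of `h = E`, is a formal divergence that equals `μ h`. -/
theorem onShell_eq_zero_of_div {K : DF Ω ℕ} {R S μ : DF Ω (Fin 1 × ℕ × ℕ)}
    (hR : onShell K R = 0) (h : Dt R + Dx S = μ * evoEq K) :
    onShell K μ = 0 := by
  have h1 := congrArg (subst (coord₂ K)) h
  rw [map_add, map_mul, subst₂_Dt, subst₂_Dx, subst₂_evoEq] at h1
  set R' := subst (coord₂ K) R with hR'
  set S' := subst (coord₂ K) S with hS'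
  set μ' := subst (coord₂ K) μ with hμ'
  have hR0 : atZero R' = 0 := (atZero_coord₂ K R).trans hR
  obtain ⟨N, hN⟩ := linCoeff_eventually_zero R'
  obtain ⟨N', hN'⟩ := linCoeff_eventually_zero S'
  refine eq_zero_of_formal_divergence (evo K : DF Ω ℕ →ₗ[ℝ] DF Ω ℕ)
    ((D : Derivation ℝ (DF Ω ℕ) (DF Ω ℕ)) : DF Ω ℕ →ₗ[ℝ] DF Ω ℕ) (evo_D K) (linCoeff R') (linCoeff S') (max N N')
    (fun a b h => hN a b (by omega)) (fun a b h => hN' a b (by omega)) _ (fun a b => ?_)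
  have h2 : linCoeff (T₂ K R' + X₂ S') a b = linCoeff (μ' * coord (Sum.inr (0, 0))) a b :=
    congrArg (fun F => linCoeff F a b) h1
  have h3 : linCoeff (μ' * coord (Sum.inr (0, 0))) a b = if a = 0 ∧ b = 0 then onShell K μ else 0 := by
    rw [linCoeff, Derivation.leibniz, pd_coord, map_add, smul_eq_mul, smul_eq_mul, map_mul, map_mul,
      subst_coord, Sum.elim_inr, zero_mul, add_zero, hμ', atZero_coord₂]
    by_cases hab : a = 0 ∧ b = 0
    · obtain ⟨rfl, rfl⟩ := hab
      simp
    · rw [if_neg hab, if_neg, map_zero, mul_zero]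
      intro h
      simp only [Sum.inr.injEq, Prod.mk.injEq] at h
      exact hab ⟨h.1.symm, h.2.symm⟩
  have h4 : linCoeff (T₂ K R' + X₂ S') a b = linCoeff (T₂ K R') a b + linCoeff (X₂ S') a b := by
    rw [linCoeff, map_add, map_add]
    rfl
  rw [h3, h4, linCoeff_T₂ hR0, linCoeff_X₂] at h2
  rw [← h2]
  exact add_assoc _ _ _

end

end DF

/-! ### Conservation laws of quasilinear second-order evolution equations -/

namespace DF

section

variable {Ω : TopologicalSpace.Opens (ℝ × ℝ)}

theorem pd_zero_D (F : DF Ω ℕ) : pd 0 (D F) = D (pd 0 F) := by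
  rw [D, pd_vf, add_eq_left]
  have : (fun d => pd 0 (coord (d + 1) : DF Ω ℕ)) = 0 := funext fun d => pd_coord_of_ne (by simp)
  rw [this, vf_zero_zero]

theorem pd_succ_D (k : ℕ) (F : DF Ω ℕ) : pd (k + 1) (D F) = D (pd (k + 1) F) + pd k F := by
  rw [D, pd_vf]
  congr 1
  have : (fun d => pd (k + 1) (coord (d + 1) : DF Ω ℕ)) = Pi.single k 1 :=
    funext fun d => by simp [pd_coord, Pi.single_apply]
  rw [this, vf_single, one_mul]

/-- `F` does not involve `u_b` for `b > r`. -/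
def OrderLE (r : ℕ) (F : DF Ω ℕ) : Prop := ∀ k, r < k → pd k F = 0

theorem exists_orderLE (F : DF Ω ℕ) : ∃ r, OrderLE r F := by
  obtain ⟨s, -, -, hs⟩ := exists_finset F
  refine ⟨s.sup id, fun k hk => hs k fun h => ?_⟩
  have := Finset.le_sup (f := id) h
  simp only [id] at this
  omega

theorem OrderLE.vf_eq {r : ℕ} {F : DF Ω ℕ} (h : OrderLE r F) (e : ℝ × ℝ) (A : ℕ → DF Ω ℕ) :
    vf e A F = vf e 0 F + ∑ d ∈ Finset.range (r + 1), A d * pd d F :=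
  vf_eq_sum (fun c hc => h c (by simpa using hc)) e A

theorem OrderLE.pd_evo {r : ℕ} {F : DF Ω ℕ} (h : OrderLE r F) (K : DF Ω ℕ) (k : ℕ) :
    pd k (evo K F) = evo K (pd k F) + ∑ d ∈ Finset.range (r + 1), pd k (D^[d] K) * pd d F := by
  rw [evo, pd_vf, h.vf_eq 0, vf_zero_zero, zero_add]

/-- The right-hand side of an evolution equation `u_t = -φ u_xx + κ(t, x, u, u_x)`, where the function `φ` of
`t` and `x` has no zeros. -/
structure Quasilinear (φ K : DF Ω ℕ) : Prop where
  pd_coeff : ∀ k, pd k φ = 0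
  ne_zero : ∀ j, φ j ≠ 0
  orderLE : OrderLE 2 K
  pd_two : pd 2 K = -φ

namespace Quasilinear

variable {φ K : DF Ω ℕ}

theorem mul_eq_zero (h : Quasilinear φ K) {F : DF Ω ℕ} (hF : φ * F = 0) : F = 0 := by
  ext j
  have : φ j * F j = 0 := congrArg (fun H : DF Ω ℕ => H j) hF
  exact (_root_.mul_eq_zero.1 this).resolve_left (h.ne_zero j)

theorem _root_.GenBurgers.DF.eq_zero_of_add_self {ι : Type} {F : DF Ω ι} (h : F + F = 0) : F = 0 := by
  ext j
  have : F j + F j = 0 := congrArg (fun H : DF Ω ι => H j) h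
  rw [zero_apply]
  linarith

theorem pd_D_coeff (h : Quasilinear φ K) (k : ℕ) : pd k (D φ) = 0 := by
  rcases k with - | k
  · rw [pd_zero_D, h.pd_coeff, map_zero]
  · rw [pd_succ_D, h.pd_coeff, h.pd_coeff, map_zero, add_zero]

theorem orderLE_iterate (h : Quasilinear φ K) (d : ℕ) : OrderLE (d + 2) (D^[d] K) := by
  induction d with
  | zero => exact h.orderLE
  | succ d ih =>
    intro k hk
    obtain ⟨k, rfl⟩ : ∃ l, k = l + 1 := ⟨k - 1, by omega⟩
    rw [Function.iterate_succ_apply', pd_succ_D, ih _ (by omega), ih _ (by omega), map_zero, add_zero]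

theorem pd_iterate (h : Quasilinear φ K) (d : ℕ) : pd (d + 2) (D^[d] K) = -φ := by
  induction d with
  | zero => exact h.pd_two
  | succ d ih =>
    rw [Function.iterate_succ_apply', pd_succ_D, ih, h.orderLE_iterate _ _ (by omega), map_zero, zero_add]

theorem pd_succ_iterate (h : Quasilinear φ K) (d : ℕ) :
    pd (d + 1) (D^[d] K) = pd 1 K - (d : ℝ) • D φ := by
  induction d with
  | zero => simp
  | succ d ih =>
    rw [Function.iterate_succ_apply', pd_succ_D, ih, h.pd_iterate, map_neg]
    push_cast
    rw [add_smul, one_smul]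
    abel

/-- The second derivatives of `D^[d] K` that are relevant for densities of positive order vanish. -/
theorem pd_pd_iterate (h : Quasilinear φ K) {r d : ℕ} (hr : 1 ≤ r) (hd : d ≤ r) :
    pd (r + 1) (pd (r + 1) (D^[d] K)) = 0 := by
  rcases Nat.lt_or_ge (d + 1) r with h1 | h1
  · rw [h.orderLE_iterate d _ (by omega), map_zero]
  rcases Nat.lt_or_ge d r with h2 | h2
  · obtain rfl : r = d + 1 := by omega
    rw [h.pd_iterate, map_neg, h.pd_coeff, neg_zero]
  · obtain rfl : r = d := by omega
    rw [h.pd_succ_iterate, map_sub, Derivation.map_smul, h.pd_D_coeff, smul_zero, sub_zero, pd_comm]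
    obtain ⟨r, rfl⟩ : ∃ l, r = l + 1 := ⟨r - 1, by omega⟩
    rcases r with - | r
    · rw [h.pd_two, map_neg, h.pd_coeff, neg_zero]
    · rw [h.orderLE _ (by omega), map_zero]

section conserved

variable {ρ σ : DF Ω ℕ} {r : ℕ}

theorem orderLE_evo (h : Quasilinear φ K) (hρ : OrderLE r ρ) : OrderLE (r + 2) (evo K ρ) := by
  intro k hk
  rw [hρ.pd_evo, hρ k (by omega), map_zero, zero_add]
  refine Finset.sum_eq_zero fun d hd => ?_
  rw [h.orderLE_iterate d k (by simp at hd; omega), zero_mul]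

/-- The order of the flux exceeds that of the density by at most one: above this order, the equation gives
`∂σ/∂u_k = -D_x ∂σ/∂u_{k+1}`, and `σ` has finite order. -/
theorem orderLE_flux (h : Quasilinear φ K) (hρ : OrderLE r ρ) (hc : evo K ρ + D σ = 0) :
    OrderLE (r + 1) σ := by
  obtain ⟨N, hN⟩ := exists_orderLE σ
  have step : ∀ k, r + 1 < k → pd k σ = -D (pd (k + 1) σ) := by
    intro k hk
    have h1 := congrArg (pd (k + 1)) hc
    rw [map_add, h.orderLE_evo hρ _ (by omega), pd_succ_D, zero_add, map_zero] at h1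
    exact eq_neg_of_add_eq_zero_right h1
  have : ∀ n k, r + 1 < k → N < k + n → pd k σ = 0 := by
    intro n
    induction n with
    | zero => intro k _ h2; exact hN k (by omega)
    | succ n ih => intro k h1 h2; rw [step k h1, ih (k + 1) (by omega) (by omega), map_zero, neg_zero]
  exact fun k hk => this (N + 1) k hk (by omega)

theorem pd_flux (h : Quasilinear φ K) (hρ : OrderLE r ρ) (hc : evo K ρ + D σ = 0) :
    pd (r + 1) σ = φ * pd r ρ := by
  have h1 := congrArg (pd (r + 2)) hc
  rw [map_add, hρ.pd_evo, hρ _ (by omega), map_zero, zero_add, pd_succ_D,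
    h.orderLE_flux hρ hc _ (by omega), map_zero, zero_add, map_zero, Finset.sum_range_succ,
    h.pd_iterate, Finset.sum_eq_zero fun d hd => ?_] at h1
  · linear_combination h1
  · rw [h.orderLE_iterate d _ (by simp at hd; omega), zero_mul]

/-- The second derivative with respect to `u_{r+1}` of `D_t ρ + D_x σ = 0`. -/
theorem pd_pd_density (h : Quasilinear φ K) (hρ : OrderLE r ρ) (hc : evo K ρ + D σ = 0) :
    (φ * pd r (pd r ρ) + φ * pd r (pd r ρ)) +
      ∑ d ∈ Finset.range (r + 1), pd (r + 1) (pd (r + 1) (D^[d] K)) * pd d ρ = 0 := by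
  have h1 := congrArg (fun F => pd (r + 1) (pd (r + 1) F)) hc
  simp only [map_zero] at h1
  rw [map_add, map_add, hρ.pd_evo, hρ _ (by omega), map_zero, zero_add, map_sum, pd_succ_D, map_add,
    pd_succ_D, pd_comm (r + 1) r, h.pd_flux hρ hc, Derivation.leibniz, Derivation.leibniz, h.pd_coeff,
    h.pd_coeff, pd_comm (r + 1) r, hρ _ (by omega)] at h1
  simp only [smul_eq_mul, map_zero, mul_zero, add_zero, zero_add] at h1
  rw [← h1, add_comm]
  congr 1
  · refine Finset.sum_congr rfl fun d _ => ?_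
    rw [Derivation.leibniz, pd_comm (r + 1) d, hρ (r + 1) (by omega), map_zero, smul_zero, zero_add,
      smul_eq_mul, mul_comm]

/-- A conserved density of positive order is equivalent to a density of lower order: it is linear in the
derivative of highest order, whose coefficient is removed by subtracting a total derivative. -/
theorem exists_lower (h : Quasilinear φ K) (hρ : OrderLE (r + 1) ρ) (hc : evo K ρ + D σ = 0) :
    ∃ H, OrderLE r (ρ - D H) := by
  have h1 : pd (r + 1) (pd (r + 1) ρ) = 0 := by
    have h2 := h.pd_pd_density hρ hc
    rw [Finset.sum_eq_zero fun d hd => by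
      rw [h.pd_pd_iterate (by omega) (by simp at hd; omega), zero_mul], add_zero] at h2
    refine h.mul_eq_zero ?_
    exact eq_zero_of_add_self h2
  obtain ⟨H, hH, hH'⟩ := exists_antideriv r (pd (r + 1) ρ)
  have h2 : ∀ k, r < k → pd k H = 0 := by
    intro k hk
    refine hH' k (by omega) ?_
    rcases eq_or_ne k (r + 1) with rfl | hk'
    · exact h1
    · rw [pd_comm, hρ k (by omega), map_zero]
  refine ⟨H, fun k hk => ?_⟩
  obtain ⟨k, rfl⟩ : ∃ l, k = l + 1 := ⟨k - 1, by omega⟩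
  rw [map_sub, pd_succ_D, h2 _ (by omega), map_zero, zero_add]
  rcases eq_or_ne k r with rfl | hk'
  · rw [hH, sub_self]
  · rw [hρ _ (by omega), h2 _ (by omega), sub_zero]

theorem conserved_sub (K H : DF Ω ℕ) (hc : evo K ρ + D σ = 0) :
    evo K (ρ - D H) + D (σ + evo K H) = 0 := by
  rw [map_sub, map_add, evo_D, ← hc]
  abel

theorem exists_order_zero (h : Quasilinear φ K) (hc : evo K ρ + D σ = 0) :
    ∃ H, OrderLE 0 (ρ - D H) := by
  obtain ⟨r, hr⟩ := exists_orderLE ρ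
  induction r generalizing ρ σ with
  | zero => exact ⟨0, by simpa using hr⟩
  | succ r ih =>
    obtain ⟨H, hH⟩ := h.exists_lower hr hc
    obtain ⟨H', hH'⟩ := ih (conserved_sub K H hc) hH
    exact ⟨H + H', by rwa [map_add, ← sub_sub]⟩

end conserved

end Quasilinear

/-! ### Conservation laws of evolution equations in terms of densities of order zero -/

/-- `ρ` is a conserved density of `u_t = K` of order zero with flux `σ`. -/
structure Conserved (K ρ σ : DF Ω ℕ) : Prop where
  order : OrderLE 0 ρ
  eq_zero : evo K ρ + D σ = 0

theorem Dx_lift (F : DF Ω ℕ) : Dx (lift F) = lift (D F) :=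
  vf_subst (fun b => by rw [vf_coord, subst_coord]) F

/-- For `F` of order zero, `D_t F` equals its restriction to the manifold plus a multiple of `u_t - K`. -/
theorem Dt_lift {F : DF Ω ℕ} (hF : OrderLE 0 F) (K : DF Ω ℕ) :
    Dt (lift F) = lift (evo K F) + lift (pd 0 F) * evoEq K := by
  rw [evo, hF.vf_eq, Finset.sum_range_one, map_add, map_mul, evoEq]
  have h1 : Dt (lift F) = lift (vf (1, 0) 0 F) + coord (0, 1, 0) * lift (pd 0 F) := by
    obtain ⟨s, -, h2, h3⟩ := exists_finset F
    ext j
    rw [Dt, vf_apply, dir_subst, h2]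
    have h4 : ∑ c ∈ s, j.2 (0, 1, c) * pd c F (substPoint (fun b => coord (0, 0, b)) j) =
        j.2 (0, 1, 0) * pd 0 F (substPoint (fun b => coord (0, 0, b)) j) := by
      refine Finset.sum_eq_single 0 (fun b _ hb => ?_) fun h0 => ?_
      · rw [hF b (Nat.pos_of_ne_zero hb), zero_apply, mul_zero]
      · rw [h3 0 h0, zero_apply, mul_zero]
    simp only [dir_coord]
    rw [add_apply, mul_apply, coord_apply]
    exact congrArg₂ (· + ·) rfl h4
  rw [h1]
  simp only [Function.iterate_zero, id]
  ring

theorem Conserved.div_lift {K ρ σ : DF Ω ℕ} (h : Conserved K ρ σ) :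
    Dt (lift ρ) + Dx (lift σ) = lift (pd 0 ρ) * evoEq K := by
  rw [Dt_lift h.order K, Dx_lift, add_right_comm, ← map_add, h.eq_zero, map_zero, zero_add]

section laws

variable {K ρ σ ρ' σ' : DF Ω ℕ} {E : Fin 1 → Jet 1 → ℝ}

/-- The conserved vector with density `ρ` and flux `σ`. -/
def Conserved.vector (h : Conserved K ρ σ) (hE : ∀ k, Restricts (E k) (evoEq K)) :
    conservedVectors Ω E :=
  ⟨(extend (lift ρ).1, extend (lift σ).1),
    (mem_conservedVectors hE (restricts_extend _) (restricts_extend _)).2 fun j hj => by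
      rw [h.div_lift, mul_apply, show evoEq K j = 0 from hj 0 0 0, mul_zero]⟩

/-- The conservation law with density `ρ` and flux `σ`. -/
def Conserved.law (h : Conserved K ρ σ) (hE : ∀ k, Restricts (E k) (evoEq K)) :
    ConservationLaws Ω E := conservationLaw (h.vector hE)

theorem mem_trivialVectors_iff_onShell (hE : ∀ k, Restricts (E k) (evoEq K))
    {F : (Jet 1 → ℝ) × (Jet 1 → ℝ)} {R S : DF Ω (Fin 1 × ℕ × ℕ)} (hR : Restricts F.1 R)
    (hS : Restricts F.2 S) : F ∈ trivialVectors Ω E ↔ ∃ G H : DF Ω (Fin 1 × ℕ × ℕ),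
      Dt G + Dx H = 0 ∧ onShell K R = onShell K G ∧ onShell K S = onShell K H := by
  rw [mem_trivialVectors hE hR hS]
  simp only [← forall_manifold, forall_and]

theorem Restricts.sub {n : ℕ} {F G : Jet n → ℝ} {A B : DF Ω (Fin n × ℕ × ℕ)} (hF : Restricts F A)
    (hG : Restricts G B) : Restricts (F - G) (A - B) := fun j hj => by
  rw [Pi.sub_apply, hF j hj, hG j hj]; rfl

theorem conservationLaw_eq_iff {n m : ℕ} {E : Fin m → Jet n → ℝ} {F G : conservedVectors Ω E} :
    conservationLaw F = conservationLaw G ↔ F.1 - G.1 ∈ trivialVectors Ω E := by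
  rw [conservationLaw, conservationLaw, Submodule.Quotient.eq]
  rfl

/-- Every conservation law has a density of order zero. -/
theorem Quasilinear.exists_law {φ : DF Ω ℕ} (hK : Quasilinear φ K)
    (hE : ∀ k, Restricts (E k) (evoEq K)) (C : ConservationLaws Ω E) :
    ∃ (ρ σ : DF Ω ℕ) (h : Conserved K ρ σ), C = h.law hE := by
  obtain ⟨F, rfl⟩ := Submodule.Quotient.mk_surjective _ C
  obtain ⟨R, hR⟩ := isDiffFun_iff.1 F.2.1
  obtain ⟨S, hS⟩ := isDiffFun_iff.1 F.2.2.1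
  have hc : evo K (onShell K R) + D (onShell K S) = 0 := by
    rw [← onShell_Dt, ← onShell_Dx, ← map_add, ← map_zero (onShell K), ← forall_manifold]
    exact (mem_conservedVectors hE hR hS).1 F.2
  obtain ⟨H, hH⟩ := hK.exists_order_zero hc
  refine ⟨_, _, ⟨hH, Quasilinear.conserved_sub K H hc⟩, conservationLaw_eq_iff.2 ?_⟩
  -- the difference of the two conserved vectors is the null divergence `(D_x H, -D_t H)` on the manifold
  refine (mem_trivialVectors_iff_onShell hE (hR.sub (restricts_extend _))
    (hS.sub (restricts_extend _))).2 ⟨Dx (lift H), -Dt (lift H), ?_, ?_, ?_⟩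
  · rw [map_neg, Dt_Dx, add_neg_cancel]
  · rw [onShell_Dx, onShell_lift, map_sub, onShell_lift, sub_sub_cancel]
  · rw [map_neg, onShell_Dt, onShell_lift, map_sub, onShell_lift, sub_add_cancel_left]

/-- The only reduced characteristic of a conservation law with density `ρ` of order zero is `∂ρ/∂u`. -/
theorem Conserved.isReducedCharacteristic_iff (h : Conserved K ρ σ)
    (hE : ∀ k, Restricts (E k) (evoEq K)) {μ : Jet 1 → ℝ} :
    IsReducedCharacteristic (h.law hE) μ ↔ Restricts μ (lift (pd 0 ρ) : DF Ω (Fin 1 × ℕ × ℕ)) := by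
  constructor
  · rintro ⟨⟨hμ, F, hF, hdiv⟩, hred⟩
    obtain ⟨M, hM⟩ := isDiffFun_iff.1 hμ
    obtain ⟨R, hR⟩ := isDiffFun_iff.1 F.2.1
    obtain ⟨S, hS⟩ := isDiffFun_iff.1 F.2.2.1
    obtain ⟨G, H, hGH, h1, h2⟩ := (mem_trivialVectors_iff_onShell hE (hR.sub (restricts_extend _))
      (hS.sub (restricts_extend _))).1 (conservationLaw_eq_iff.1 hF)
    have h3 : Dt R + Dx S = M * evoEq K := by
      ext j
      have := hdiv ((j.1 : ℝ × ℝ), j.2) j.1.2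
      rwa [hR.totalDiv hS _ j.1.2, hM _ j.1.2, hE 0 _ j.1.2] at this
    have h4 := onShell_eq_zero_of_div (K := K) (R := R - lift ρ - G) (S := S - lift σ - H)
      (μ := M - lift (pd 0 ρ)) (by rw [map_sub, h1, sub_self]) (by
        rw [map_sub, map_sub, map_sub, map_sub, sub_mul, ← h3, ← h.div_lift]
        linear_combination -hGH)
    rw [map_sub, onShell_lift, sub_eq_zero] at h4
    -- `h4` is an equality on the manifold; a reduced function takes the same value at `j` and at the point of the
    -- manifold with the same `x`-derivatives
    intro j hj
    let p := substPoint (evoCoord K) (⟨j.1, hj⟩, fun b => j.2 (0, 0, b))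
    have h5 := hred j ((p.1 : ℝ × ℝ), p.2) hj rfl fun i b => by rw [Subsingleton.elim i 0]; rfl
    refine h5.trans ((hM ((p.1 : ℝ × ℝ), p.2) hj).trans ?_)
    exact congrArg (fun F : DF Ω ℕ => F (⟨j.1, hj⟩, fun b => j.2 (0, 0, b))) h4
  · intro hμ
    refine ⟨⟨hμ.isDiffFun, h.vector hE, rfl, fun j hj => ?_⟩, fun j j' hj hjj' h0 => ?_⟩
    · rw [Restricts.totalDiv (F := (h.vector hE).1) (restricts_extend _) (restricts_extend _) j hj,
        h.div_lift, hμ j hj, hE 0 j hj]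
      rfl
    · rw [hμ j hj, hμ j' (hjj' ▸ hj)]
      exact congrArg (pd 0 ρ).1 (Prod.ext (Subtype.ext hjj') (funext fun b => h0 0 b))

/-- Conservation laws are equal if and only if their reduced characteristics are. -/
theorem Conserved.law_eq_iff (h : Conserved K ρ σ) (h' : Conserved K ρ' σ')
    (hE : ∀ k, Restricts (E k) (evoEq K)) : h.law hE = h'.law hE ↔ pd 0 ρ = pd 0 ρ' := by
  constructor
  · intro heq
    have h1 := (h.isReducedCharacteristic_iff hE).2 (restricts_extend _)
    rw [heq, h'.isReducedCharacteristic_iff] at h1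
    ext j
    have h2 := h1 ((j.1 : ℝ × ℝ), fun c => j.2 c.2.2) j.1.2
    rw [restricts_extend _ _ j.1.2] at h2
    exact h2
  · intro heq
    refine conservationLaw_eq_iff.2 ((mem_trivialVectors_iff_onShell hE
      ((restricts_extend _).sub (restricts_extend _))
      ((restricts_extend _).sub (restricts_extend _))).2 ⟨_, _, ?_, rfl, rfl⟩)
    rw [map_sub, map_sub, sub_add_sub_comm, h.div_lift, h'.div_lift, heq, sub_self]

theorem Conserved.smul (h : Conserved K ρ σ) (a : ℝ) : Conserved K (a • ρ) (a • σ) :=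
  ⟨fun k hk => by rw [Derivation.map_smul, h.order k hk, smul_zero], by
    rw [Derivation.map_smul, Derivation.map_smul, ← smul_add, h.eq_zero, smul_zero]⟩

theorem Conserved.smul_law (h : Conserved K ρ σ) (hE : ∀ k, Restricts (E k) (evoEq K)) (a : ℝ) :
    a • h.law hE = (h.smul a).law hE := by
  refine (Submodule.Quotient.mk_smul _ a (h.vector hE)).symm.trans (congrArg conservationLaw (Subtype.ext ?_))
  have h1 : ∀ F : DF Ω ℕ, a • extend (lift F).1 = extend (lift (a • F)).1 := by
    intro F
    funext j
    by_cases hj : j.1 ∈ Ω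
    · rw [Pi.smul_apply, extend_of_mem _ hj, extend_of_mem _ hj, map_smul]; rfl
    · rw [Pi.smul_apply, extend, extend, dif_neg hj, dif_neg hj, smul_zero]
  exact Prod.ext (h1 ρ) (h1 σ)

theorem conserved_zero : Conserved K (0 : DF Ω ℕ) 0 := ⟨fun k _ => map_zero _, by simp⟩

theorem Conserved.law_eq_zero_iff (h : Conserved K ρ σ) (hE : ∀ k, Restricts (E k) (evoEq K)) :
    h.law hE = 0 ↔ pd 0 ρ = 0 := by
  have h1 := conserved_zero.smul_law hE (K := K) 0
  rw [zero_smul] at h1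
  rw [h1, law_eq_iff, smul_zero, map_zero]

end laws

end

end DF

/-! ### Functions of `t` and `x` -/

namespace DF

section

variable {Ω : TopologicalSpace.Opens (ℝ × ℝ)} {ι : Type}

/-- The derivative of a function of `t` and `x` along a vector field. -/
theorem hasDerivAt_vf {F : DF Ω ι} {h : ℝ → ℝ → ℝ} (hF : ∀ j, F j = h j.1.1.1 j.1.1.2) (e : ℝ × ℝ)
    (A : ι → DF Ω ι) (j : JetOver Ω ι) :
    HasDerivAt (fun ε => h (j.1.1.1 + ε * e.1) (j.1.1.2 + ε * e.2)) (vf e A F j) 0 := by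
  have h1 := hasDerivAt_dir F j (e, fun c => A c j)
  refine h1.congr_of_eventuallyEq ?_
  filter_upwards [line_mem j (e, fun c => A c j)] with ε hε
  rw [extend_of_mem _ hε, hF]
  simp [line]

theorem hasDerivAt_vf_x {F : DF Ω ι} {h : ℝ → ℝ → ℝ} (hF : ∀ j, F j = h j.1.1.1 j.1.1.2)
    (A : ι → DF Ω ι) (j : JetOver Ω ι) :
    HasDerivAt (fun x => h j.1.1.1 x) (vf (0, 1) A F j) j.1.1.2 := by
  have h1 := hasDerivAt_vf hF (0, 1) A j
  simp only [mul_zero, add_zero, mul_one] at h1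
  simpa using HasDerivAt.comp_sub_const (f := fun ε => h j.1.1.1 (j.1.1.2 + ε)) j.1.1.2 j.1.1.2
    (by simpa using h1)

theorem hasDerivAt_vf_t {F : DF Ω ι} {h : ℝ → ℝ → ℝ} (hF : ∀ j, F j = h j.1.1.1 j.1.1.2)
    (A : ι → DF Ω ι) (j : JetOver Ω ι) :
    HasDerivAt (fun t => h t j.1.1.2) (vf (1, 0) A F j) j.1.1.1 := by
  have h1 := hasDerivAt_vf hF (1, 0) A j
  simp only [mul_zero, add_zero, mul_one] at h1
  simpa using HasDerivAt.comp_sub_const (f := fun ε => h (j.1.1.1 + ε) j.1.1.2) j.1.1.1 j.1.1.1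
    (by simpa using h1)

theorem D_iterate_apply {F : DF Ω ℕ} {h : ℝ → ℝ → ℝ} (hF : ∀ j, F j = h j.1.1.1 j.1.1.2) (n : ℕ)
    (j : JetOver Ω ℕ) : (D^[n] F : DF Ω ℕ) j = iteratedDeriv n (fun y => h j.1.1.1 y) j.1.1.2 := by
  induction n generalizing j with
  | zero => exact hF j
  | succ n ih =>
    rw [Function.iterate_succ_apply', iteratedDeriv_succ]
    exact (hasDerivAt_vf_x (h := fun t x => iteratedDeriv n (fun y => h t y) x) ih _ j).deriv.symm

theorem vf_base_congr (g : ℝ × ℝ → ℝ) (hg : ContDiffOn ℝ ∞ g Ω) (e : ℝ × ℝ) (A B : ι → DF Ω ι) :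
    vf e A (base g hg) = vf e B (base g hg) :=
  ext fun j => by rw [vf_apply, vf_apply, dir_base, dir_base]

/-- A function of `t` and `x` with vanishing derivatives is constant. -/
theorem exists_eq_algebraMap (hΩ : IsPreconnected (Ω : Set (ℝ × ℝ))) {F : DF Ω ι} [DecidableEq ι]
    (h : ∀ c, pd c F = 0) {A B : ι → DF Ω ι} (ht : vf (1, 0) A F = 0) (hx : vf (0, 1) B F = 0) :
    ∃ a : ℝ, F = algebraMap ℝ (DF Ω ι) a := by
  obtain ⟨g, hg, rfl⟩ := exists_eq_base h
  have h1 : (Ω : Set (ℝ × ℝ)).EqOn (fderiv ℝ g) 0 := by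
    intro p hp
    have h2 := congrArg (fun H : DF Ω ι => H (⟨p, hp⟩, 0)) ht
    have h3 := congrArg (fun H : DF Ω ι => H (⟨p, hp⟩, 0)) hx
    simp only [vf_apply, dir_base, zero_apply] at h2 h3
    ext
    · simpa using h2
    · simpa using h3
  obtain ⟨a, ha⟩ := Ω.isOpen.exists_is_const_of_fderiv_eq_zero hΩ (hg.differentiableOn (by simp)) h1
  exact ⟨a, ext fun j => ha _ j.1.2⟩

end

end DF

/-- A continuous function on an open interval has an antiderivative. -/
theorem exists_antideriv_of_continuousOn {I : Set ℝ} (hI : IsOpen I) (hIc : I.OrdConnected) {c : ℝ → ℝ}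
    (hc : ContinuousOn c I) : ∃ A : ℝ → ℝ, ∀ t ∈ I, HasDerivAt A (c t) t := by
  rcases I.eq_empty_or_nonempty with rfl | ⟨t₀, ht₀⟩
  · exact ⟨0, fun t ht => ht.elim⟩
  · refine ⟨fun t => ∫ s in t₀..t, c s, fun t ht => ?_⟩
    exact intervalIntegral.integral_hasDerivAt_right
      ((hc.mono (hIc.uIcc_subset ht₀ ht)).intervalIntegrable)
      (hc.stronglyMeasurableAtFilter hI t ht) (hc.continuousAt (hI.mem_nhds ht))

/-- Two solutions of a scalar linear equation `G' = c G` on an interval are proportional. -/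
theorem eq_const_mul_of_linear_ode {I : Set ℝ} (hI : IsOpen I) (hIc : I.OrdConnected) {c G L : ℝ → ℝ}
    (hG : ∀ t ∈ I, HasDerivAt G (c t * G t) t) (hL : ∀ t ∈ I, HasDerivAt L (c t * L t) t)
    (hL0 : ∀ t ∈ I, L t ≠ 0) : ∃ a : ℝ, ∀ t ∈ I, G t = a * L t := by
  have h1 : ∀ t ∈ I, HasDerivAt (fun t => G t / L t) 0 t := by
    intro t ht
    refine ((hG t ht).div (hL t ht) (hL0 t ht)).congr_deriv ?_
    rw [div_eq_zero_iff]
    exact Or.inl (by ring)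
  obtain ⟨a, ha⟩ := hI.exists_is_const_of_deriv_eq_zero hIc.isPreconnected
    (fun t ht => (h1 t ht).differentiableAt.differentiableWithinAt) fun t ht => (h1 t ht).deriv
  refine ⟨a, fun t ht => ?_⟩
  rw [← ha t ht, div_mul_cancel₀ _ (hL0 t ht)]

/-- Differentiable solutions of a scalar linear equation with smooth coefficient are smooth, by bootstrapping. -/
theorem contDiffOn_of_linear_ode {I : Set ℝ} (hI : IsOpen I) {c L : ℝ → ℝ} (hc : ContDiffOn ℝ ∞ c I)
    (hL : ∀ t ∈ I, HasDerivAt L (c t * L t) t) : ContDiffOn ℝ ∞ L I := by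
  have hd : DifferentiableOn ℝ L I := fun t ht => (hL t ht).differentiableAt.differentiableWithinAt
  rw [contDiffOn_infty]
  intro n
  induction n with
  | zero => exact contDiffOn_zero.2 hd.continuousOn
  | succ n ih =>
    have := (contDiffOn_succ_iff_deriv_of_isOpen (n := n) hI (f := L) (𝕜 := ℝ)).2
      ⟨hd, fun h => absurd h (by simp), ((hc.of_le (by exact_mod_cast le_top)).mul ih).congr
        fun t ht => (hL t ht).deriv⟩
    exact_mod_cast this

/-! ### Conservation laws of the generalized Burgers equation -/

namespace DF

section

variable {Ω : TopologicalSpace.Opens (ℝ × ℝ)}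

/-- The right-hand side of `u_t = -(u u_x + φ u_xx)`. -/
def burgersRhs (φ : DF Ω ℕ) : DF Ω ℕ := -(coord 0 * coord 1 + φ * coord 2)

theorem quasilinear_burgersRhs {φ : DF Ω ℕ} (h : ∀ k, pd k φ = 0) (h0 : ∀ j, φ j ≠ 0) :
    Quasilinear φ (burgersRhs φ) where
  pd_coeff := h
  ne_zero := h0
  orderLE k hk := by
    simp [burgersRhs, pd_coord, h, show (0 : ℕ) ≠ k by omega, show 1 ≠ k by omega,
      show 2 ≠ k by omega]
  pd_two := by simp [burgersRhs, pd_coord, h]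

/-- The characteristics of conservation laws of the generalized Burgers equation that correspond to densities of
order zero: the functions `γ` of `t` with `γ_t = φ_xx γ`. Here `D` and `evo` reduce to `∂/∂x` and `∂/∂t`. -/
structure BurgersChar (φ γ : DF Ω ℕ) : Prop where
  pd_eq : ∀ k, pd k γ = 0
  D_eq : D γ = 0
  evo_eq : evo (burgersRhs φ) γ = D (D φ) * γ

/-- The derivatives of `D_t ρ + D_x σ = 0` with respect to `u_x` twice, to `u_x`, and to `u` give, in turn,
`γ_u = 0` for `γ = ∂ρ/∂u`, the dependence of `σ` on `u`, and an equation that is affine in `u`. -/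
theorem burgersChar_of_conserved {φ ρ σ : DF Ω ℕ} (hφ : ∀ k, pd k φ = 0) (hφ0 : ∀ j, φ j ≠ 0)
    (h : Conserved (burgersRhs φ) ρ σ) : BurgersChar φ (pd 0 ρ) := by
  have hK := quasilinear_burgersRhs hφ hφ0
  have hK1 : pd 1 (burgersRhs φ) = -coord 0 := by simp [burgersRhs, pd_coord, hφ]
  have hK0 : pd 0 (burgersRhs φ) = -coord 1 := by simp [burgersRhs, pd_coord, hφ]
  have hρ := h.order
  have h00 : pd 0 (pd 0 ρ) = 0 := by
    have h1 := hK.pd_pd_density hρ h.eq_zero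
    simp only [zero_add, Finset.sum_range_one, Function.iterate_zero, id, hK1, map_neg,
      pd_coord_of_ne (zero_ne_one : (0 : ℕ) ≠ 1), neg_zero, zero_mul, add_zero] at h1
    exact hK.mul_eq_zero (eq_zero_of_add_self h1)
  have hpd : ∀ k, pd k (pd 0 ρ) = 0 := by
    intro k
    rcases Nat.eq_zero_or_pos k with rfl | hk
    · exact h00
    · rw [pd_comm, hρ k hk, map_zero]
  have hσ1 : pd 1 σ = φ * pd 0 ρ := hK.pd_flux hρ h.eq_zero
  have e1 := congrArg (pd 1) h.eq_zero
  rw [map_add, hρ.pd_evo, hρ 1 one_pos, map_zero, zero_add, pd_succ_D, zero_add, Finset.sum_range_one,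
    Function.iterate_zero, id, hK1, hσ1, map_zero] at e1
  have e0 := congrArg (pd 0) h.eq_zero
  rw [map_add, hρ.pd_evo, pd_zero_D, zero_add, Finset.sum_range_one, Function.iterate_zero, id, hK0,
    map_zero, show pd 0 σ = coord 0 * pd 0 ρ - D (φ * pd 0 ρ) by linear_combination e1] at e0
  generalize pd 0 ρ = γ at *
  have hDγ : ∀ k, pd k (D γ) = 0 := by
    intro k
    rcases k with - | k
    · rw [pd_zero_D, hpd, map_zero]
    · rw [pd_succ_D, hpd, hpd, map_zero, add_zero]
  simp only [map_sub, Derivation.leibniz, smul_eq_mul, D_coord, zero_add, map_add] at e0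
  -- the coefficient of `u` in the remaining equation
  have e00 := congrArg (pd 0) e0
  have hDφ := hK.pd_D_coeff
  have hDDφ : pd 0 (D (D φ)) = 0 := by rw [pd_zero_D, hDφ, map_zero]
  have hDDγ : pd 0 (D (D γ)) = 0 := by rw [pd_zero_D, hDγ, map_zero]
  have hevo : pd 0 (evo (burgersRhs φ) γ) = 0 := by
    rw [OrderLE.pd_evo (r := 0) (fun k _ => hpd k), hpd]
    simp [hpd]
  simp only [map_add, map_sub, map_neg, Derivation.leibniz, smul_eq_mul, hevo, hDφ, hDDφ, hDDγ, hpd,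
    hDγ, hφ, pd_coord_self, pd_coord_of_ne (one_ne_zero : (1 : ℕ) ≠ 0), map_zero] at e00
  have hD : D γ = 0 := by linear_combination e00
  refine ⟨hpd, hD, ?_⟩
  rw [hD] at e0
  simp only [map_zero, mul_zero, add_zero] at e0
  linear_combination e0

/-- The conserved vector `(γ u, γ (φ u_x + u² / 2 - φ_x u))`. -/
theorem BurgersChar.conserved {φ γ : DF Ω ℕ} (h : BurgersChar φ γ) :
    Conserved (burgersRhs φ) (γ * coord 0) (φ * γ * coord 1 +
      algebraMap ℝ _ (1 / 2) * γ * coord 0 ^ 2 - D φ * γ * coord 0) where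
  order k hk := by
    simp [h.pd_eq, pd_coord, show (0 : ℕ) ≠ k by omega]
  eq_zero := by
    have h2 : (algebraMap ℝ (DF Ω ℕ) (1 / 2)) * 2 = 1 := by
      rw [← map_ofNat (algebraMap ℝ (DF Ω ℕ)) 2, ← map_mul]
      norm_num
    simp only [map_add, map_sub, Derivation.leibniz, smul_eq_mul, D_coord, h.D_eq, h.evo_eq, evo_coord,
      Function.iterate_zero, id, Derivation.map_algebraMap, Derivation.leibniz_pow]
    simp only [burgersRhs, nsmul_eq_mul, Nat.cast_ofNat, zero_add, Nat.add_one_sub_one, pow_one]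
    linear_combination γ * coord 0 * coord 1 * h2

theorem BurgersChar.pd_density {φ γ : DF Ω ℕ} (h : BurgersChar φ γ) : pd 0 (γ * coord 0) = γ := by
  simp [h.pd_eq]

end

end DF

namespace DF

section

variable {I J : TopologicalSpace.Opens ℝ} {f : ℝ → ℝ → ℝ}

theorem isPreconnected_box (hIc : (I : Set ℝ).OrdConnected) (hJc : (J : Set ℝ).OrdConnected) :
    IsPreconnected (box I J : Set (ℝ × ℝ)) := hIc.isPreconnected.prod hJc.isPreconnected

/-- The coefficient `f` as a differential function. -/
def coeff {ι : Type} (hf : ContDiffOn ℝ ∞ (Function.uncurry f) ((I : Set ℝ) ×ˢ (J : Set ℝ))) :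
    DF (box I J) ι := base (Function.uncurry f) hf

/-- A smooth function of `t` as a differential function. -/
def timeFun {ι : Type} {L : ℝ → ℝ} (hL : ContDiffOn ℝ ∞ L I) : DF (box I J) ι :=
  base (fun p => L p.1) (hL.comp contDiff_fst.contDiffOn fun _ hp => hp.1)

@[simp] theorem timeFun_apply {ι : Type} {L : ℝ → ℝ} (hL : ContDiffOn ℝ ∞ L I)
    (j : JetOver (box I J) ι) : timeFun hL j = L j.1.1.1 := rfl

@[simp] theorem coeff_apply {ι : Type}
    (hf : ContDiffOn ℝ ∞ (Function.uncurry f) ((I : Set ℝ) ×ˢ (J : Set ℝ)))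
    (j : JetOver (box I J) ι) : coeff hf j = f j.1.1.1 j.1.1.2 := rfl

theorem pd_coeff
    (hf : ContDiffOn ℝ ∞ (Function.uncurry f) ((I : Set ℝ) ×ˢ (J : Set ℝ)))
    (k : ℕ) : pd k (coeff hf) = 0 := pd_base _ _ _

theorem coeff_ne_zero
    (hf : ContDiffOn ℝ ∞ (Function.uncurry f) ((I : Set ℝ) ×ˢ (J : Set ℝ)))
    (hf0 : ∀ t ∈ I, ∀ x ∈ J, f t x ≠ 0) (j : JetOver (box I J) ℕ) :
    coeff hf j ≠ 0 := hf0 _ j.1.2.1 _ j.1.2.2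

theorem D_coeff_apply
    (hf : ContDiffOn ℝ ∞ (Function.uncurry f) ((I : Set ℝ) ×ˢ (J : Set ℝ)))
    (j : JetOver (box I J) ℕ) : D (coeff hf) j = fx f j.1.1.1 j.1.1.2 :=
  (hasDerivAt_vf_x (F := coeff hf) (fun _ => rfl) _ j).deriv.symm

theorem D_D_coeff_apply
    (hf : ContDiffOn ℝ ∞ (Function.uncurry f) ((I : Set ℝ) ×ˢ (J : Set ℝ)))
    (j : JetOver (box I J) ℕ) : D (D (coeff hf)) j = fxx f j.1.1.1 j.1.1.2 :=
  D_iterate_apply (F := coeff hf) (fun _ => rfl) 2 j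

theorem D_D_D_coeff_apply
    (hf : ContDiffOn ℝ ∞ (Function.uncurry f) ((I : Set ℝ) ×ˢ (J : Set ℝ)))
    (j : JetOver (box I J) ℕ) :
    D (D (D (coeff hf))) j = fxxx f j.1.1.1 j.1.1.2 :=
  D_iterate_apply (F := coeff hf) (fun _ => rfl) 3 j

theorem contDiffOn_fxx
    (hf : ContDiffOn ℝ ∞ (Function.uncurry f) ((I : Set ℝ) ×ˢ (J : Set ℝ))) :
    ContDiffOn ℝ ∞ (Function.uncurry (fxx f)) ((I : Set ℝ) ×ˢ (J : Set ℝ)) := by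
  have hpd : ∀ (F : DF (box I J) ℕ), (∀ k, pd k F = 0) → ∀ k, pd k (D F) = 0 := by
    intro F hF k
    rcases k with - | k
    · rw [pd_zero_D, hF, map_zero]
    · rw [pd_succ_D, hF, hF, map_zero, add_zero]
  obtain ⟨g, hg, h⟩ := exists_eq_base (hpd _ (hpd _ (pd_coeff hf)))
  refine ContDiffOn.congr hg fun p hp => ?_
  have h1 := D_D_coeff_apply hf (⟨p, hp⟩, 0)
  rw [h] at h1
  exact h1.symm

theorem contDiffOn_fxx_left
    (hf : ContDiffOn ℝ ∞ (Function.uncurry f) ((I : Set ℝ) ×ˢ (J : Set ℝ)))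
    {x : ℝ} (hx : x ∈ J) : ContDiffOn ℝ ∞ (fun t => fxx f t x) I :=
  (contDiffOn_fxx hf).comp (f := fun t => (t, x)) (ContDiff.contDiffOn (by fun_prop))
    fun _ ht => ⟨ht, hx⟩

theorem restricts_burgers
    (hf : ContDiffOn ℝ ∞ (Function.uncurry f) ((I : Set ℝ) ×ˢ (J : Set ℝ)))
    (k : Fin 1) : Restricts (burgers f k) (evoEq (burgersRhs (coeff hf))) := by
  intro j hj
  simp only [burgers, evoEq, burgersRhs, map_neg, map_add, map_mul, subst_coord, sub_apply, neg_apply,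
    add_apply, mul_apply, coord_apply]
  change _ = _ - -(_ + f j.1.1 j.1.2 * _)
  ring

/-- The multiplier `λ` with `λ_t = f_xx λ` is smooth. -/
theorem contDiffOn_of_multiplier
    (hf : ContDiffOn ℝ ∞ (Function.uncurry f) ((I : Set ℝ) ×ˢ (J : Set ℝ)))
    (hJ : (J : Set ℝ).Nonempty) {L : ℝ → ℝ}
    (hL : ∀ t ∈ I, ∀ x ∈ J, HasDerivAt L (fxx f t x * L t) t) : ContDiffOn ℝ ∞ L I := by
  obtain ⟨x, hx⟩ := hJ
  exact contDiffOn_of_linear_ode I.isOpen (contDiffOn_fxx_left hf hx) fun t ht => hL t ht x hx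

theorem burgersChar_timeFun
    (hf : ContDiffOn ℝ ∞ (Function.uncurry f) ((I : Set ℝ) ×ˢ (J : Set ℝ)))
    {L : ℝ → ℝ} (hLs : ContDiffOn ℝ ∞ L I)
    (hL : ∀ t ∈ I, ∀ x ∈ J, HasDerivAt L (fxx f t x * L t) t) :
    BurgersChar (coeff hf) (timeFun hLs : DF (box I J) ℕ) where
  pd_eq k := pd_base _ _ _
  D_eq := ext fun j =>
    (hasDerivAt_vf_x (F := timeFun hLs) (h := fun t _ => L t) (fun _ => rfl) _ j).unique
      (hasDerivAt_const _ _)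
  evo_eq := ext fun j => by
    rw [mul_apply, D_D_coeff_apply]
    exact (hasDerivAt_vf_t (F := timeFun hLs) (h := fun t _ => L t) (fun _ => rfl) _ j).unique
      (hL _ j.1.2.1 _ j.1.2.2)

/-- A nonzero conservation law of the generalized Burgers equation has a characteristic without zeros, so
that `f_xxx` vanishes. -/
theorem fxxx_eq_zero_of_nontrivial
    (hf : ContDiffOn ℝ ∞ (Function.uncurry f) ((I : Set ℝ) ×ˢ (J : Set ℝ)))
    (hIc : (I : Set ℝ).OrdConnected) (hJc : (J : Set ℝ).OrdConnected)
    (hf0 : ∀ t ∈ I, ∀ x ∈ J, f t x ≠ 0) (h : Nontrivial (ConservationLaws (box I J) (burgers f))) :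
    ∀ t ∈ I, ∀ x ∈ J, fxxx f t x = 0 := by
  intro t ht x hx
  obtain ⟨C, hC⟩ := exists_ne (0 : ConservationLaws (box I J) (burgers f))
  have hφ := pd_coeff hf
  have hφ0 := coeff_ne_zero hf hf0
  obtain ⟨ρ, σ, hρσ, rfl⟩ := (quasilinear_burgersRhs hφ hφ0).exists_law (restricts_burgers hf) C
  rw [Ne, hρσ.law_eq_zero_iff] at hC
  have hγ := burgersChar_of_conserved hφ hφ0 hρσ
  generalize pd 0 ρ = γ at hC hγ
  obtain ⟨g, hg, rfl⟩ := exists_eq_base hγ.pd_eq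
  have h1 : D (D (D (coeff hf))) * base g hg = 0 := by
    have h2 := congrArg D hγ.evo_eq
    rw [← evo_D, hγ.D_eq, map_zero, Derivation.leibniz, hγ.D_eq, smul_zero, zero_add, smul_eq_mul] at h2
    rw [mul_comm, ← h2]
  have h2 : fxxx f t x * g (t, x) = 0 := by
    have h3 := congrArg (fun H : DF (box I J) ℕ => H (⟨(t, x), ht, hx⟩, 0)) h1
    simp only [mul_apply, D_D_D_coeff_apply] at h3
    exact h3
  refine (mul_eq_zero.1 h2).resolve_right fun h0 => hC ?_
  -- `g` solves a linear equation with respect to `t`, so that it vanishes together with `g (t, x)`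
  obtain ⟨A, hA⟩ := exists_antideriv_of_continuousOn I.isOpen hIc (contDiffOn_fxx_left hf hx).continuousOn
  obtain ⟨a, ha⟩ := eq_const_mul_of_linear_ode (G := fun s => g (s, x)) (L := fun s => Real.exp (A s))
    (c := fun s => fxx f s x) I.isOpen hIc (fun s hs => by
      have h3 := hasDerivAt_vf_t (F := base g hg) (h := fun t x => g (t, x)) (fun _ => rfl)
        (fun b => D^[b] (burgersRhs (coeff hf))) (⟨(s, x), hs, hx⟩, 0)
      have h4 := congrArg (fun H : DF (box I J) ℕ => H (⟨(s, x), hs, hx⟩, 0)) hγ.evo_eq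
      simp only [mul_apply, D_D_coeff_apply, base_apply] at h4
      rw [evo] at h4
      rwa [h4] at h3) (fun s hs => by
      simpa [mul_comm] using (hA s hs).exp) fun s _ => (Real.exp_pos _).ne'
  have ha0 : a = 0 := by
    have := ha t ht
    rw [h0] at this
    exact (mul_eq_zero.1 this.symm).resolve_right (Real.exp_pos _).ne'
  ext j
  have h5 : ∀ y ∈ J, HasDerivAt (fun y => g (j.1.1.1, y)) 0 y := by
    intro y hy
    have h3 := hasDerivAt_vf_x (F := base g hg) (h := fun t x => g (t, x)) (fun _ => rfl)
      (fun b => coord (b + 1)) (⟨(j.1.1.1, y), j.1.2.1, hy⟩, (0 : ℕ → ℝ))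
    have h4 := congrArg (fun H : DF (box I J) ℕ => H (⟨(j.1.1.1, y), j.1.2.1, hy⟩, 0)) hγ.D_eq
    simp only [zero_apply] at h4
    rw [D] at h4
    rwa [h4] at h3
  have h6 := J.isOpen.is_const_of_deriv_eq_zero hJc.isPreconnected
    (fun y hy => (h5 y hy).differentiableAt.differentiableWithinAt) (fun y hy => (h5 y hy).deriv)
    j.1.2.2 hx
  have h7 := ha _ j.1.2.1
  rw [ha0, zero_mul] at h7
  exact h6.trans h7

/-- If `f_xxx` vanishes, then `f_xx` is independent of `x` and has an antiderivative with respect to `t`. -/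
theorem exists_antideriv_fxx
    (hf : ContDiffOn ℝ ∞ (Function.uncurry f) ((I : Set ℝ) ×ˢ (J : Set ℝ)))
    (hIc : (I : Set ℝ).OrdConnected) (hJc : (J : Set ℝ).OrdConnected)
    (hJ : (J : Set ℝ).Nonempty) (h3 : ∀ t ∈ I, ∀ x ∈ J, fxxx f t x = 0) :
    ∃ A : ℝ → ℝ, ∀ t ∈ I, ∀ x ∈ J, HasDerivAt A (fxx f t x) t := by
  obtain ⟨x₀, hx₀⟩ := hJ
  obtain ⟨A, hA⟩ := exists_antideriv_of_continuousOn I.isOpen hIc (contDiffOn_fxx_left hf hx₀).continuousOn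
  refine ⟨A, fun t ht x hx => ?_⟩
  have h5 : ∀ y ∈ J, HasDerivAt (fun y => fxx f t y) 0 y := by
    intro y hy
    have h6 : HasDerivAt (fun y => fxx f t y)
        (D (D (D (coeff hf))) (⟨(t, y), ht, hy⟩, (0 : ℕ → ℝ))) y :=
      hasDerivAt_vf_x (D_D_coeff_apply hf) _ (⟨(t, y), ht, hy⟩, (0 : ℕ → ℝ))
    rw [D_D_D_coeff_apply] at h6
    exact h6.congr_deriv (h3 t ht y hy)
  have h6 := J.isOpen.is_const_of_deriv_eq_zero hJc.isPreconnected
    (fun y hy => (h5 y hy).differentiableAt.differentiableWithinAt) (fun y hy => (h5 y hy).deriv)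
    hx hx₀
  exact (hA t ht).congr_deriv h6.symm

/-- The conservation law with characteristic `e^A` and its multiples. -/
theorem exists_burgers_law
    (hf : ContDiffOn ℝ ∞ (Function.uncurry f) ((I : Set ℝ) ×ˢ (J : Set ℝ)))
    (hIc : (I : Set ℝ).OrdConnected) (hJc : (J : Set ℝ).OrdConnected)
    (hI : (I : Set ℝ).Nonempty) (hJ : (J : Set ℝ).Nonempty) (hf0 : ∀ t ∈ I, ∀ x ∈ J, f t x ≠ 0)
    {A : ℝ → ℝ} (hA : ∀ t ∈ I, ∀ x ∈ J, HasDerivAt A (fxx f t x) t) :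
    ∃ C : ConservationLaws (box I J) (burgers f), C ≠ 0 ∧ (∀ C', ∃ a : ℝ, a • C = C') ∧
      ∀ (a : ℝ) (μ : Jet 1 → ℝ), IsReducedCharacteristic (a • C) μ ↔
        ∀ j : Jet 1, j.1 ∈ box I J → μ j = a * Real.exp (A j.1.1) := by
  have hL : ∀ t ∈ I, ∀ x ∈ J, HasDerivAt (fun t => Real.exp (A t)) (fxx f t x * Real.exp (A t)) t :=
    fun t ht x hx => by simpa [mul_comm] using (hA t ht x hx).exp
  have hLs := contDiffOn_of_multiplier hf hJ hL
  have hφ := pd_coeff hf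
  have hφ0 := coeff_ne_zero hf hf0
  have hE := restricts_burgers hf
  have hb := burgersChar_timeFun hf hLs hL
  refine ⟨hb.conserved.law hE, ?_, fun C' => ?_, fun a μ => ?_⟩
  · rw [Ne, hb.conserved.law_eq_zero_iff, hb.pd_density]
    intro h
    obtain ⟨t, ht⟩ := hI
    obtain ⟨x, hx⟩ := hJ
    exact (Real.exp_pos _).ne' (congrArg (fun H : DF (box I J) ℕ => H (⟨(t, x), ht, hx⟩, 0)) h)
  · obtain ⟨ρ, σ, hρσ, rfl⟩ := (quasilinear_burgersRhs hφ hφ0).exists_law hE C'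
    have hγ := burgersChar_of_conserved hφ hφ0 hρσ
    -- the quotient of two characteristics is constant
    have hInv : ContDiffOn ℝ ∞ (fun t => (Real.exp (A t))⁻¹) I := hLs.inv fun t _ => (Real.exp_pos _).ne'
    let lam : DF (box I J) ℕ := timeFun hLs
    let inv : DF (box I J) ℕ := timeFun hInv
    have hmul : inv * lam = 1 := ext fun j => inv_mul_cancel₀ (Real.exp_pos _).ne'
    have hcancel : ∀ F : DF (box I J) ℕ, lam * F = 0 → F = 0 := fun F hF => by
      linear_combination inv * hF - F * hmul
    have hquot : ∀ T : Derivation ℝ (DF (box I J) ℕ) (DF (box I J) ℕ), ∀ c,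
        T lam = c * lam → T (pd 0 ρ) = c * pd 0 ρ → T (inv * pd 0 ρ) = 0 := by
      intro T c h1 h2
      have h3 := congrArg T hmul
      rw [Derivation.leibniz, h1, Derivation.map_one_eq_zero, smul_eq_mul, smul_eq_mul] at h3
      refine hcancel _ ?_
      rw [Derivation.leibniz, h2, smul_eq_mul, smul_eq_mul]
      linear_combination pd 0 ρ * h3
    obtain ⟨a, ha⟩ := exists_eq_algebraMap (isPreconnected_box hIc hJc) (F := inv * pd 0 ρ)
      (fun k => hquot _ 0 (by rw [zero_mul]; exact hb.pd_eq k) (by rw [zero_mul]; exact hγ.pd_eq k))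
      (hquot _ _ hb.evo_eq hγ.evo_eq)
      (hquot D 0 (by rw [zero_mul]; exact hb.D_eq) (by rw [zero_mul]; exact hγ.D_eq))
    refine ⟨a, ?_⟩
    rw [hb.conserved.smul_law, Conserved.law_eq_iff, Derivation.map_smul, hb.pd_density, Algebra.smul_def,
      ← ha]
    linear_combination pd 0 ρ * hmul
  · rw [hb.conserved.smul_law, Conserved.isReducedCharacteristic_iff, Derivation.map_smul, hb.pd_density]
    rfl

end

end DF

/-! ### Conservation laws of the potential equation -/

namespace DF

section

variable {Ω : TopologicalSpace.Opens (ℝ × ℝ)}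

/-- The partial derivative with respect to `t`. -/
def pt : Derivation ℝ (DF Ω ℕ) (DF Ω ℕ) := vf (1, 0) 0

/-- The partial derivative with respect to `x`. -/
def px : Derivation ℝ (DF Ω ℕ) (DF Ω ℕ) := vf (0, 1) 0

theorem pd_pt (k : ℕ) (F : DF Ω ℕ) : pd k (pt F) = pt (pd k F) := by
  rw [pt, pd_vf, add_eq_left]
  have : (fun d => pd k ((0 : ℕ → DF Ω ℕ) d)) = 0 := funext fun d => map_zero _
  rw [this, vf_zero_zero]

theorem pd_px (k : ℕ) (F : DF Ω ℕ) : pd k (px F) = px (pd k F) := by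
  rw [px, pd_vf, add_eq_left]
  have : (fun d => pd k ((0 : ℕ → DF Ω ℕ) d)) = 0 := funext fun d => map_zero _
  rw [this, vf_zero_zero]

theorem OrderLE.evo_eq {F : DF Ω ℕ} (h : OrderLE 0 F) (K : DF Ω ℕ) : evo K F = pt F + K * pd 0 F := by
  rw [evo, h.vf_eq, zero_add, Finset.sum_range_one]
  rfl

theorem OrderLE.D_eq {F : DF Ω ℕ} (h : OrderLE 0 F) : D F = px F + coord 1 * pd 0 F := by
  rw [D, h.vf_eq, zero_add, Finset.sum_range_one]
  rfl

/-- The coefficients of the potential equation `v_t + η v_x² + φ v_xx - φ_x v_x = 0`, where `η = φ θ` depends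
only on `t` and satisfies `η_t = -φ_xx η`. -/
structure PotentialCoeffs (φ η θ : DF Ω ℕ) : Prop where
  pd_φ : ∀ k, pd k φ = 0
  pd_θ : ∀ k, pd k θ = 0
  φ_ne : ∀ j, φ j ≠ 0
  θ_ne : ∀ j, θ j ≠ 0
  η_eq : η = φ * θ
  px_η : px η = 0
  pt_η : pt η = -(px (px φ) * η)

/-- The right-hand side of the potential equation `v_t = -(η v_x² + φ v_xx - φ_x v_x)`. -/
def potentialRhs (φ η : DF Ω ℕ) : DF Ω ℕ := -(η * coord 1 ^ 2 + φ * coord 2 - px φ * coord 1)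

/-- The characteristics of conservation laws of the potential equation that correspond to densities of order
zero. The first two conditions say that `μ = ψ(t, x) e^{θ v}`, the next two imply that `φ` is locally constant
where `μ` does not vanish, and the last one is the heat equation. -/
structure PotentialChar (φ θ μ : DF Ω ℕ) : Prop where
  order : OrderLE 0 μ
  pd_zero : pd 0 μ = θ * μ
  px_φ : px φ * μ = 0
  pt_φ : pt φ * μ = 0
  heat : pt μ = φ * px (px μ)

theorem PotentialCoeffs.quasilinear {φ η θ : DF Ω ℕ} (h : PotentialCoeffs φ η θ) :
    Quasilinear φ (potentialRhs φ η) where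
  pd_coeff := h.pd_φ
  ne_zero := h.φ_ne
  orderLE k hk := by
    simp [potentialRhs, pd_coord, h.pd_φ, h.η_eq, h.pd_θ, pd_px, Derivation.leibniz_pow,
      show 1 ≠ k by omega, show 2 ≠ k by omega]
  pd_two := by simp [potentialRhs, pd_coord, h.pd_φ, h.η_eq, h.pd_θ, pd_px, Derivation.leibniz_pow]

theorem eq_zero_of_mul_eq_zero {ι : Type} {F G : DF Ω ι} (hF : ∀ j, F j ≠ 0) (h : F * G = 0) : G = 0 :=
  ext fun j => (_root_.mul_eq_zero.1 (congrArg (fun H : DF Ω ι => H j) h)).resolve_left (hF j)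

/-- The algebra of differential functions is reduced. -/
theorem mul_eq_zero_of_sq_mul {ι : Type} {F G : DF Ω ι} (h : F * (F * G) = 0) : F * G = 0 :=
  ext fun j => by
    have h1 : F j * (F j * G j) = 0 := congrArg (fun H : DF Ω ι => H j) h
    rcases _root_.mul_eq_zero.1 h1 with h2 | h2
    · rw [mul_apply, h2, zero_mul]; rfl
    · exact h2

/-- The equation for `μ = ∂ρ/∂v` that remains after comparing coefficients is
`μ_t = (2 φ_x μ + φ μ_x)_x`, while `μ_v = θ μ`. Its derivatives with respect to `v` give the conditions on `φ`. -/
theorem PotentialCoeffs.potentialChar {φ η θ ρ σ : DF Ω ℕ} (h : PotentialCoeffs φ η θ)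
    (hc : Conserved (potentialRhs φ η) ρ σ) : PotentialChar φ θ (pd 0 ρ) := by
  have hK := h.quasilinear
  have hη : ∀ k, pd k η = 0 := fun k => by simp [h.η_eq, h.pd_φ, h.pd_θ]
  have hχ : ∀ k, pd k (px φ) = 0 := fun k => by rw [pd_px, h.pd_φ, map_zero]
  have hK1 : pd 1 (potentialRhs φ η) = px φ - 2 * η * coord 1 := by
    simp [potentialRhs, pd_coord, h.pd_φ, hη, hχ, Derivation.leibniz_pow]
    ring
  have hK0 : pd 0 (potentialRhs φ η) = 0 := by
    simp [potentialRhs, pd_coord, h.pd_φ, hη, hχ, Derivation.leibniz_pow]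
  have hρ := hc.order
  have h2 : (2 : DF Ω ℕ) = algebraMap ℝ _ 2 := (map_ofNat _ 2).symm
  have hK11 : pd 1 (pd 1 (potentialRhs φ η)) = -(2 * η) := by
    rw [hK1, h2]
    simp [hη, hχ]
  -- the dependence on `v`
  have hμ0 : pd 0 (pd 0 ρ) = θ * pd 0 ρ := by
    have h1 := hK.pd_pd_density hρ hc.eq_zero
    simp only [zero_add, Finset.sum_range_one, Function.iterate_zero, id, hK11] at h1
    rw [h.η_eq] at h1
    rw [← sub_eq_zero]
    refine hK.mul_eq_zero (eq_zero_of_add_self ?_)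
    linear_combination h1
  have hμ : OrderLE 0 (pd 0 ρ) := fun k hk => by rw [pd_comm, hρ k hk, map_zero]
  have hσ1 : pd 1 σ = φ * pd 0 ρ := hK.pd_flux hρ hc.eq_zero
  have e1 := congrArg (pd 1) hc.eq_zero
  rw [map_add, hρ.pd_evo, hρ 1 one_pos, map_zero, zero_add, pd_succ_D, zero_add, Finset.sum_range_one,
    Function.iterate_zero, id, hK1, hσ1, map_zero] at e1
  have e0 := congrArg (pd 0) hc.eq_zero
  rw [map_add, hρ.pd_evo, pd_zero_D, zero_add, Finset.sum_range_one, Function.iterate_zero, id, hK0,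
    map_zero, zero_mul, add_zero,
    show pd 0 σ = 2 * η * coord 1 * pd 0 ρ - px φ * pd 0 ρ - D (φ * pd 0 ρ) by
      linear_combination e1] at e0
  generalize pd 0 ρ = μ at *
  have hOmul : ∀ F : DF Ω ℕ, (∀ k, pd k F = 0) → ∀ G, OrderLE 0 G → OrderLE 0 (F * G) :=
    fun F hF G hG k hk => by rw [Derivation.leibniz, hF, hG k hk, smul_zero, smul_zero, add_zero]
  have hOpx : ∀ G : DF Ω ℕ, OrderLE 0 G → OrderLE 0 (px G) := fun G hG k hk => by
    rw [pd_px, hG k hk, map_zero]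
  -- `φ θ_x = - φ_x θ`, since `η = φ θ` does not depend on `x`
  have hθx : φ * px θ = -(px φ * θ) := by
    have := h.px_η
    rw [h.η_eq, Derivation.leibniz, smul_eq_mul, smul_eq_mul] at this
    linear_combination this
  have hDη : D η = 0 := by
    rw [OrderLE.D_eq fun k _ => hη k, h.px_η, hη, mul_zero, add_zero]
  have heq : pt μ = px (2 * px φ * μ + φ * px μ) := by
    have h3 : D (φ * μ) = px φ * μ + φ * px μ + η * coord 1 * μ := by
      rw [(hOmul φ h.pd_φ μ hμ).D_eq, Derivation.leibniz, Derivation.leibniz, h.pd_φ, hμ0, h.η_eq]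
      simp only [smul_eq_mul]
      ring
    set M := 2 * px φ * μ + φ * px μ with hM
    have hMO : OrderLE 0 M := by
      have h4 : M = px φ * μ + (px φ * μ + φ * px μ) := by rw [hM]; ring
      intro k hk
      rw [h4, map_add, map_add, hOmul _ hχ μ hμ k hk, hOmul _ h.pd_φ _ (hOpx μ hμ) k hk, add_zero,
        add_zero]
    have hM0 : pd 0 M = px φ * θ * μ + η * px μ := by
      have h4 : M = px φ * μ + (px φ * μ + φ * px μ) := by rw [hM]; ring
      rw [h4]
      simp only [map_add, Derivation.leibniz, hχ, h.pd_φ, pd_px, hμ0, smul_eq_mul, mul_zero, add_zero,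
        h.η_eq]
      linear_combination μ * hθx
    have h5 : 2 * η * coord 1 * μ - px φ * μ - D (φ * μ) = η * (coord 1 * μ) - M := by
      rw [h3, hM]; ring
    rw [h5, map_sub, hMO.D_eq, hM0, hμ.evo_eq, hμ0, Derivation.leibniz, Derivation.leibniz, hDη,
      D_coord, hμ.D_eq, hμ0, potentialRhs, h.η_eq] at e0
    simp only [smul_eq_mul] at e0
    rw [h.η_eq] at *
    linear_combination e0
  -- the derivative of the equation with respect to `v`, and its derivative
  have heq1 : pt θ * μ = px θ * (2 * px φ * μ + φ * px μ) + px (φ * px θ * μ) := by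
    have h3 := congrArg (pd 0) heq
    rw [pd_pt, pd_px, hμ0] at h3
    have h4 : pd 0 (2 * px φ * μ + φ * px μ) = θ * (2 * px φ * μ + φ * px μ) + φ * px θ * μ := by
      rw [h2]
      simp only [map_add, Derivation.leibniz, hχ, h.pd_φ, pd_px, hμ0, smul_eq_mul, mul_zero, add_zero,
        Derivation.map_algebraMap]
      ring
    rw [h4, Derivation.leibniz, map_add, Derivation.leibniz px θ, heq] at h3
    simp only [smul_eq_mul] at h3
    linear_combination h3
  have hθ' : ∀ k, pd k (px θ) = 0 := fun k => by rw [pd_px, h.pd_θ, map_zero]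
  have hθt : ∀ k, pd k (pt θ) = 0 := fun k => by rw [pd_pt, h.pd_θ, map_zero]
  -- applying `∂/∂v - θ` to `heq1` gives `2 φ θ_x² μ = 0`
  have hθμ : px θ * μ = 0 := by
    have h3 := congrArg (pd 0) heq1
    have h4 : pd 0 (2 * px φ * μ + φ * px μ) = θ * (2 * px φ * μ + φ * px μ) + φ * px θ * μ := by
      rw [h2]
      simp only [map_add, Derivation.leibniz, hχ, h.pd_φ, pd_px, hμ0, smul_eq_mul, mul_zero, add_zero,
        Derivation.map_algebraMap]
      ring
    have h5 : pd 0 (φ * px θ * μ) = θ * (φ * px θ * μ) := by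
      simp only [Derivation.leibniz, h.pd_φ, hθ', hμ0, smul_eq_mul, mul_zero, add_zero]
      ring
    rw [map_add, pd_px, h5, Derivation.leibniz, Derivation.leibniz, h4, hμ0, hθt, hθ',
      Derivation.leibniz px θ] at h3
    simp only [smul_eq_mul, mul_zero, add_zero] at h3
    refine mul_eq_zero_of_sq_mul (hK.mul_eq_zero (eq_zero_of_add_self ?_))
    linear_combination θ * heq1 - h3
  have hθμx : px θ * px μ = 0 := by
    refine mul_eq_zero_of_sq_mul ?_
    have h3 := congrArg px hθμ
    rw [Derivation.leibniz, map_zero, smul_eq_mul, smul_eq_mul] at h3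
    linear_combination px θ * h3 - px (px θ) * hθμ
  have hφx : px φ * μ = 0 := eq_zero_of_mul_eq_zero h.θ_ne (by
    linear_combination μ * hθx - φ * hθμ)
  have hφxx : px φ * px μ = 0 := eq_zero_of_mul_eq_zero h.θ_ne (by
    linear_combination px μ * hθx - φ * hθμx)
  have hθtμ : pt θ * μ = 0 := by
    rw [mul_assoc φ, hθμ, mul_zero, map_zero, add_zero] at heq1
    linear_combination heq1 + 2 * px φ * hθμ + φ * hθμx
  have hxx : px (px φ) * μ = 0 := by
    have h3 := congrArg px hφx
    rw [Derivation.leibniz, map_zero, smul_eq_mul, smul_eq_mul] at h3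
    linear_combination h3 - hφxx
  refine ⟨hμ, hμ0, hφx, eq_zero_of_mul_eq_zero h.θ_ne ?_, ?_⟩
  · have h3 := h.pt_η
    rw [h.η_eq, Derivation.leibniz, smul_eq_mul, smul_eq_mul] at h3
    linear_combination μ * h3 - φ * hθtμ - φ * θ * hxx
  · rw [heq, mul_assoc, hφx, mul_zero, zero_add, Derivation.leibniz, smul_eq_mul, smul_eq_mul]
    linear_combination hφxx

/-- If the coefficients are constant, then every solution `μ = ψ e^{θ v}` with `ψ_t = φ ψ_xx` gives rise to a
conserved vector with density `μ / θ`. -/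
theorem PotentialCoeffs.conserved {φ η θ ζ μ : DF Ω ℕ} (h : PotentialCoeffs φ η θ) (hζ : ζ * θ = 1)
    (hφ : D φ = 0) (hD : D ζ = 0) (hT : evo (potentialRhs φ η) ζ = 0) (hζ' : ∀ k, pd k ζ = 0)
    (hμ : OrderLE 0 μ) (hμ0 : pd 0 μ = θ * μ) (heat : pt μ = φ * px (px μ)) :
    Conserved (potentialRhs φ η) (ζ * μ) (φ * coord 1 * μ - φ * ζ * px μ) ∧ pd 0 (ζ * μ) = μ := by
  have hpxφ : px φ = 0 := by
    have := OrderLE.D_eq fun k (_ : 0 < k) => h.pd_φ k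
    rwa [hφ, h.pd_φ, mul_zero, add_zero, eq_comm] at this
  have hpxμ : OrderLE 0 (px μ) := fun k hk => by rw [pd_px, hμ k hk, map_zero]
  have hpxθ : px θ = 0 := by
    have := h.px_η
    rw [h.η_eq, Derivation.leibniz, hpxφ, smul_zero, add_zero] at this
    exact eq_zero_of_mul_eq_zero h.φ_ne this
  refine ⟨⟨fun k hk => ?_, ?_⟩, ?_⟩
  · rw [Derivation.leibniz, hζ', hμ k hk, smul_zero, smul_zero, add_zero]
  · have h1 : px (θ * μ) = θ * px μ := by
      rw [Derivation.leibniz, hpxθ, smul_zero, add_zero, smul_eq_mul]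
    simp only [map_sub, Derivation.leibniz, smul_eq_mul, hT, hD, hφ, D_coord, hμ.evo_eq, hμ.D_eq,
      hpxμ.D_eq, pd_px, hμ0, h1, heat]
    rw [potentialRhs, hpxφ, h.η_eq]
    linear_combination (-φ * coord 2 * μ - φ * θ * coord 1 ^ 2 * μ - φ * coord 1 * px μ) * hζ
  · rw [Derivation.leibniz, hζ', smul_zero, add_zero, hμ0, smul_eq_mul]
    linear_combination μ * hζ

end

end DF

/-! ### Characteristics for the potential equation on a rectangle -/

namespace DF

section

variable {Ω : TopologicalSpace.Opens (ℝ × ℝ)} {ι : Type}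

/-- The exponential of a differential function. -/
def exp (F : DF Ω ι) : DF Ω ι := compReal Real.exp Real.contDiff_exp F

@[simp] theorem exp_apply (F : DF Ω ι) (j : JetOver Ω ι) : exp F j = Real.exp (F j) := rfl

theorem vf_exp (e : ℝ × ℝ) (A : ι → DF Ω ι) (F : DF Ω ι) : vf e A (exp F) = exp F * vf e A F :=
  ext fun j => by
    rw [vf_apply, mul_apply, exp_apply, vf_apply, exp, dir_compReal, Real.deriv_exp]

theorem exp_neg_mul_exp (F : DF Ω ι) : exp (-F) * exp F = 1 :=
  ext fun j => by
    rw [mul_apply, exp_apply, exp_apply, neg_apply, ← Real.exp_add, neg_add_cancel, Real.exp_zero]; rfl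

/-- Differential functions are continuous in `(t, x)` for fixed jet coordinates. -/
theorem continuousOn_base_variable (F : DF Ω ι) (u : ι → ℝ) :
    ContinuousOn (fun p : ℝ × ℝ => extend F.1 (p, u)) Ω := by
  obtain ⟨s, G, h⟩ := F.2
  have h1 : ContinuousOn (fun p : ℝ × ℝ => G (p, s.restrict u)) Ω :=
    h.1.continuousOn.comp (by fun_prop) fun p hp => ⟨hp, mem_univ _⟩
  exact h1.congr fun p hp => (extend_of_mem (p := (p, u)) F.1 hp).trans (h.2 _)

theorem eq_of_restricts_lift {F : Jet 1 → ℝ} {A B : DF Ω ℕ} (hA : Restricts F (lift A : DF Ω _))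
    (hB : Restricts F (lift B : DF Ω _)) : A = B :=
  ext fun j => ((hA ((j.1 : ℝ × ℝ), fun c => j.2 c.2.2) j.1.2).symm.trans
    (hB ((j.1 : ℝ × ℝ), fun c => j.2 c.2.2) j.1.2) :)

end

section

variable {I J : TopologicalSpace.Opens ℝ} {f : ℝ → ℝ → ℝ} {lam : ℝ → ℝ}

/-- The hypotheses on `f` and on the multiplier `λ` of the potential system. -/
structure PotentialData (I J : TopologicalSpace.Opens ℝ) (f : ℝ → ℝ → ℝ) (lam : ℝ → ℝ) : Prop where
  smooth : ContDiffOn ℝ ∞ (Function.uncurry f) ((I : Set ℝ) ×ˢ (J : Set ℝ))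
  ne_zero : ∀ t ∈ I, ∀ x ∈ J, f t x ≠ 0
  lam_smooth : ContDiffOn ℝ ∞ lam I
  lam_ne_zero : ∀ t ∈ I, lam t ≠ 0
  lam_deriv : ∀ t ∈ I, ∀ x ∈ J, HasDerivAt lam (fxx f t x * lam t) t

namespace PotentialData

variable (h : PotentialData I J f lam)

/-- `1 / (2 λ)`. -/
def eta : DF (box I J) ℕ :=
  timeFun (L := fun t => 1 / (2 * lam t)) (contDiffOn_const.div (contDiffOn_const.mul h.lam_smooth)
    fun t ht => mul_ne_zero two_ne_zero (h.lam_ne_zero t ht))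

/-- `2 f λ`. -/
def zeta : DF (box I J) ℕ := algebraMap ℝ _ 2 * coeff h.smooth * timeFun h.lam_smooth

/-- `1 / (2 f λ)`. -/
def theta : DF (box I J) ℕ :=
  base (fun p => 1 / (2 * f p.1 p.2 * lam p.1)) (contDiffOn_const.div
    ((contDiffOn_const.mul h.smooth).mul (h.lam_smooth.comp contDiff_fst.contDiffOn fun _ hp => hp.1))
    fun _ hp => mul_ne_zero (mul_ne_zero two_ne_zero (h.ne_zero _ hp.1 _ hp.2)) (h.lam_ne_zero _ hp.1))

theorem theta_apply (j : JetOver (box I J) ℕ) :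
    h.theta j = 1 / (2 * f j.1.1.1 j.1.1.2 * lam j.1.1.1) := rfl

theorem zeta_apply (j : JetOver (box I J) ℕ) :
    h.zeta j = 2 * f j.1.1.1 j.1.1.2 * lam j.1.1.1 := rfl

theorem zeta_ne_zero (j : JetOver (box I J) ℕ) : h.zeta j ≠ 0 :=
  mul_ne_zero (mul_ne_zero two_ne_zero (h.ne_zero _ j.1.2.1 _ j.1.2.2)) (h.lam_ne_zero _ j.1.2.1)

theorem zeta_mul_theta : h.zeta * h.theta = 1 :=
  ext fun j => by
    rw [mul_apply, theta_apply, ← h.zeta_apply, mul_one_div_cancel (h.zeta_ne_zero j)]; rfl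

theorem px_coeff : px (coeff h.smooth) = D (coeff h.smooth) := vf_base_congr _ _ _ _ _

theorem px_px_coeff_apply (j : JetOver (box I J) ℕ) :
    px (px (coeff h.smooth)) j = fxx f j.1.1.1 j.1.1.2 := by
  rw [← D_D_coeff_apply h.smooth, ← h.px_coeff, OrderLE.D_eq (F := px (coeff h.smooth)), pd_px, pd_coeff,
    map_zero, mul_zero, add_zero]
  intro k _
  rw [pd_px, pd_coeff, map_zero]

theorem potentialCoeffs : PotentialCoeffs (coeff h.smooth) h.eta h.theta where
  pd_φ := pd_coeff _
  pd_θ k := pd_base _ _ _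
  φ_ne := coeff_ne_zero _ h.ne_zero
  θ_ne j := one_div_ne_zero (h.zeta_ne_zero j)
  η_eq := ext fun j => by
    have h1 := h.ne_zero _ j.1.2.1 _ j.1.2.2
    have h2 := h.lam_ne_zero _ j.1.2.1
    rw [mul_apply, theta_apply, coeff_apply, eta, timeFun_apply]
    field_simp
  px_η := ext fun j =>
    (hasDerivAt_vf_x (F := h.eta) (h := fun t _ => 1 / (2 * lam t)) (fun _ => rfl) _ j).unique
      (hasDerivAt_const _ _)
  pt_η := ext fun j => by
    have h2 := h.lam_ne_zero _ j.1.2.1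
    rw [neg_apply, mul_apply, h.px_px_coeff_apply]
    refine (hasDerivAt_vf_t (F := h.eta) (h := fun t _ => 1 / (2 * lam t)) (fun _ => rfl) _ j).unique ?_
    have h3 := ((h.lam_deriv _ j.1.2.1 _ j.1.2.2).const_mul 2).fun_inv
      (mul_ne_zero two_ne_zero (h.lam_ne_zero _ j.1.2.1))
    simp only [one_div, eta, timeFun_apply]
    refine h3.congr_deriv ?_
    field_simp

theorem restricts (k : Fin 1) : Restricts (potentialEquation f lam k)
    (evoEq (potentialRhs (coeff h.smooth) h.eta)) := by
  intro j hj
  have h1 : px (coeff h.smooth) (substPoint (fun b => coord (0, 0, b)) (⟨j.1, hj⟩, j.2)) =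
      fx f j.1.1 j.1.2 := by rw [h.px_coeff, D_coeff_apply]; rfl
  simp only [potentialEquation, evoEq, potentialRhs, map_neg, map_add, map_sub, map_mul, map_pow,
    subst_coord, sub_apply, neg_apply, add_apply, mul_apply, pow_apply, coord_apply]
  change _ = _ - -(1 / (2 * lam j.1.1) * _ + f j.1.1 j.1.2 * _ - px (coeff h.smooth) (substPoint _ _) * _)
  rw [h1]
  ring

/-- The potential equation has no nonzero conservation laws if `f` is not constant on any open set. -/
theorem subsingleton_of_nonconstant (h : PotentialData I J f lam)
    (hnc : ∀ U : Set (ℝ × ℝ), IsOpen U → U.Nonempty → U ⊆ (I : Set ℝ) ×ˢ (J : Set ℝ) →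
      ¬ ∃ c : ℝ, ∀ p ∈ U, f p.1 p.2 = c) :
    Subsingleton (ConservationLaws (box I J) (potentialEquation f lam)) := by
  refine subsingleton_of_forall_eq 0 fun C => ?_
  obtain ⟨ρ, σ, hρσ, rfl⟩ := h.potentialCoeffs.quasilinear.exists_law h.restricts C
  rw [hρσ.law_eq_zero_iff]
  have hμ := h.potentialCoeffs.potentialChar hρσ
  generalize pd 0 ρ = μ at hμ
  by_contra hne
  obtain ⟨j, hj⟩ : ∃ j, μ j ≠ 0 := by
    by_contra! h0
    exact hne (ext h0)
  -- `μ` does not vanish near `j`, so that the gradient of `f` vanishes on a ball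
  have hU : IsOpen ((box I J : Set (ℝ × ℝ)) ∩ (fun p : ℝ × ℝ => extend μ.1 (p, j.2)) ⁻¹' {0}ᶜ) :=
    (continuousOn_base_variable μ j.2).isOpen_inter_preimage (box I J).isOpen isOpen_compl_singleton
  obtain ⟨ε, hε, hball⟩ := Metric.isOpen_iff.1 hU (j.1 : ℝ × ℝ) ⟨j.1.2, by
    rw [mem_preimage, extend_of_mem (p := ((j.1 : ℝ × ℝ), j.2)) μ.1 j.1.2]
    exact hj⟩
  have hfd : (Metric.ball (j.1 : ℝ × ℝ) ε).EqOn (fderiv ℝ (Function.uncurry f)) 0 := by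
    intro p hp
    have hpb : p ∈ box I J := (hball hp).1
    have hp0 : μ (⟨p, hpb⟩, j.2) ≠ 0 := by
      have := (hball hp).2
      rw [mem_preimage, extend_of_mem (p := (p, j.2)) μ.1 hpb] at this
      exact this
    have h2 := (mul_eq_zero.1 (congrArg (fun H : DF (box I J) ℕ => H (⟨p, hpb⟩, j.2))
      hμ.px_φ)).resolve_right hp0
    have h3 := (mul_eq_zero.1 (congrArg (fun H : DF (box I J) ℕ => H (⟨p, hpb⟩, j.2))
      hμ.pt_φ)).resolve_right hp0
    replace h2 := (dir_base (Ω := box I J) (Function.uncurry f) h.smooth _ _).symm.trans h2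
    replace h3 := (dir_base (Ω := box I J) (Function.uncurry f) h.smooth _ _).symm.trans h3
    change fderiv ℝ (Function.uncurry f) p (1, 0) = 0 at h3
    change fderiv ℝ (Function.uncurry f) p (0, 1) = 0 at h2
    ext
    · simpa using h3
    · simpa using h2
  obtain ⟨c, hc⟩ := Metric.isOpen_ball.exists_is_const_of_fderiv_eq_zero
    (convex_ball (j.1 : ℝ × ℝ) ε).isPreconnected
    ((h.smooth.differentiableOn (by simp)).mono fun p hp => (hball hp).1) hfd
  exact hnc _ Metric.isOpen_ball (Metric.nonempty_ball.2 hε) (fun p hp => (hball hp).1) ⟨c, hc⟩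

section constant

theorem coeff_eq_algebraMap {ι : Type} {c : ℝ} (hc : ∀ t ∈ I, ∀ x ∈ J, f t x = c) :
    (coeff h.smooth : DF (box I J) ι) = algebraMap ℝ _ c := ext fun j => hc _ j.1.2.1 _ j.1.2.2

/-- For constant `f`, the function `2 f λ` is constant. -/
theorem deriv_zeta (hc : ∃ c : ℝ, ∀ t ∈ I, ∀ x ∈ J, f t x = c) (A : ℕ → DF (box I J) ℕ) :
    vf (1, 0) A h.zeta = 0 ∧ vf (0, 1) A h.zeta = 0 := by
  obtain ⟨c, hc⟩ := hc
  have h1 := burgersChar_timeFun h.smooth h.lam_smooth h.lam_deriv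
  have h2 : vf (1, 0) A (timeFun h.lam_smooth : DF (box I J) ℕ) = 0 := by
    have h3 := h1.evo_eq
    rw [h.coeff_eq_algebraMap hc, Derivation.map_algebraMap, map_zero, zero_mul] at h3
    rw [← h3]
    exact vf_base_congr _ _ _ _ _
  have h3 : vf (0, 1) A (timeFun h.lam_smooth : DF (box I J) ℕ) = 0 := by
    rw [← h1.D_eq]
    exact vf_base_congr _ _ _ _ _
  rw [zeta, h.coeff_eq_algebraMap hc]
  simp [h2, h3]

theorem deriv_theta (hc : ∃ c : ℝ, ∀ t ∈ I, ∀ x ∈ J, f t x = c) (A : ℕ → DF (box I J) ℕ) :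
    vf (1, 0) A h.theta = 0 ∧ vf (0, 1) A h.theta = 0 := by
  have key : ∀ T : Derivation ℝ (DF (box I J) ℕ) (DF (box I J) ℕ), T h.zeta = 0 → T h.theta = 0 := by
    intro T hT
    have h1 := congrArg T h.zeta_mul_theta
    rw [Derivation.leibniz, hT, smul_zero, add_zero, Derivation.map_one_eq_zero, smul_eq_mul] at h1
    exact eq_zero_of_mul_eq_zero h.zeta_ne_zero h1
  exact ⟨key _ (h.deriv_zeta hc A).1, key _ (h.deriv_zeta hc A).2⟩

/-- `e^{v / (2 f λ)}`. -/
def expTheta : DF (box I J) ℕ := exp (h.theta * coord 0)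

theorem pd_expTheta (k : ℕ) : pd k h.expTheta = if k = 0 then h.theta * h.expTheta else 0 := by
  rw [expTheta, pd, vf_exp]
  rcases eq_or_ne k 0 with rfl | hk
  · have : vf 0 (Pi.single 0 1) (h.theta * coord 0) = pd 0 (h.theta * coord 0) := rfl
    rw [if_pos rfl, this, Derivation.leibniz, pd_coord_self, h.potentialCoeffs.pd_θ, smul_zero, add_zero,
      smul_eq_mul, mul_one, mul_comm]
  · have : vf 0 (Pi.single k 1) (h.theta * coord 0) = pd k (h.theta * coord 0) := rfl
    rw [if_neg hk, this, Derivation.leibniz, pd_coord_of_ne hk.symm, h.potentialCoeffs.pd_θ, smul_zero,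
      smul_zero, add_zero, mul_zero]

theorem deriv_expTheta (hc : ∃ c : ℝ, ∀ t ∈ I, ∀ x ∈ J, f t x = c) :
    pt h.expTheta = 0 ∧ px h.expTheta = 0 := by
  have h1 := h.deriv_theta hc 0
  have h2 : vf (1, 0) 0 (coord 0 : DF (box I J) ℕ) = 0 := vf_coord _ _ _
  have h3 : vf (0, 1) 0 (coord 0 : DF (box I J) ℕ) = 0 := vf_coord _ _ _
  constructor
  · rw [pt, expTheta, vf_exp, Derivation.leibniz, h1.1, h2, smul_zero, smul_zero, add_zero, mul_zero]
  · rw [px, expTheta, vf_exp, Derivation.leibniz, h1.2, h3, smul_zero, smul_zero, add_zero, mul_zero]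

theorem expTheta_apply (j : JetOver (box I J) ℕ) :
    h.expTheta j = Real.exp (j.2 0 / (2 * f j.1.1.1 j.1.1.2 * lam j.1.1.1)) := by
  rw [expTheta, exp_apply, mul_apply, theta_apply, coord_apply, one_div_mul_eq_div]

/-- The heat equation in terms of partial derivatives of differential functions. -/
theorem isHeatSolution_iff {ψ : ℝ → ℝ → ℝ}
    (hψ : ContDiffOn ℝ ∞ (Function.uncurry ψ) ((I : Set ℝ) ×ˢ (J : Set ℝ))) :
    IsHeatSolution I J f ψ ↔
      pt (coeff hψ : DF (box I J) ℕ) = coeff h.smooth * px (px (coeff hψ)) := by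
  have h1 : px (px (coeff hψ : DF (box I J) ℕ)) = D (D (coeff hψ)) := by
    have h2 : px (coeff hψ : DF (box I J) ℕ) = D (coeff hψ) := vf_base_congr _ _ _ _ _
    rw [← h2, OrderLE.D_eq (F := px _), pd_px, pd_coeff, map_zero, mul_zero, add_zero]
    intro k _
    rw [pd_px, pd_coeff, map_zero]
  have h3 : ∀ j, pt (coeff hψ : DF (box I J) ℕ) j = deriv (fun s => ψ s j.1.1.2) j.1.1.1 := fun j =>
    (hasDerivAt_vf_t (F := coeff hψ) (fun _ => rfl) _ j).deriv.symm
  have h4 : ∀ j, px (px (coeff hψ : DF (box I J) ℕ)) j =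
      iteratedDeriv 2 (fun y => ψ j.1.1.1 y) j.1.1.2 := fun j => by
    rw [h1]; exact D_iterate_apply (F := coeff hψ) (fun _ => rfl) 2 j
  constructor
  · rintro ⟨-, h5⟩
    ext j
    rw [mul_apply, h3, h4]
    exact h5 _ j.1.2.1 _ j.1.2.2
  · intro h5
    refine ⟨hψ, fun t ht x hx => ?_⟩
    have h6 := congrArg (fun H : DF (box I J) ℕ => H (⟨(t, x), ht, hx⟩, 0)) h5
    simp only [mul_apply] at h6
    rw [h3, h4] at h6
    exact h6

theorem restricts_lift_iff {ψ : ℝ → ℝ → ℝ}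
    (hψ : ContDiffOn ℝ ∞ (Function.uncurry ψ) ((I : Set ℝ) ×ˢ (J : Set ℝ))) (μ : Jet 1 → ℝ) :
    Restricts μ (lift (coeff hψ * h.expTheta) : DF (box I J) _) ↔
      ∀ j : Jet 1, j.1 ∈ box I J → μ j = ψ j.1.1 j.1.2 *
        Real.exp (j.2 (0, 0, 0) / (2 * f j.1.1 j.1.2 * lam j.1.1)) := by
  refine forall₂_congr fun j hj => ?_
  rw [map_mul, mul_apply, subst_apply, subst_apply, expTheta_apply]
  rfl

/-- For constant `f`, every characteristic has the form `ψ e^{v / (2 f λ)}`. -/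
theorem exists_heatSolution (h : PotentialData I J f lam) (hc : ∃ c : ℝ, ∀ t ∈ I, ∀ x ∈ J, f t x = c)
    (C : ConservationLaws (box I J) (potentialEquation f lam)) :
    ∃ ψ : ℝ → ℝ → ℝ, IsHeatSolution I J f ψ ∧ ∀ μ : Jet 1 → ℝ, IsReducedCharacteristic C μ ↔
      ∀ j : Jet 1, j.1 ∈ box I J → μ j = ψ j.1.1 j.1.2 *
        Real.exp (j.2 (0, 0, 0) / (2 * f j.1.1 j.1.2 * lam j.1.1)) := by
  obtain ⟨ρ, σ, hρσ, rfl⟩ := h.potentialCoeffs.quasilinear.exists_law h.restricts C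
  have hμ := h.potentialCoeffs.potentialChar hρσ
  simp only [hρσ.isReducedCharacteristic_iff]
  generalize pd 0 ρ = μ at hμ
  -- `ψ = μ e^{-θ v}` does not depend on `v`
  have hinv : exp (-(h.theta * coord 0)) * h.expTheta = 1 := exp_neg_mul_exp _
  have hcancel : ∀ F : DF (box I J) ℕ, h.expTheta * F = 0 → F = 0 := fun F hF => by
    linear_combination exp (-(h.theta * coord 0)) * hF - F * hinv
  have hQ : μ = (exp (-(h.theta * coord 0)) * μ) * h.expTheta := by
    linear_combination (-μ) * hinv
  generalize exp (-(h.theta * coord 0)) * μ = Q at hQ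
  have hpd : ∀ k, pd k Q = 0 := by
    intro k
    refine hcancel _ ?_
    have h1 := congrArg (pd k) hQ
    rw [Derivation.leibniz, h.pd_expTheta, smul_eq_mul, smul_eq_mul] at h1
    rcases eq_or_ne k 0 with rfl | hk
    · rw [if_pos rfl, hμ.pd_zero, hQ] at h1
      linear_combination -h1
    · rw [if_neg hk, hμ.order k (Nat.pos_of_ne_zero hk)] at h1
      linear_combination -h1
  obtain ⟨g, hg, rfl⟩ := exists_eq_base hpd
  have hψ : ContDiffOn ℝ ∞ (Function.uncurry fun t x => g (t, x)) ((I : Set ℝ) ×ˢ (J : Set ℝ)) := hg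
  refine ⟨fun t x => g (t, x), (h.isHeatSolution_iff hψ).2 (sub_eq_zero.1 (hcancel _ ?_)), fun M => ?_⟩
  · have h1 := hμ.heat
    obtain ⟨h2, h3⟩ := h.deriv_expTheta hc
    rw [hQ] at h1
    simp only [Derivation.leibniz, h2, h3, zero_add, smul_eq_mul, mul_zero] at h1
    change h.expTheta * (pt (base g hg) - coeff h.smooth * px (px (base g hg))) = 0
    linear_combination h1
  · rw [hQ]
    exact h.restricts_lift_iff hψ M

/-- For constant `f`, every solution `ψ` of the heat equation yields exactly one conservation law. -/
theorem existsUnique_law (h : PotentialData I J f lam) (hc : ∃ c : ℝ, ∀ t ∈ I, ∀ x ∈ J, f t x = c) {ψ : ℝ → ℝ → ℝ}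
    (hψ : IsHeatSolution I J f ψ) :
    ∃! C : ConservationLaws (box I J) (potentialEquation f lam),
      IsReducedCharacteristic C fun j => ψ j.1.1 j.1.2 *
        Real.exp (j.2 (0, 0, 0) / (2 * f j.1.1 j.1.2 * lam j.1.1)) := by
  have hheat := (h.isHeatSolution_iff hψ.1).1 hψ
  obtain ⟨h2, h3⟩ := h.deriv_expTheta hc
  set Q : DF (box I J) ℕ := coeff hψ.1 with hQ
  have hQpd : ∀ k, pd k Q = 0 := pd_coeff hψ.1
  have hrestr := (h.restricts_lift_iff hψ.1 _).2 fun j _ => rfl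
  obtain ⟨hcons, hchar⟩ := h.potentialCoeffs.conserved (ζ := h.zeta) (μ := Q * h.expTheta)
    h.zeta_mul_theta (by
      obtain ⟨c, hc⟩ := hc
      rw [h.coeff_eq_algebraMap hc, Derivation.map_algebraMap]) (h.deriv_zeta hc _).2
    (h.deriv_zeta hc _).1 (fun k => by simp [zeta, pd_coeff, timeFun]) (fun k hk => by
      rw [Derivation.leibniz, h.pd_expTheta, if_neg (by omega), hQpd, smul_zero, smul_zero, add_zero])
    (by
      rw [Derivation.leibniz, h.pd_expTheta, if_pos rfl, hQpd, smul_zero, add_zero, smul_eq_mul]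
      ring)
    (by
      simp only [Derivation.leibniz, h2, h3, zero_add, smul_eq_mul, hheat, mul_zero]
      ring)
  refine ⟨hcons.law h.restricts, (hcons.isReducedCharacteristic_iff h.restricts).2 ?_, fun C' hC' => ?_⟩
  · rw [hchar]
    exact hrestr
  · obtain ⟨ρ, σ, hρσ, rfl⟩ := h.potentialCoeffs.quasilinear.exists_law h.restricts C'
    rw [Conserved.law_eq_iff, hchar]
    exact eq_of_restricts_lift ((hρσ.isReducedCharacteristic_iff h.restricts).1 hC') hrestr

end constant

end PotentialData

end

end DF

/-! ### The potential system and the potential equation -/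

namespace DF

section equivalence

variable {Ω : TopologicalSpace.Opens (ℝ × ℝ)} {n n' m m' : ℕ}

theorem iterate_coord (i : Fin n) (a b : ℕ) :
    Dt^[a] (Dx^[b] (coord (i, 0, 0))) = (coord (i, a, b) : DF Ω (Fin n × ℕ × ℕ)) := by
  induction a with
  | zero =>
    induction b with
    | zero => rfl
    | succ b ih =>
      rw [Function.iterate_zero, id] at ih ⊢
      rw [Function.iterate_succ_apply', ih, Dx_coord]
  | succ a ih => rw [Function.iterate_succ_apply', ih, Dt_coord]

/-- A substitution that is compatible with the total derivatives. -/
structure IsProlonged (P : Fin n' × ℕ × ℕ → DF Ω (Fin n × ℕ × ℕ)) : Prop where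
  dt : ∀ c, Dt (P c) = P (c.1, c.2.1 + 1, c.2.2)
  dx : ∀ c, Dx (P c) = P (c.1, c.2.1, c.2.2 + 1)

namespace IsProlonged

variable {P : Fin n' × ℕ × ℕ → DF Ω (Fin n × ℕ × ℕ)}

theorem subst_Dt (h : IsProlonged P) (F : DF Ω (Fin n' × ℕ × ℕ)) : subst P (Dt F) = Dt (subst P F) :=
  (vf_subst (fun c => h.dt c) F).symm

theorem subst_Dx (h : IsProlonged P) (F : DF Ω (Fin n' × ℕ × ℕ)) : subst P (Dx F) = Dx (subst P F) :=
  (vf_subst (fun c => h.dx c) F).symm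

theorem subst_iterate (h : IsProlonged P) (a b : ℕ) (F : DF Ω (Fin n' × ℕ × ℕ)) :
    subst P (Dt^[a] (Dx^[b] F)) = Dt^[a] (Dx^[b] (subst P F)) := by
  rw [Function.Semiconj.iterate_right (f := subst P) (fun F => h.subst_Dt F) a,
    Function.Semiconj.iterate_right (f := subst P) (fun F => h.subst_Dx F) b]

theorem substPoint_mem_manifold (h : IsProlonged P) {A : Fin m' → DF Ω (Fin n' × ℕ × ℕ)}
    {j : JetOver Ω (Fin n × ℕ × ℕ)}
    (hj : ∀ k a b, (Dt^[a] (Dx^[b] (subst P (A k))) : DF Ω _) j = 0) : substPoint P j ∈ manifold A :=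
  fun k a b => (congrArg (fun F : DF Ω _ => F j) (h.subst_iterate a b (A k))).trans (hj k a b)

end IsProlonged

/-- The jet coordinates of `v` as functions of the jets of `(u, v)`. -/
def secondCoord (c : Fin 1 × ℕ × ℕ) : DF Ω (Fin 2 × ℕ × ℕ) := coord (1, c.2)

theorem isProlonged_secondCoord : IsProlonged (secondCoord (Ω := Ω)) where
  dt _ := Dt_coord _
  dx _ := Dx_coord _

/-- The jet coordinates of `(u, v)` as functions of the jets of `v`, if `u = w`. -/
def eliminate (w : DF Ω (Fin 1 × ℕ × ℕ)) (c : Fin 2 × ℕ × ℕ) : DF Ω (Fin 1 × ℕ × ℕ) :=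
  ![Dt^[c.2.1] (Dx^[c.2.2] w), coord (0, c.2)] c.1

theorem isProlonged_eliminate (w : DF Ω (Fin 1 × ℕ × ℕ)) : IsProlonged (eliminate w) where
  dt := by
    rintro ⟨i, a, b⟩
    fin_cases i
    · exact (Function.iterate_succ_apply' _ _ _).symm
    · exact Dt_coord _
  dx := by
    rintro ⟨i, a, b⟩
    fin_cases i
    · change Dx (Dt^[a] (Dx^[b] w)) = Dt^[a] (Dx^[b + 1] w)
      rw [Function.iterate_succ_apply']
      exact Function.Commute.iterate_right (f := (Dx : DF Ω (Fin 1 × ℕ × ℕ) → _)) (g := Dt)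
        (fun F => (Dt_Dx F).symm) a _
    · exact Dx_coord _

theorem substPoint_secondCoord_eliminate (w : DF Ω (Fin 1 × ℕ × ℕ)) (j : JetOver Ω (Fin 1 × ℕ × ℕ)) :
    substPoint secondCoord (substPoint (eliminate w) j) = j :=
  Prod.ext rfl (funext fun ⟨i, a, b⟩ => by rw [Subsingleton.elim i 0]; rfl)

theorem Restricts.liftV {F : Jet 1 → ℝ} {A : DF Ω (Fin 1 × ℕ × ℕ)} (h : Restricts F A) :
    Restricts (liftV F) (subst secondCoord A) := fun j hj => h (j.1, fun c => j.2 (1, c.2)) hj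

/-- The system `A'` for `(u, v)` arises from the equations `A` for `v` by adjoining the equation `u = w`, where
`w` is a differential function of `v`. -/
structure IsExtensionBy (A : Fin m → DF Ω (Fin 1 × ℕ × ℕ)) (A' : Fin m' → DF Ω (Fin 2 × ℕ × ℕ))
    (w : DF Ω (Fin 1 × ℕ × ℕ)) : Prop where
  mem_of_mem : ∀ j ∈ manifold A, substPoint (eliminate w) j ∈ manifold A'
  proj_mem : ∀ j ∈ manifold A', substPoint secondCoord j ∈ manifold A
  eliminate_proj : ∀ j ∈ manifold A', substPoint (eliminate w) (substPoint secondCoord j) = j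

/-- `liftV` for pairs of functions, as a linear map. -/
def liftVPair : ((Jet 1 → ℝ) × (Jet 1 → ℝ)) →ₗ[ℝ] ((Jet 2 → ℝ) × (Jet 2 → ℝ)) :=
  (LinearMap.funLeft ℝ ℝ fun j : Jet 2 => ((j.1, fun c => j.2 (1, c.2)) : Jet 1)).prodMap
    (LinearMap.funLeft ℝ ℝ fun j : Jet 2 => ((j.1, fun c => j.2 (1, c.2)) : Jet 1))

namespace IsExtensionBy

variable {E : Fin m → Jet 1 → ℝ} {E' : Fin m' → Jet 2 → ℝ} {A : Fin m → DF Ω (Fin 1 × ℕ × ℕ)}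
  {A' : Fin m' → DF Ω (Fin 2 × ℕ × ℕ)} {w : DF Ω (Fin 1 × ℕ × ℕ)}

theorem liftVPair_mem_conservedVectors (h : IsExtensionBy A A' w) (hE : ∀ k, Restricts (E k) (A k))
    (hE' : ∀ k, Restricts (E' k) (A' k)) {F : (Jet 1 → ℝ) × (Jet 1 → ℝ)}
    (hF : F ∈ conservedVectors Ω E) : liftVPair F ∈ conservedVectors Ω E' := by
  obtain ⟨R, hR⟩ := isDiffFun_iff.1 hF.1
  obtain ⟨S, hS⟩ := isDiffFun_iff.1 hF.2.1
  refine (mem_conservedVectors (F := liftVPair F) hE' hR.liftV hS.liftV).2 fun j hj => ?_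
  rw [← isProlonged_secondCoord.subst_Dt, ← isProlonged_secondCoord.subst_Dx, ← map_add]
  exact (mem_conservedVectors hE hR hS).1 hF _ (h.proj_mem j hj)

theorem liftVPair_mem_trivialVectors_iff (h : IsExtensionBy A A' w) (hE : ∀ k, Restricts (E k) (A k))
    (hE' : ∀ k, Restricts (E' k) (A' k)) {F : (Jet 1 → ℝ) × (Jet 1 → ℝ)}
    (hF : F ∈ conservedVectors Ω E) : liftVPair F ∈ trivialVectors Ω E' ↔ F ∈ trivialVectors Ω E := by
  obtain ⟨R, hR⟩ := isDiffFun_iff.1 hF.1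
  obtain ⟨S, hS⟩ := isDiffFun_iff.1 hF.2.1
  rw [mem_trivialVectors (F := liftVPair F) hE' hR.liftV hS.liftV, mem_trivialVectors hE hR hS]
  constructor
  · rintro ⟨G, H, h1, h2⟩
    refine ⟨subst (eliminate w) G, subst (eliminate w) H, ?_, fun j hj => ?_⟩
    · rw [← (isProlonged_eliminate w).subst_Dt, ← (isProlonged_eliminate w).subst_Dx, ← map_add, h1, map_zero]
    · have h3 := h2 _ (h.mem_of_mem j hj)
      have h4 := substPoint_secondCoord_eliminate w j
      exact ⟨(congrArg R.1 h4).symm.trans h3.1, (congrArg S.1 h4).symm.trans h3.2⟩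
  · rintro ⟨G, H, h1, h2⟩
    refine ⟨subst secondCoord G, subst secondCoord H, ?_, fun j hj => h2 _ (h.proj_mem j hj)⟩
    rw [← isProlonged_secondCoord.subst_Dt, ← isProlonged_secondCoord.subst_Dx, ← map_add, h1, map_zero]

/-- Regarding functions of the jets of `v` as functions of the jets of `(u, v)` identifies the conservation laws
of the two systems. -/
theorem exists_linearEquiv (h : IsExtensionBy A A' w) (hE : ∀ k, Restricts (E k) (A k))
    (hE' : ∀ k, Restricts (E' k) (A' k)) :
    ∃ Φ : ConservationLaws Ω E ≃ₗ[ℝ] ConservationLaws Ω E', ∀ F : conservedVectors Ω E,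
      ∃ G : conservedVectors Ω E', G.1 = (GenBurgers.liftV F.1.1, GenBurgers.liftV F.1.2) ∧
        Φ (conservationLaw F) = conservationLaw G := by
  let L : conservedVectors Ω E →ₗ[ℝ] conservedVectors Ω E' :=
    liftVPair.restrict fun F hF => h.liftVPair_mem_conservedVectors hE hE' hF
  let Ψ := Submodule.mapQ ((trivialVectors Ω E).submoduleOf (conservedVectors Ω E))
    ((trivialVectors Ω E').submoduleOf (conservedVectors Ω E')) L
    fun F hF => (h.liftVPair_mem_trivialVectors_iff hE hE' F.2).2 hF
  have hinj : Function.Injective Ψ := by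
    rw [← LinearMap.ker_eq_bot, LinearMap.ker_eq_bot']
    intro C hC
    obtain ⟨F, rfl⟩ := Submodule.Quotient.mk_surjective _ C
    exact (Submodule.Quotient.mk_eq_zero _).2 ((h.liftVPair_mem_trivialVectors_iff hE hE' F.2).1
      ((Submodule.Quotient.mk_eq_zero ((trivialVectors Ω E').submoduleOf (conservedVectors Ω E'))
        (x := L F)).1 hC))
  have hsurj : Function.Surjective Ψ := by
    intro C
    obtain ⟨F, rfl⟩ := Submodule.Quotient.mk_surjective _ C
    obtain ⟨R, hR⟩ := isDiffFun_iff.1 F.2.1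
    obtain ⟨S, hS⟩ := isDiffFun_iff.1 F.2.2.1
    have hR' := restricts_extend (subst (eliminate w) R)
    have hS' := restricts_extend (subst (eliminate w) S)
    refine ⟨conservationLaw ⟨(extend (subst (eliminate w) R).1, extend (subst (eliminate w) S).1),
      (mem_conservedVectors hE hR' hS').2 fun j hj => ?_⟩, conservationLaw_eq_iff.2 ?_⟩
    · rw [← (isProlonged_eliminate w).subst_Dt, ← (isProlonged_eliminate w).subst_Dx, ← map_add]
      exact (mem_conservedVectors hE' hR hS).1 F.2 _ (h.mem_of_mem j hj)
    · refine (mem_trivialVectors hE' (hR'.liftV.sub hR) (hS'.liftV.sub hS)).2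
        ⟨0, 0, by simp, fun j hj => ?_⟩
      have h1 : ∀ F : DF Ω (Fin 2 × ℕ × ℕ),
          (subst secondCoord (subst (eliminate w) F) - F : DF Ω _) j = 0 := fun F =>
        sub_eq_zero.2 (congrArg F.1 (h.eliminate_proj j hj))
      exact ⟨h1 R, h1 S⟩
  exact ⟨LinearEquiv.ofBijective Ψ ⟨hinj, hsurj⟩, fun F => ⟨L F, rfl, rfl⟩⟩

end IsExtensionBy

end equivalence

namespace PotentialData

variable {I J : TopologicalSpace.Opens ℝ} {f : ℝ → ℝ → ℝ} {lam : ℝ → ℝ} (h : PotentialData I J f lam)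

/-- `1 / λ`. -/
def lamInv : DF (box I J) (Fin 1 × ℕ × ℕ) :=
  timeFun (L := fun t => (lam t)⁻¹) (h.lam_smooth.inv h.lam_ne_zero)

/-- The left-hand side of the potential equation. -/
def equation : DF (box I J) (Fin 1 × ℕ × ℕ) :=
  coord (0, 1, 0) + algebraMap ℝ _ 2⁻¹ * h.lamInv * coord (0, 0, 1) ^ 2 + coeff h.smooth * coord (0, 0, 2)
    - Dx (coeff h.smooth) * coord (0, 0, 1)

/-- The left-hand sides of the equations of the potential system. -/
def system : Fin 2 → DF (box I J) (Fin 2 × ℕ × ℕ) :=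
  ![coord (1, 0, 1) - timeFun h.lam_smooth * coord (0, 0, 0),
    coord (1, 1, 0) + timeFun h.lam_smooth * (algebraMap ℝ _ 2⁻¹ * coord (0, 0, 0) ^ 2
      + coeff h.smooth * coord (0, 0, 1) - Dx (coeff h.smooth) * coord (0, 0, 0))]

theorem Dx_coeff_apply {n : ℕ} (j : JetOver (box I J) (Fin n × ℕ × ℕ)) :
    Dx (coeff h.smooth) j = fx f j.1.1.1 j.1.1.2 :=
  (hasDerivAt_vf_x (F := coeff h.smooth) (fun _ => rfl) _ j).deriv.symm

theorem restricts_equation (k : Fin 1) : Restricts (potentialEquation f lam k) h.equation := by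
  intro j hj
  simp only [potentialEquation, equation, sub_apply, add_apply, mul_apply, pow_apply, coord_apply,
    h.Dx_coeff_apply, coeff_apply, lamInv, timeFun_apply]
  change _ = _ + 2⁻¹ * _ * _ + _ - _
  rw [div_eq_mul_inv, mul_inv]
  ring

theorem restricts_system (k : Fin 2) : Restricts (potentialSystem f lam k) (h.system k) := by
  intro j hj
  fin_cases k
  · rfl
  · change _ = (_ : ℝ) + lam j.1.1 * (2⁻¹ * j.2 (0, 0, 0) ^ 2 + f j.1.1 j.1.2 * j.2 (0, 0, 1) -
      Dx (coeff h.smooth : DF (box I J) (Fin 2 × ℕ × ℕ)) (⟨j.1, hj⟩, j.2) * j.2 (0, 0, 0))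
    rw [h.Dx_coeff_apply, inv_mul_eq_div]
    rfl

theorem Dx_timeFun {n : ℕ} {L : ℝ → ℝ} (hL : ContDiffOn ℝ ∞ L I) :
    Dx (timeFun hL : DF (box I J) (Fin n × ℕ × ℕ)) = 0 := ext fun j =>
  (hasDerivAt_vf_x (F := (timeFun hL : DF (box I J) (Fin n × ℕ × ℕ))) (h := fun t _ => L t)
    (fun _ => rfl) _ j).unique (hasDerivAt_const _ _)

/-- Elimination of `u = v_x / λ` turns the potential system into the potential equation. -/
theorem isExtensionBy : IsExtensionBy (fun _ : Fin 1 => h.equation) h.system (h.lamInv * coord (0, 0, 1)) := by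
  set w : DF (box I J) (Fin 1 × ℕ × ℕ) := h.lamInv * coord (0, 0, 1) with hw
  have hhalf : ∀ {ι : Type}, 2 * algebraMap ℝ (DF (box I J) ι) 2⁻¹ = 1 := fun {ι} => by
    rw [← map_ofNat (algebraMap ℝ (DF (box I J) ι)) 2, ← map_mul, mul_inv_cancel₀ two_ne_zero, map_one]
  have hinv : (timeFun h.lam_smooth : DF (box I J) (Fin 1 × ℕ × ℕ)) * h.lamInv = 1 :=
    ext fun j => mul_inv_cancel₀ (h.lam_ne_zero _ j.1.2.1)
  -- on the manifold of the system, the equation for `v` is a combination of the equations of the system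
  have hproj : ∀ j ∈ manifold h.system, ∀ a b : ℕ,
      (Dt^[a] (Dx^[b] (subst secondCoord h.equation)) : DF (box I J) _) j = 0 := by
    intro j hj a b
    have h0 : ∀ a b, (Dt^[a] (Dx^[b] (Dx (h.system 0))) : DF (box I J) _) j = 0 := fun a b => by
      rw [← Function.iterate_succ_apply]; exact hj 0 a (b + 1)
    have h1 : subst secondCoord h.equation = h.system 1 +
        (algebraMap ℝ _ 2⁻¹ * subst secondCoord h.lamInv * h.system 0 + coord (0, 0, 0)
          - Dx (coeff h.smooth)) * h.system 0 + coeff h.smooth * Dx (h.system 0) := by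
      have h2 : Dx (h.system 0) = coord (1, 0, 2) - timeFun h.lam_smooth * coord (0, 0, 1) := by
        change Dx (coord (1, 0, 1) - timeFun h.lam_smooth * coord (0, 0, 0)) = _
        rw [map_sub, Derivation.leibniz, Dx_timeFun, smul_zero, add_zero, Dx_coord, Dx_coord, smul_eq_mul]
      have h3 : (timeFun h.lam_smooth : DF (box I J) (Fin 2 × ℕ × ℕ)) * subst secondCoord h.lamInv = 1 :=
        congrArg (subst secondCoord) hinv
      rw [h2, equation]
      simp only [map_add, map_sub, map_mul, map_pow, isProlonged_secondCoord.subst_Dx, subst_coord]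
      change coord (1, 1, 0) + algebraMap ℝ _ 2⁻¹ * _ * coord (1, 0, 1) ^ 2 + coeff h.smooth * coord (1, 0, 2)
        - Dx (coeff h.smooth) * coord (1, 0, 1) = coord (1, 1, 0) + timeFun h.lam_smooth *
          (algebraMap ℝ _ 2⁻¹ * coord (0, 0, 0) ^ 2 + coeff h.smooth * coord (0, 0, 1)
            - Dx (coeff h.smooth) * coord (0, 0, 0)) + (algebraMap ℝ _ 2⁻¹ * _ *
          (coord (1, 0, 1) - timeFun h.lam_smooth * coord (0, 0, 0)) + coord (0, 0, 0)
          - Dx (coeff h.smooth)) * (coord (1, 0, 1) - timeFun h.lam_smooth * coord (0, 0, 0)) + _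
      generalize subst secondCoord h.lamInv = κ at *
      generalize (timeFun h.lam_smooth : DF (box I J) (Fin 2 × ℕ × ℕ)) = l at *
      set r := algebraMap ℝ (DF (box I J) (Fin 2 × ℕ × ℕ)) 2⁻¹
      linear_combination (2 * r * coord (0, 0, 0) * coord (1, 0, 1) - r * l * coord (0, 0, 0) ^ 2) * h3
        + (coord (0, 0, 0) * coord (1, 0, 1) - l * coord (0, 0, 0) ^ 2) *
          (hhalf : 2 * algebraMap ℝ (DF (box I J) (Fin 2 × ℕ × ℕ)) 2⁻¹ = 1)
    rw [h1, iterate_map_add, iterate_map_add, iterate_map_add, iterate_map_add, add_apply, add_apply,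
      hj 1 a b, iterate_mul_eq_zero (hj 0), iterate_mul_eq_zero h0, add_zero, add_zero]
  refine ⟨fun j hj => (isProlonged_eliminate w).substPoint_mem_manifold fun k a b => ?_,
    fun j hj => isProlonged_secondCoord.substPoint_mem_manifold fun _ => hproj j hj, fun j hj => ?_⟩
  · fin_cases k
    · have h1 : subst (eliminate w) (h.system 0) = 0 := by
        change coord (0, 0, 1) - timeFun h.lam_smooth * w = 0
        linear_combination (-coord (0, 0, 1)) * hinv
      change (Dt^[a] (Dx^[b] (subst (eliminate w) (h.system 0))) : DF (box I J) _) j = 0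
      rw [h1, iterate_map_zero, iterate_map_zero]
      rfl
    · have h1 : subst (eliminate w) (h.system 1) = h.equation := by
        change coord (0, 1, 0) + timeFun h.lam_smooth * (algebraMap ℝ _ 2⁻¹ * w ^ 2
          + coeff h.smooth * Dx w - subst (eliminate w) (Dx (coeff h.smooth)) * w) = _
        rw [(isProlonged_eliminate w).subst_Dx, hw, Derivation.leibniz, lamInv, Dx_timeFun, smul_zero,
          add_zero, Dx_coord, smul_eq_mul]
        change coord (0, 1, 0) + timeFun h.lam_smooth * (algebraMap ℝ _ 2⁻¹ * (h.lamInv * coord (0, 0, 1)) ^ 2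
          + coeff h.smooth * (h.lamInv * coord (0, 0, 2)) - Dx (coeff h.smooth) *
            (h.lamInv * coord (0, 0, 1))) = h.equation
        rw [equation]
        linear_combination (algebraMap ℝ _ 2⁻¹ * h.lamInv * coord (0, 0, 1) ^ 2 +
          coeff h.smooth * coord (0, 0, 2) - Dx (coeff h.smooth) * coord (0, 0, 1)) * hinv
      change (Dt^[a] (Dx^[b] (subst (eliminate w) (h.system 1))) : DF (box I J) _) j = 0
      rw [h1]
      exact hj 0 a b
  · refine Prod.ext rfl (funext fun ⟨i, a, b⟩ => ?_)
    fin_cases i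
    · have h1 : subst secondCoord w - coord (0, 0, 0) = subst secondCoord h.lamInv * h.system 0 := by
        have h3 : (timeFun h.lam_smooth : DF (box I J) (Fin 2 × ℕ × ℕ)) * subst secondCoord h.lamInv = 1 :=
          congrArg (subst secondCoord) hinv
        change subst secondCoord h.lamInv * coord (1, 0, 1) - coord (0, 0, 0) = _ *
          (coord (1, 0, 1) - timeFun h.lam_smooth * coord (0, 0, 0))
        linear_combination coord (0, 0, 0) * h3
      have h2 := iterate_mul_eq_zero (hj 0) (subst secondCoord h.lamInv) a b
      rw [← h1, iterate_map_sub, iterate_map_sub, iterate_coord, ← isProlonged_secondCoord.subst_iterate] at h2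
      exact sub_eq_zero.1 h2
    · rfl

end PotentialData

end DF

end GenBurgers

end


theorem mainTheorem6 (I J : TopologicalSpace.Opens ℝ)
    (hI : (I : Set ℝ).Nonempty) (hIc : (I : Set ℝ).OrdConnected)
    (hJ : (J : Set ℝ).Nonempty) (hJc : (J : Set ℝ).OrdConnected)
    (f : ℝ → ℝ → ℝ)
    (hf : ContDiffOn ℝ ∞ (Function.uncurry f) ((I : Set ℝ) ×ˢ (J : Set ℝ)))
    (hf0 : ∀ t ∈ I, ∀ x ∈ J, f t x ≠ 0) :
    -- nontrivial local conservation laws exist if and only if `f_xxx = 0`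
    (Nontrivial (ConservationLaws (box I J) (burgers f)) ↔
      ∀ t ∈ I, ∀ x ∈ J, fxxx f t x = 0) ∧
    ((∀ t ∈ I, ∀ x ∈ J, fxxx f t x = 0) →
      -- the space of conservation laws is one-dimensional, with characteristic `exp (∫ f_xx dt)`
      (Module.finrank ℝ (ConservationLaws (box I J) (burgers f)) = 1 ∧
        (∃ A : ℝ → ℝ, ∀ t ∈ I, ∀ x ∈ J, HasDerivAt A (fxx f t x) t) ∧
        ∀ A : ℝ → ℝ, (∀ t ∈ I, ∀ x ∈ J, HasDerivAt A (fxx f t x) t) →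
          ∃ C : ConservationLaws (box I J) (burgers f), C ≠ 0 ∧
            ∀ (a : ℝ) (μ : Jet 1 → ℝ),
              IsReducedCharacteristic (a • C) μ ↔
                ∀ j : Jet 1, j.1 ∈ box I J → μ j = a * Real.exp (A j.1.1)) ∧
      -- potential conservation laws
      ∀ lam : ℝ → ℝ, (∀ t ∈ I, lam t ≠ 0) →
        (∀ t ∈ I, ∀ x ∈ J, HasDerivAt lam (fxx f t x * lam t) t) →
        -- those of the potential system are the same as those of the potential equation
        (∃ Φ : ConservationLaws (box I J) (potentialEquation f lam) ≃ₗ[ℝ]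
              ConservationLaws (box I J) (potentialSystem f lam),
          ∀ F : conservedVectors (box I J) (potentialEquation f lam),
            ∃ G : conservedVectors (box I J) (potentialSystem f lam),
              G.1 = (liftV F.1.1, liftV F.1.2) ∧
              Φ (conservationLaw F) = conservationLaw G) ∧
        -- nonconstant `f`
        ((∀ U : Set (ℝ × ℝ), IsOpen U → U.Nonempty → U ⊆ (I : Set ℝ) ×ˢ (J : Set ℝ) →
            ¬ ∃ c : ℝ, ∀ p ∈ U, f p.1 p.2 = c) →
          Subsingleton (ConservationLaws (box I J) (potentialSystem f lam)) ∧
          Subsingleton (ConservationLaws (box I J) (potentialEquation f lam))) ∧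
        -- constant `f`
        ((∃ c : ℝ, ∀ t ∈ I, ∀ x ∈ J, f t x = c) →
          (∀ C : ConservationLaws (box I J) (potentialEquation f lam),
            ∃ ψ : ℝ → ℝ → ℝ, IsHeatSolution I J f ψ ∧
              ∀ μ : Jet 1 → ℝ, IsReducedCharacteristic C μ ↔
                ∀ j : Jet 1, j.1 ∈ box I J →
                  μ j = ψ j.1.1 j.1.2 *
                    Real.exp (j.2 (0, 0, 0) / (2 * f j.1.1 j.1.2 * lam j.1.1))) ∧
          ∀ ψ : ℝ → ℝ → ℝ, IsHeatSolution I J f ψ →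
            ∃! C : ConservationLaws (box I J) (potentialEquation f lam),
              IsReducedCharacteristic C fun j =>
                ψ j.1.1 j.1.2 *
                  Real.exp (j.2 (0, 0, 0) / (2 * f j.1.1 j.1.2 * lam j.1.1))))
  := by
  have hE := fun A hA => DF.exists_burgers_law hf hIc hJc hI hJ hf0 (A := A) hA
  refine ⟨⟨DF.fxxx_eq_zero_of_nontrivial hf hIc hJc hf0, fun h3 => ?_⟩, fun h3 => ⟨⟨?_, ?_, ?_⟩, ?_⟩⟩
  · obtain ⟨A, hA⟩ := DF.exists_antideriv_fxx hf hIc hJc hJ h3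
    obtain ⟨C, hC, -⟩ := hE A hA
    exact ⟨C, 0, hC⟩
  · obtain ⟨A, hA⟩ := DF.exists_antideriv_fxx hf hIc hJc hJ h3
    obtain ⟨C, hC, hspan, -⟩ := hE A hA
    exact finrank_eq_one C hC hspan
  · exact DF.exists_antideriv_fxx hf hIc hJc hJ h3
  · intro A hA
    obtain ⟨C, hC, -, hchar⟩ := hE A hA
    exact ⟨C, hC, hchar⟩
  · intro lam hlam hderiv
    have h : DF.PotentialData I J f lam :=
      ⟨hf, hf0, DF.contDiffOn_of_multiplier hf hJ hderiv, hlam, hderiv⟩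
    obtain ⟨Φ, hΦ⟩ := h.isExtensionBy.exists_linearEquiv h.restricts_equation h.restricts_system
    refine ⟨⟨Φ, hΦ⟩, fun hnc => ?_, fun hc => ⟨h.exists_heatSolution hc, fun ψ hψ => h.existsUnique_law hc hψ⟩⟩
    have := h.subsingleton_of_nonconstant hnc
    exact ⟨Φ.symm.injective.subsingleton, this⟩
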